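/- **Setting.** Let $(\tau,\rho)$ with $|\tau|<1$, $0\le\rho<\rho_0$ be the F-coordinates of Minkowski space near the cylinder at spatial infinity $\{\rho=0\}$; null infinity $\mathscr I^{\pm}$ is at $\tau=\pm1$. Let $Y_{s;\ell,m}$ be the orthonormal spin-weighted spherical harmonics on $\mathbb S^2$ ($Y_{s;\ell,m}=0$ unless $|s|,|m|\le\ell$), with $\eth Y_{s;\ell,m}=\sqrt{(\ell-s)(\ell+s+1)}\,Y_{s+1;\ell,m}$ and $\bar\eth Y_{s;\ell,m}=-\sqrt{(\ell+s)(\ell-s+1)}\,Y_{s-1;\ell,m}$. Let $\phi_0,\dots,\phi_4$ be functions of $(\tau,\rho)$ and of a point of $\mathbb S^2$, smooth up to and including $\rho=0$, $\phi_n$ of spin weight $2-n$, with Taylor expansion at $\rho=0$ $$\phi_n=\sum_{p\ge|2-n|}\ \sum_{\ell=|2-n|}^{p}\ \sum_{m=-\ell}^{\ell}\frac1{p!}\,a_{n,p;\ell,m}(\tau)\,Y_{2-n;\ell-1,m}\,\rho^p ,$$ that is, $\partial_\rho^p\phi_n|_{\rho=0}=\sum_{\ell,m}a_{n,p;\ell,m}Y_{2-n;\ell-1,m}$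 for all $p$, where $a_{n,p;\ell,m}:=0$ if $\ell-1<|2-n|$ or $\ell-1<|m|$. Suppose that the $\phi_n$ satisfy the massless spin-2 equations in the F-gauge for $\rho>0$: $$(1+\tau)\partial_\tau\phi_0-\rho\partial_\rho\phi_0+\eth\phi_1=-2\phi_0,\qquad \partial_\tau\phi_1+\tfrac12\bar\eth\phi_0+\tfrac12\eth\phi_2=-\phi_1,\qquad \partial_\tau\phi_2+\tfrac12\bar\eth\phi_1+\tfrac12\eth\phi_3=0,$$ $$\partial_\tau\phi_3+\tfrac12\bar\eth\phi_2+\tfrac12\eth\phi_4=\phi_3,\qquad (1-\tau)\partial_\tau\phi_4+\rho\partial_\rho\phi_4+\bar\eth\phi_3=2\phi_4,$$ $$\tau\partial_\tau\phi_k-\rho\partial_\rho\phi_k+\tfrac12\eth\phi_{k+1}-\tfrac12\bar\eth\phi_{k-1}=0\qquad(k=1,2,3);$$ or, alternatively, that instead of these equations the coefficients with $3\le\ell\le p$, $|m|\le\ell$ satisfy the transport equations (labels $p;\ell,m$ suppressed, $\lambda_1=\sqrt{(\ell-1)(\ell+2)}$, $\lambda_0=\sqrt{\ell(\ell+1)}$,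 $|\tau|<1$) $$(1+\tau)\dot a_0+\lambda_1a_1-(p-2)a_0=0,\quad \dot a_1-\tfrac12\lambda_1a_0+\tfrac12\lambda_0a_2+a_1=0,\quad \dot a_2-\tfrac12\lambda_0a_1+\tfrac12\lambda_0a_3=0,$$ $$\dot a_3-\tfrac12\lambda_0a_2+\tfrac12\lambda_1a_4-a_3=0,\quad (1-\tau)\dot a_4-\lambda_1a_3+(p-2)a_4=0,$$ $$\tau\dot a_1+\tfrac12\lambda_0a_2+\tfrac12\lambda_1a_0-pa_1=0,\quad \tau\dot a_2+\tfrac12\lambda_0a_3+\tfrac12\lambda_0a_1-pa_2=0,\quad \tau\dot a_3+\tfrac12\lambda_1a_4+\tfrac12\lambda_0a_2-pa_3=0.$$ *Time symmetry:* $a_{0,p;p,m}(0)=-a_{4,p;p,m}(0)$ for all $p\ge3$, $|m|\le p$. *Regularity condition:* for all $p\ge3$, $|m|\le p$ there are constants $C,C^\circledast,D,D^\circledast$ (depending on $p,m$) with $C^\circledast=D^\circledast=0$ such that, for $|\tau|<1$, $$a_{0,p;p,m}(\tau)=\Big(\tfrac{1-\tau}2\Big)^{p+2}\Big(\tfrac{1+\tau}2\Big)^{p-2}\Big(C+C^\circledast\!\int_0^\tau\!\tfrac{ds}{(1+s)^{p-1}(1-s)^{p+3}}\Big),$$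 $$a_{4,p;p,m}(\tau)=\Big(\tfrac{1+\tau}2\Big)^{p+2}\Big(\tfrac{1-\tau}2\Big)^{p-2}\Big(D+D^\circledast\!\int_0^\tau\!\tfrac{ds}{(1-s)^{p-1}(1+s)^{p+3}}\Big).$$ *NP constants:* for $n\ge0$, $|m|\le n+2$, $$G^{n\,+}_m=\lim_{\tau\to1^-}\lim_{\rho\to0^+}\frac{(-1)^{n+1}}{(n+1)!\,2^{(n+1)/2}}\int_{\mathbb S^2}\overline{Y_{2;n+2,m}}\;(\boldsymbol e'_{+})^{n+1}\!\left(\frac{\phi_0}{\rho^2(1-\tau)^4}\right)dS,\qquad \boldsymbol e'_{+}=\frac{\sqrt2}{2}\,\frac{(1-\tau)\partial_\tau+\rho\,\partial_\rho}{\rho(1-\tau)^2},$$ and $G^{n\,-}_m$ is the time dual, obtained by $\tau\to-\tau$, $\partial_\tau\to-\partial_\tau$, $\phi_0\to\phi_4$, $Y_{2;n+2,m}\to Y_{-2;n+2,m}$, with the limit $\tau\to-1^+$. **Proposition.** Let the initial data be time-symmetric. 1. If the regularity condition holds, then $a_{0,p;p,m}(0)=a_{4,p;p,m}(0)=0$ for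 all $p\ge3$, $|m|\le p$. 2. If $a_{0,p;p,m}(0)=a_{4,p;p,m}(0)=0$ for all $p\ge3$, $|m|\le p$, then for all $n\ge0$, $|m|\le n+2$ the NP constants $G^{n\,+}_m$ at $\mathscr I^+$ and $G^{n\,-}_m$ at $\mathscr I^-$ are finite (the limits exist) and $G^{n\,+}_m=G^{n\,-}_m=0$. In particular, for time-symmetric data satisfying the regularity condition all NP constants at $\mathscr I^{\pm}$ are finite and vanish. -/

import Mathlib

open Set Filter Topology MeasureTheory
open scoped ContDiff Nat ComplexConjugate

noncomputable section

namespace Spin2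

/-! ### Spin-weighted functions on the unit sphere

A point of the sphere together with a spin frame at it is described by a spinor `o = (z, w) ≠ 0`
up to positive rescaling: the point is the null direction of `o`, the frame vector is
`m = o ῑ`.  A function of spin weight `s` is a function of `o` with
`η (c o) = (c / |c|) ^ (2 s) η (o)`, so that `m ↦ e ^ {i α} m` induces `η ↦ e ^ {i s α} η`. -/

/-- The spinor completing `o` to a spin dyad. -/
def iota (o : ℂ × ℂ) : ℂ × ℂ := (-conj o.2, conj o.1)

/-- Squared Hermitian norm of a spinor. -/
def spinorNormSq (o : ℂ × ℂ) : ℝ := Complex.normSq o.1 + Complex.normSq o.2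

/-- The spin-raising operator `ð`: minus the derivative in the complex direction `m`. -/
def eth (F : ℂ × ℂ → ℂ) (o : ℂ × ℂ) : ℂ :=
  -(1 / 2) * (fderiv ℝ F o (iota o) + Complex.I * fderiv ℝ F o (Complex.I • iota o))

/-- The spin-lowering operator `ð̄`: minus the derivative in the complex direction `m̄`. -/
def ethBar (F : ℂ × ℂ → ℂ) (o : ℂ × ℂ) : ℂ :=
  -(1 / 2) * (fderiv ℝ F o (iota o) - Complex.I * fderiv ℝ F o (Complex.I • iota o))

/-- The spin-weighted spherical harmonic `Y_{s; l, m}`; it is zero unless `|s| ≤ l` and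
`|m| ≤ l`.  For `s = 0` these are the usual orthonormal `Y_{l, m}`; moreover
`ð Y_{s; l, m} = √((l - s)(l + s + 1)) Y_{s + 1; l, m}` and
`ð̄ Y_{s; l, m} = -√((l + s)(l - s + 1)) Y_{s - 1; l, m}`. -/
def Y (s l m : ℤ) (o : ℂ × ℂ) : ℂ :=
  if |s| ≤ l ∧ |m| ≤ l then
    (-1 : ℂ) ^ m *
      ((Real.sqrt ((2 * (l : ℝ) + 1) / (4 * Real.pi) *
        ((((l + s).toNat ! : ℕ) : ℝ) * (((l - s).toNat ! : ℕ) : ℝ)) /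
        ((((l + m).toNat ! : ℕ) : ℝ) * (((l - m).toNat ! : ℕ) : ℝ))) : ℝ) : ℂ) *
      (∑ j ∈ Finset.range ((l - s).toNat + 1),
        (-1 : ℂ) ^ j * (((l - m).toNat.choose j : ℕ) : ℂ) *
          (((l + m).toNat.choose ((l - s).toNat - j) : ℕ) : ℂ) *
          o.1 ^ (l - m - j).toNat * o.2 ^ (s + m + j).toNat *
          conj o.1 ^ ((l - s).toNat - j) * conj o.2 ^ j) /
      ((spinorNormSq o : ℝ) : ℂ) ^ l.toNat
  else 0

/-- The integral over the unit sphere, in polar angles, of a function of spin weight zero. -/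
def sphereIntegral (f : ℂ × ℂ → ℂ) : ℂ :=
  ∫ ϕ in (0 : ℝ)..(2 * Real.pi), ∫ θ in (0 : ℝ)..Real.pi,
    f ((Real.cos (θ / 2) : ℂ), (Real.sin (θ / 2) : ℂ) * Complex.exp (Complex.I * (ϕ : ℂ))) *
      (Real.sin θ : ℂ)

/-! ### The spin-2 field near the cylinder at spatial infinity

The components `Φ n τ ρ o`, `n = 0, …, 4`, have spin weight `2 - n`. -/

/-- The components are smooth for `|τ| < 1`, `0 ≤ ρ < ρ₀`, up to and including the cylinder `ρ = 0`,
have the right spin weights, and have the Taylor expansion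
`Φ_n = ∑_{p ≥ |2-n|} ∑_{l = |2-n|}^p ∑_{m = -l}^l (1 / p!) a_{n,p;l,m}(τ) Y_{2-n; l-1, m} ρ^p`
at `ρ = 0`; coefficients of identically vanishing harmonics are zero by convention. -/
structure HasExpansion (ρ₀ : ℝ) (Φ : Fin 5 → ℝ → ℝ → ℂ × ℂ → ℂ)
    (a : Fin 5 → ℕ → ℤ → ℤ → ℝ → ℂ) : Prop where
  smooth : ∀ n : Fin 5, ContDiffOn ℝ ∞
    (fun q : ℝ × ℝ × (ℂ × ℂ) => Φ n q.1 q.2.1 q.2.2)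
    (Ioo (-1 : ℝ) 1 ×ˢ (Ico (0 : ℝ) ρ₀ ×ˢ {o : ℂ × ℂ | o ≠ 0}))
  spin_weight : ∀ n : Fin 5, ∀ τ ∈ Ioo (-1 : ℝ) 1, ∀ ρ ∈ Ico (0 : ℝ) ρ₀,
    ∀ o : ℂ × ℂ, o ≠ 0 → ∀ c : ℂ, c ≠ 0 →
      Φ n τ ρ (c • o) = (c / (‖c‖ : ℂ)) ^ (2 * (2 - (n : ℤ))) * Φ n τ ρ o
  expansion : ∀ n : Fin 5, ∀ p : ℕ, ∀ τ ∈ Ioo (-1 : ℝ) 1, ∀ o : ℂ × ℂ, o ≠ 0 →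
    iteratedDerivWithin p (fun r => Φ n τ r o) (Ico (0 : ℝ) ρ₀) 0 =
      ∑ l ∈ Finset.Icc |2 - (n : ℤ)| (p : ℤ), ∑ m ∈ Finset.Icc (-l) l,
        a n p l m τ * Y (2 - (n : ℤ)) (l - 1) m o
  unused : ∀ n : Fin 5, ∀ p : ℕ, ∀ l m : ℤ, (l - 1 < |2 - (n : ℤ)| ∨ l - 1 < |m|) →
    ∀ τ : ℝ, a n p l m τ = 0

/-- `∂_τ Φ_n`. -/
def dTau (Φ : Fin 5 → ℝ → ℝ → ℂ × ℂ → ℂ) (n : Fin 5) (τ ρ : ℝ) (o : ℂ × ℂ) : ℂ :=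
  deriv (fun t => Φ n t ρ o) τ

/-- `ρ ∂_ρ Φ_n`. -/
def rhoDRho (Φ : Fin 5 → ℝ → ℝ → ℂ × ℂ → ℂ) (n : Fin 5) (τ ρ : ℝ) (o : ℂ × ℂ) : ℂ :=
  (ρ : ℂ) * deriv (fun r => Φ n τ r o) ρ

/-- The massless spin-2 equations `∇_{A'}^A Φ_{ABCD} = 0` on Minkowski space in the F-gauge:
five evolution equations and three constraints. -/
def FieldEquations (ρ₀ : ℝ) (Φ : Fin 5 → ℝ → ℝ → ℂ × ℂ → ℂ) : Prop :=
  ∀ τ ∈ Ioo (-1 : ℝ) 1, ∀ ρ ∈ Ioo (0 : ℝ) ρ₀, ∀ o : ℂ × ℂ, o ≠ 0 →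
    (1 + (τ : ℂ)) * dTau Φ 0 τ ρ o - rhoDRho Φ 0 τ ρ o + eth (Φ 1 τ ρ) o = -2 * Φ 0 τ ρ o ∧
    dTau Φ 1 τ ρ o + 1 / 2 * ethBar (Φ 0 τ ρ) o + 1 / 2 * eth (Φ 2 τ ρ) o = -Φ 1 τ ρ o ∧
    dTau Φ 2 τ ρ o + 1 / 2 * ethBar (Φ 1 τ ρ) o + 1 / 2 * eth (Φ 3 τ ρ) o = 0 ∧
    dTau Φ 3 τ ρ o + 1 / 2 * ethBar (Φ 2 τ ρ) o + 1 / 2 * eth (Φ 4 τ ρ) o = Φ 3 τ ρ o ∧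
    (1 - (τ : ℂ)) * dTau Φ 4 τ ρ o + rhoDRho Φ 4 τ ρ o + ethBar (Φ 3 τ ρ) o = 2 * Φ 4 τ ρ o ∧
    (τ : ℂ) * dTau Φ 1 τ ρ o - rhoDRho Φ 1 τ ρ o
      + 1 / 2 * eth (Φ 2 τ ρ) o - 1 / 2 * ethBar (Φ 0 τ ρ) o = 0 ∧
    (τ : ℂ) * dTau Φ 2 τ ρ o - rhoDRho Φ 2 τ ρ o
      + 1 / 2 * eth (Φ 3 τ ρ) o - 1 / 2 * ethBar (Φ 1 τ ρ) o = 0 ∧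
    (τ : ℂ) * dTau Φ 3 τ ρ o - rhoDRho Φ 3 τ ρ o
      + 1 / 2 * eth (Φ 4 τ ρ) o - 1 / 2 * ethBar (Φ 2 τ ρ) o = 0

/-- The system of transport equations along the cylinder, with `lam1 = √((l-1)(l+2))` and
`lam0 = √(l(l+1))`, for the coefficients labelled by `3 ≤ l ≤ p`, `|m| ≤ l`. -/
def TransportEquations (a : Fin 5 → ℕ → ℤ → ℤ → ℝ → ℂ) : Prop :=
  ∀ p : ℕ, ∀ l ∈ Finset.Icc (3 : ℤ) p, ∀ m ∈ Finset.Icc (-l) l, ∀ τ ∈ Ioo (-1 : ℝ) 1,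
    let lam1 : ℂ := (Real.sqrt (((l : ℝ) - 1) * ((l : ℝ) + 2)) : ℂ)
    let lam0 : ℂ := (Real.sqrt ((l : ℝ) * ((l : ℝ) + 1)) : ℂ)
    let b : Fin 5 → ℂ := fun n => a n p l m τ
    let db : Fin 5 → ℂ := fun n => deriv (a n p l m) τ
    (1 + (τ : ℂ)) * db 0 + lam1 * b 1 - ((p : ℂ) - 2) * b 0 = 0 ∧
    db 1 - 1 / 2 * lam1 * b 0 + 1 / 2 * lam0 * b 2 + b 1 = 0 ∧
    db 2 - 1 / 2 * lam0 * b 1 + 1 / 2 * lam0 * b 3 = 0 ∧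
    db 3 - 1 / 2 * lam0 * b 2 + 1 / 2 * lam1 * b 4 - b 3 = 0 ∧
    (1 - (τ : ℂ)) * db 4 - lam1 * b 3 + ((p : ℂ) - 2) * b 4 = 0 ∧
    (τ : ℂ) * db 1 + 1 / 2 * lam0 * b 2 + 1 / 2 * lam1 * b 0 - (p : ℂ) * b 1 = 0 ∧
    (τ : ℂ) * db 2 + 1 / 2 * lam0 * b 3 + 1 / 2 * lam0 * b 1 - (p : ℂ) * b 2 = 0 ∧
    (τ : ℂ) * db 3 + 1 / 2 * lam1 * b 4 + 1 / 2 * lam0 * b 2 - (p : ℂ) * b 3 = 0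

/-- Time-symmetric initial data: `a_{0,p;p,m}(0) = -a_{4,p;p,m}(0)` for `p ≥ 3`, `|m| ≤ p`. -/
def TimeSymmetric (a : Fin 5 → ℕ → ℤ → ℤ → ℝ → ℂ) : Prop :=
  ∀ p : ℕ, 3 ≤ p → ∀ m ∈ Finset.Icc (-(p : ℤ)) p, a 0 p p m 0 = -a 4 p p m 0

/-- `f` is the solution with integration constants `C`, `Cs` of the Jacobi equation for
`a_{0,p;p,m}`; the term with `Cs` has logarithmic singularities at `τ = ±1`. -/
def IsJacobi0 (p : ℕ) (C Cs : ℂ) (f : ℝ → ℂ) : Prop :=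
  ∀ τ ∈ Ioo (-1 : ℝ) 1,
    f τ = (((1 - τ) / 2) ^ (p + 2) * ((1 + τ) / 2) ^ (p - 2) : ℝ) *
      (C + Cs * ((∫ s in (0 : ℝ)..τ, 1 / ((1 + s) ^ (p - 1) * (1 - s) ^ (p + 3)) : ℝ) : ℂ))

/-- The same for `a_{4,p;p,m}`. -/
def IsJacobi4 (p : ℕ) (D Ds : ℂ) (f : ℝ → ℂ) : Prop :=
  ∀ τ ∈ Ioo (-1 : ℝ) 1,
    f τ = (((1 + τ) / 2) ^ (p + 2) * ((1 - τ) / 2) ^ (p - 2) : ℝ) *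
      (D + Ds * ((∫ s in (0 : ℝ)..τ, 1 / ((1 - s) ^ (p - 1) * (1 + s) ^ (p + 3)) : ℝ) : ℂ))

/-- The regularity condition: the constants `C⊛_{p,m}`, `D⊛_{p,m}` in `a_{0,p;p,m}` and
`a_{4,p;p,m}` vanish for `p ≥ 3`, `|m| ≤ p`. -/
def Regular (a : Fin 5 → ℕ → ℤ → ℤ → ℝ → ℂ) : Prop :=
  ∀ p : ℕ, 3 ≤ p → ∀ m ∈ Finset.Icc (-(p : ℤ)) p, ∃ C Cs D Ds : ℂ,
    IsJacobi0 p C Cs (a 0 p p m) ∧ IsJacobi4 p D Ds (a 4 p p m) ∧ Cs = 0 ∧ Ds = 0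

/-- `a_{0,p;p,m}(0) = a_{4,p;p,m}(0) = 0` for `p ≥ 3`, `|m| ≤ p`. -/
def TopDataVanish (a : Fin 5 → ℕ → ℤ → ℤ → ℝ → ℂ) : Prop :=
  ∀ p : ℕ, 3 ≤ p → ∀ m ∈ Finset.Icc (-(p : ℤ)) p, a 0 p p m 0 = 0 ∧ a 4 p p m 0 = 0

/-! ### Newman-Penrose constants -/

/-- The derivative along the frame vector `e'_{00'}` of the NP-gauge at future null infinity. -/
def npDerivPlus (f : ℝ → ℝ → ℂ) : ℝ → ℝ → ℂ := fun τ ρ =>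
  ((Real.sqrt 2 / 2 / (ρ * (1 - τ) ^ 2) : ℝ) : ℂ) *
    ((1 - (τ : ℂ)) * deriv (fun t => f t ρ) τ + (ρ : ℂ) * deriv (fun r => f τ r) ρ)

/-- The time dual of `npDerivPlus`, for past null infinity. -/
def npDerivMinus (f : ℝ → ℝ → ℂ) : ℝ → ℝ → ℂ := fun τ ρ =>
  ((Real.sqrt 2 / 2 / (ρ * (1 + τ) ^ 2) : ℝ) : ℂ) *
    (-(1 + (τ : ℂ)) * deriv (fun t => f t ρ) τ + (ρ : ℂ) * deriv (fun r => f τ r) ρ)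

/-- The integral defining `G^n_m` at future null infinity, over the sphere of given `(τ, ρ)`:
here `Φ'_0 = (Λ^0_0)^4 Φ_0` with `Λ^0_0 = ρ^{-1/2} (1 - τ)^{-1}`. -/
def npIntegralPlus (Φ : Fin 5 → ℝ → ℝ → ℂ × ℂ → ℂ) (n : ℕ) (m : ℤ) (τ ρ : ℝ) : ℂ :=
  (((-1) ^ (n + 1) / (((n + 1) ! : ℕ) * Real.sqrt 2 ^ (n + 1)) : ℝ) : ℂ) *
    sphereIntegral (fun o => conj (Y 2 (n + 2) m o) *
      (npDerivPlus^[n + 1] (fun t r => Φ 0 t r o / ((r : ℂ) ^ 2 * (1 - (t : ℂ)) ^ 4))) τ ρ)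

/-- The time dual of `npIntegralPlus`; `Φ_4` has spin weight `-2`. -/
def npIntegralMinus (Φ : Fin 5 → ℝ → ℝ → ℂ × ℂ → ℂ) (n : ℕ) (m : ℤ) (τ ρ : ℝ) : ℂ :=
  (((-1) ^ (n + 1) / (((n + 1) ! : ℕ) * Real.sqrt 2 ^ (n + 1)) : ℝ) : ℂ) *
    sphereIntegral (fun o => conj (Y (-2) (n + 2) m o) *
      (npDerivMinus^[n + 1] (fun t r => Φ 4 t r o / ((r : ℂ) ^ 2 * (1 + (t : ℂ)) ^ 4))) τ ρ)

/-- `G` is finite with value `g`: the integral converges as `ρ → 0` for every `τ`, and the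
result converges to `g` as `τ → 1` from below. -/
def HasNPConstantPlus (Φ : Fin 5 → ℝ → ℝ → ℂ × ℂ → ℂ) (n : ℕ) (m : ℤ) (g : ℂ) : Prop :=
  ∃ H : ℝ → ℂ,
    (∀ τ ∈ Ioo (-1 : ℝ) 1, Tendsto (npIntegralPlus Φ n m τ) (𝓝[>] 0) (𝓝 (H τ))) ∧
      Tendsto H (𝓝[<] 1) (𝓝 g)

/-- The same at past null infinity, `τ → -1` from above. -/
def HasNPConstantMinus (Φ : Fin 5 → ℝ → ℝ → ℂ × ℂ → ℂ) (n : ℕ) (m : ℤ) (g : ℂ) : Prop :=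
  ∃ H : ℝ → ℂ,
    (∀ τ ∈ Ioo (-1 : ℝ) 1, Tendsto (npIntegralMinus Φ n m τ) (𝓝[>] 0) (𝓝 (H τ))) ∧
      Tendsto H (𝓝[>] (-1)) (𝓝 g)

end Spin2

end

/-!
Expanding a solution at the cylinder `ρ = 0` in powers of `ρ` and in harmonics of degree `L` turns
the field equations into linear ordinary differential equations in `τ` for five coefficients
`y 0, …, y 4`, one system for each order `p` and each harmonic (`TransportAt`).  Only the top
coefficients `a_{n,p;p,m}` matter.  They belong to harmonics of degree `L = p - 1` when the system
comes from the field equations, because of the shift in `Y_{2-n; l-1, m}`, whereas the transport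
equations of the statement are those of degree `L = p`; every argument below works for all
`2 ≤ L ≤ p`.

*Regular data.*  At `τ = 0` the three constraints are algebraic.  With time symmetry they give
`(L (L + 1) - 2 p²) y 2 = 0`, hence `y 2 = 0` and `lam1 * y 0 = 2 p * y 1`
(`TransportAt.constraints`).  Without the logarithmic term the Jacobi solution has
`y 0' = -4 * y 0` at `τ = 0`, so that the first evolution equation reads
`lam1 * y 1 = (p + 2) * y 0`.  Since `lam1² = (L - 1)(L + 2) < 2 p (p + 2)`, both relations together
force `y 0 = 0` (`TransportAt.eq_zero_of_isJacobi0`).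

*Vanishing data.*  If `y 0` and `y 4` vanish at `τ = 0`, the constraints give `y 1 = y 3 = 0` there.
One evolution equation combines with a constraint so that `(y 0, y 1)`, and after `τ ↦ -τ` also
`(y 4, y 3)`, satisfy a closed linear system, regular for `|τ| < 1`; by uniqueness `y 0` and `y 4`
vanish identically (`TransportAt.eq_zero`).

*Newman-Penrose constants.*  The `n + 1`-st derivative of `Φ / (ρ² (1 - τ)⁴)` is
`ρ ^ (-(n + 3))` times a smooth function, up to a power of `1 - τ` (`npDeriv_iterate`).  The Taylor
coefficients in `ρ` of this function, of order at most `n + 3`, are combinations of those of `Φ` and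
of their `τ`-derivatives, so that they stay in the span of the harmonics occurring in `Φ`
(`dirRho_iterate_npNum_mem`).  Only degrees `L ≤ n + 2` occur, and `L = n + 2` only in the top
coefficient of order `n + 3`, which vanishes.  By orthogonality to `Y_{±2; n+2, m}` the integral of
the smooth function is `O(ρ ^ (n + 4))` (`exists_norm_sphereIntegral_le`), so the integral defining
the constant tends to zero at the cylinder, for every `τ`.

*Harmonics.*  The `Y_{s; l, m}` are normalised coefficients of the generating polynomial
`(w + x z̄) ^ (l + m) (z - x w̄) ^ (l - m)`, on which `ð` and `ð̄` act as first-order operators in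
`x`.  In polar angles the coefficients are given by a Rodrigues formula, from which orthogonality
follows by repeated integration by parts.  Orthogonality gives linear independence, hence a dual
basis of finite combinations of point evaluations (`exists_dual_evaluation`), by which equations
and differentiability pass from the field to its coefficients.
-/

noncomputable section

namespace Spin2

/-! ### The harmonics as coefficients of a generating polynomial -/

/-- The generating polynomial `(w + x z̄) ^ a (z - x w̄) ^ b` in `x`, at the spinor `o = (z, w)`.
The harmonics `Y s l m` with `a = l + m`, `b = l - m` are, up to a factor, its coefficients. -/
def genPoly (a b : ℕ) (o : ℂ × ℂ) : Polynomial ℂ :=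
  (Polynomial.C o.2 + Polynomial.X * Polynomial.C (conj o.1)) ^ a *
    (Polynomial.C o.1 - Polynomial.X * Polynomial.C (conj o.2)) ^ b

/-- The coefficient of `x ^ k` in `genPoly a b o`. -/
def harm (a b k : ℕ) (o : ℂ × ℂ) : ℂ := (genPoly a b o).coeff k

lemma coeff_linear_pow {R : Type*} [CommRing R] (u v : R) (n i : ℕ) :
    ((Polynomial.C u + Polynomial.X * Polynomial.C v) ^ n).coeff i =
      (n.choose i : R) * u ^ (n - i) * v ^ i := by
  have h : (Polynomial.C u + Polynomial.X * Polynomial.C v) ^ n =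
      ∑ j ∈ Finset.range (n + 1),
        Polynomial.C ((n.choose j : R) * u ^ (n - j) * v ^ j) * Polynomial.X ^ j := by
    rw [add_comm, add_pow]
    refine Finset.sum_congr rfl fun j _ => ?_
    simp only [map_mul, map_pow, map_natCast, mul_pow]
    ring
  rw [h, Polynomial.finsetSum_coeff]
  simp only [Polynomial.coeff_C_mul, Polynomial.coeff_X_pow, mul_ite, mul_one, mul_zero]
  rw [Finset.sum_ite_eq]
  split_ifs with hi
  · rfl
  · rw [Nat.choose_eq_zero_of_lt (by simpa using hi)]
    simp

lemma harm_eq_sum (a b k : ℕ) (o : ℂ × ℂ) :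
    harm a b k o = ∑ j ∈ Finset.range (k + 1),
      (-1 : ℂ) ^ j * (b.choose j : ℂ) * (a.choose (k - j) : ℂ) *
        o.1 ^ (b - j) * o.2 ^ (a - (k - j)) * conj o.1 ^ (k - j) * conj o.2 ^ j := by
  have hb : Polynomial.C o.1 - Polynomial.X * Polynomial.C (conj o.2) =
      Polynomial.C o.1 + Polynomial.X * Polynomial.C (-conj o.2) := by
    simp [sub_eq_add_neg]
  rw [harm, genPoly, hb, mul_comm, Polynomial.coeff_mul,
    Finset.Nat.sum_antidiagonal_eq_sum_range_succ_mk]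
  refine Finset.sum_congr rfl fun j _ => ?_
  simp only [coeff_linear_pow]
  rw [neg_pow]
  ring

lemma harm_zero_zero (k : ℕ) (o : ℂ × ℂ) : harm 0 0 k o = if k = 0 then 1 else 0 := by
  simp [harm, genPoly, Polynomial.coeff_one]

lemma genPoly_succ_left (a b : ℕ) (o : ℂ × ℂ) : genPoly (a + 1) b o =
    Polynomial.C o.2 * genPoly a b o +
      Polynomial.C (conj o.1) * genPoly a b o * Polynomial.X := by
  simp only [genPoly]; ring

lemma genPoly_succ_right (a b : ℕ) (o : ℂ × ℂ) : genPoly a (b + 1) o =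
    Polynomial.C o.1 * genPoly a b o -
      Polynomial.C (conj o.2) * genPoly a b o * Polynomial.X := by
  simp only [genPoly]; ring

lemma harm_succ_left (a b k : ℕ) (o : ℂ × ℂ) : harm (a + 1) b (k + 1) o =
    o.2 * harm a b (k + 1) o + conj o.1 * harm a b k o := by
  simp only [harm, genPoly_succ_left, Polynomial.coeff_add, Polynomial.coeff_C_mul,
    Polynomial.coeff_mul_X]

lemma harm_succ_left_zero (a b : ℕ) (o : ℂ × ℂ) : harm (a + 1) b 0 o = o.2 * harm a b 0 o := by
  simp [harm, genPoly_succ_left]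

lemma harm_succ_right (a b k : ℕ) (o : ℂ × ℂ) : harm a (b + 1) (k + 1) o =
    o.1 * harm a b (k + 1) o - conj o.2 * harm a b k o := by
  simp only [harm, genPoly_succ_right, Polynomial.coeff_sub, Polynomial.coeff_C_mul,
    Polynomial.coeff_mul_X]

lemma harm_succ_right_zero (a b : ℕ) (o : ℂ × ℂ) : harm a (b + 1) 0 o = o.1 * harm a b 0 o := by
  simp [harm, genPoly_succ_right]

/-- The normalising factor of `Y s l m`. -/
def normY (s l m : ℤ) : ℂ :=
  (-1 : ℂ) ^ m * ((Real.sqrt ((2 * (l : ℝ) + 1) / (4 * Real.pi) *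
        ((((l + s).toNat ! : ℕ) : ℝ) * (((l - s).toNat ! : ℕ) : ℝ)) /
        ((((l + m).toNat ! : ℕ) : ℝ) * (((l - m).toNat ! : ℕ) : ℝ))) : ℝ) : ℂ)

lemma Y_eq {s l m : ℤ} (hs : |s| ≤ l) (hm : |m| ≤ l) (o : ℂ × ℂ) :
    Y s l m o = normY s l m * harm (l + m).toNat (l - m).toNat (l - s).toNat o /
      ((spinorNormSq o : ℝ) : ℂ) ^ l.toNat := by
  rw [Y, if_pos ⟨hs, hm⟩, normY, harm_eq_sum]
  congr 2
  refine Finset.sum_congr rfl fun j hj => ?_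
  have hj' : j ≤ (l - s).toNat := by simpa [Nat.lt_succ_iff] using hj
  have h1 : (l - m - j).toNat = (l - m).toNat - j := by omega
  have h2 : (s + m + j).toNat = (l + m).toNat - ((l - s).toNat - j) := by
    rw [abs_le] at hs hm; omega
  rw [h1, h2]

lemma Y_eq_zero {s l m : ℤ} (h : ¬(|s| ≤ l ∧ |m| ≤ l)) (o : ℂ × ℂ) : Y s l m o = 0 := by
  rw [Y, if_neg h]

/-! ### The operators `ð` and `ð̄` on harmonics -/

/-- `F` is real differentiable at `o` with value `d` of `ð F` (for `ε = 1`) or `ð̄ F`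
(for `ε = -1`). -/
def HasEth (ε : ℂ) (F : ℂ × ℂ → ℂ) (o : ℂ × ℂ) (d : ℂ) : Prop :=
  ∃ F' : ℂ × ℂ →L[ℝ] ℂ, HasFDerivAt F F' o ∧
    -(1 / 2) * (F' (iota o) + ε * Complex.I * F' (Complex.I • iota o)) = d

lemma HasEth.eth_eq {F : ℂ × ℂ → ℂ} {o : ℂ × ℂ} {d : ℂ} (h : HasEth 1 F o d) : eth F o = d := by
  obtain ⟨F', h1, h2⟩ := h
  rw [eth, h1.fderiv, ← h2]; ring

lemma HasEth.ethBar_eq {F : ℂ × ℂ → ℂ} {o : ℂ × ℂ} {d : ℂ} (h : HasEth (-1) F o d) :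
    ethBar F o = d := by
  obtain ⟨F', h1, h2⟩ := h
  rw [ethBar, h1.fderiv, ← h2]; ring

lemma HasEth.differentiableAt {ε : ℂ} {F : ℂ × ℂ → ℂ} {o : ℂ × ℂ} {d : ℂ} (h : HasEth ε F o d) :
    DifferentiableAt ℝ F o := by
  obtain ⟨F', h1, _⟩ := h
  exact h1.differentiableAt

section
variable {ε : ℂ} {F G : ℂ × ℂ → ℂ} {o : ℂ × ℂ} {d e : ℂ}

lemma hasEth_const (ε c : ℂ) (o : ℂ × ℂ) : HasEth ε (fun _ => c) o 0 :=
  ⟨0, hasFDerivAt_const c o, by simp⟩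

lemma HasEth.add (hF : HasEth ε F o d) (hG : HasEth ε G o e) :
    HasEth ε (fun x => F x + G x) o (d + e) := by
  obtain ⟨F', h1, h2⟩ := hF
  obtain ⟨G', h3, h4⟩ := hG
  refine ⟨F' + G', h1.add h3, ?_⟩
  rw [← h2, ← h4]; simp only [add_apply]; ring

lemma HasEth.mul (hF : HasEth ε F o d) (hG : HasEth ε G o e) :
    HasEth ε (fun x => F x * G x) o (F o * e + G o * d) := by
  obtain ⟨F', h1, h2⟩ := hF
  obtain ⟨G', h3, h4⟩ := hG
  refine ⟨F o • G' + G o • F', h1.mul h3, ?_⟩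
  rw [← h2, ← h4]
  simp only [add_apply, smul_apply, smul_eq_mul]; ring

lemma HasEth.const_mul (c : ℂ) (hF : HasEth ε F o d) : HasEth ε (fun x => c * F x) o (c * d) := by
  simpa using (hasEth_const ε c o).mul hF

lemma HasEth.sub (hF : HasEth ε F o d) (hG : HasEth ε G o e) :
    HasEth ε (fun x => F x - G x) o (d - e) := by
  simpa [sub_eq_add_neg] using hF.add (hG.const_mul (-1))

lemma HasEth.sum {ι : Type*} (t : Finset ι) {F : ι → ℂ × ℂ → ℂ} {d : ι → ℂ}
    (h : ∀ i ∈ t, HasEth ε (F i) o (d i)) :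
    HasEth ε (fun x => ∑ i ∈ t, F i x) o (∑ i ∈ t, d i) := by
  classical
  induction t using Finset.induction_on with
  | empty => simpa using hasEth_const ε 0 o
  | insert i t hi ih =>
    simp only [Finset.sum_insert hi]
    exact (h i (Finset.mem_insert_self i t)).add
      (ih fun j hj => h j (Finset.mem_insert_of_mem hj))

lemma HasEth.inv (hF : HasEth ε F o 0) (h0 : F o ≠ 0) : HasEth ε (fun x => (F x)⁻¹) o 0 := by
  obtain ⟨F', h1, h2⟩ := hF
  refine ⟨_, ((hasDerivAt_inv h0).hasFDerivAt.restrictScalars ℝ).comp o h1, ?_⟩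
  simp only [ContinuousLinearMap.comp_apply, ContinuousLinearMap.coe_restrictScalars',
    ContinuousLinearMap.toSpanSingleton_apply, smul_eq_mul]
  linear_combination (-((F o) ^ 2)⁻¹) * h2

lemma HasEth.pow (hF : HasEth ε F o 0) (n : ℕ) : HasEth ε (fun x => F x ^ n) o 0 := by
  induction n with
  | zero => simpa using hasEth_const ε 1 o
  | succ n ih => simpa [pow_succ] using ih.mul hF

end

lemma hasFDerivAt_conj_fst (o : ℂ × ℂ) : HasFDerivAt (fun x : ℂ × ℂ => conj x.1)
    ((Complex.conjCLE : ℂ →L[ℝ] ℂ).comp (ContinuousLinearMap.fst ℝ ℂ ℂ)) o :=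
  ((Complex.conjCLE : ℂ →L[ℝ] ℂ).comp (ContinuousLinearMap.fst ℝ ℂ ℂ)).hasFDerivAt

lemma hasFDerivAt_conj_snd (o : ℂ × ℂ) : HasFDerivAt (fun x : ℂ × ℂ => conj x.2)
    ((Complex.conjCLE : ℂ →L[ℝ] ℂ).comp (ContinuousLinearMap.snd ℝ ℂ ℂ)) o :=
  ((Complex.conjCLE : ℂ →L[ℝ] ℂ).comp (ContinuousLinearMap.snd ℝ ℂ ℂ)).hasFDerivAt

lemma hasEth_fst (ε : ℂ) (o : ℂ × ℂ) :
    HasEth ε (fun x => x.1) o ((1 - ε) / 2 * conj o.2) :=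
  ⟨ContinuousLinearMap.fst ℝ ℂ ℂ, (ContinuousLinearMap.fst ℝ ℂ ℂ).hasFDerivAt, by
    simp only [ContinuousLinearMap.coe_fst', iota, Prod.smul_mk, smul_eq_mul]
    linear_combination (1 / 2 * ε * conj o.2) * Complex.I_sq⟩

lemma hasEth_snd (ε : ℂ) (o : ℂ × ℂ) :
    HasEth ε (fun x => x.2) o (-((1 - ε) / 2 * conj o.1)) :=
  ⟨ContinuousLinearMap.snd ℝ ℂ ℂ, (ContinuousLinearMap.snd ℝ ℂ ℂ).hasFDerivAt, by
    simp only [ContinuousLinearMap.coe_snd', iota, Prod.smul_mk, smul_eq_mul]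
    linear_combination (-1 / 2 * ε * conj o.1) * Complex.I_sq⟩

lemma hasEth_conj_fst (ε : ℂ) (o : ℂ × ℂ) :
    HasEth ε (fun x => conj x.1) o ((1 + ε) / 2 * o.2) :=
  ⟨_, hasFDerivAt_conj_fst o, by
    simp only [ContinuousLinearMap.comp_apply, ContinuousLinearMap.coe_fst', iota, Prod.smul_mk,
      smul_eq_mul, ContinuousLinearEquiv.coe_coe, Complex.conjCLE_apply, map_mul, map_neg,
      Complex.conj_conj, Complex.conj_I]
    linear_combination (-1 / 2 * ε * o.2) * Complex.I_sq⟩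

lemma hasEth_conj_snd (ε : ℂ) (o : ℂ × ℂ) :
    HasEth ε (fun x => conj x.2) o (-((1 + ε) / 2 * o.1)) :=
  ⟨_, hasFDerivAt_conj_snd o, by
    simp only [ContinuousLinearMap.comp_apply, ContinuousLinearMap.coe_snd', iota, Prod.smul_mk,
      smul_eq_mul, ContinuousLinearEquiv.coe_coe, Complex.conjCLE_apply, map_mul,
      Complex.conj_conj, Complex.conj_I]
    linear_combination (1 / 2 * ε * o.1) * Complex.I_sq⟩

lemma spinorNormSq_eq (o : ℂ × ℂ) :
    ((spinorNormSq o : ℝ) : ℂ) = o.1 * conj o.1 + o.2 * conj o.2 := by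
  simp [spinorNormSq, Complex.mul_conj]

lemma hasEth_spinorNormSq (ε : ℂ) (o : ℂ × ℂ) :
    HasEth ε (fun x => ((spinorNormSq x : ℝ) : ℂ)) o 0 := by
  simp only [spinorNormSq_eq]
  convert ((hasEth_fst ε o).mul (hasEth_conj_fst ε o)).add
    ((hasEth_snd ε o).mul (hasEth_conj_snd ε o)) using 1
  ring

lemma spinorNormSq_pos {o : ℂ × ℂ} (ho : o ≠ 0) : 0 < spinorNormSq o := by
  rcases o with ⟨z, w⟩
  by_cases hz : z = 0
  · have hw : w ≠ 0 := by rintro rfl; exact ho (by simp [hz])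
    exact add_pos_of_nonneg_of_pos (Complex.normSq_nonneg _) (Complex.normSq_pos.2 hw)
  · exact add_pos_of_pos_of_nonneg (Complex.normSq_pos.2 hz) (Complex.normSq_nonneg _)

/-- `ð` lowers the index of a coefficient of the generating polynomial; it acts on
`Q = genPoly a b o` as `x ((a + b) Q - x Q')`. -/
lemma hasEth_harm (a b k : ℕ) (o : ℂ × ℂ) :
    HasEth 1 (harm a b (k + 1)) o (((a : ℂ) + b - k) * harm a b k o) ∧
      HasEth 1 (harm a b 0) o 0 := by
  have z := hasEth_fst 1 o
  have w := hasEth_snd 1 o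
  have zb := hasEth_conj_fst 1 o
  have wb := hasEth_conj_snd 1 o
  norm_num at z w zb wb
  induction a generalizing k with
  | zero =>
    induction b generalizing k with
    | zero =>
      refine ⟨?_, ?_⟩
      · have h : harm 0 0 (k + 1) = fun _ => 0 := by ext x; simp [harm_zero_zero]
        rw [h]
        convert hasEth_const 1 0 o using 1
        rcases k with _ | k <;> simp [harm_zero_zero]
      · have h : harm 0 0 0 = fun _ => 1 := by ext x; simp [harm_zero_zero]
        rw [h]; exact hasEth_const 1 1 o
    | succ b ih =>
      refine ⟨?_, ?_⟩
      · have h : harm 0 (b + 1) (k + 1) =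
            fun x => x.1 * harm 0 b (k + 1) x - conj x.2 * harm 0 b k x := by
          ext x; exact harm_succ_right _ _ _ _
        rw [h]
        rcases k with _ | k
        · convert (z.mul (ih 0).1).sub (wb.mul (ih 0).2) using 1
          rw [harm_succ_right_zero]; push_cast; ring
        · convert (z.mul (ih (k + 1)).1).sub (wb.mul (ih k).1) using 1
          rw [harm_succ_right]; push_cast; ring
      · have h : harm 0 (b + 1) 0 = fun x => x.1 * harm 0 b 0 x := by
          ext x; exact harm_succ_right_zero _ _ _
        rw [h]
        convert z.mul (ih 0).2 using 1
        ring
  | succ a ih =>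
    refine ⟨?_, ?_⟩
    · have h : harm (a + 1) b (k + 1) =
          fun x => x.2 * harm a b (k + 1) x + conj x.1 * harm a b k x := by
        ext x; exact harm_succ_left _ _ _ _
      rw [h]
      rcases k with _ | k
      · convert (w.mul (ih 0).1).add (zb.mul (ih 0).2) using 1
        rw [harm_succ_left_zero]; push_cast; ring
      · convert (w.mul (ih (k + 1)).1).add (zb.mul (ih k).1) using 1
        rw [harm_succ_left]; push_cast; ring
    · have h : harm (a + 1) b 0 = fun x => x.2 * harm a b 0 x := by
        ext x; exact harm_succ_left_zero _ _ _
      rw [h]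
      convert w.mul (ih 0).2 using 1
      ring

/-- `ð̄` raises the index of a coefficient of the generating polynomial; it acts on
`Q = genPoly a b o` as `-Q'`. -/
lemma hasEthBar_harm (a b k : ℕ) (o : ℂ × ℂ) :
    HasEth (-1) (harm a b k) o (-((k : ℂ) + 1) * harm a b (k + 1) o) := by
  have z := hasEth_fst (-1) o
  have w := hasEth_snd (-1) o
  have zb := hasEth_conj_fst (-1) o
  have wb := hasEth_conj_snd (-1) o
  norm_num at z w zb wb
  induction a generalizing k with
  | zero =>
    induction b generalizing k with
    | zero =>
      have h : harm 0 0 k = fun _ => if k = 0 then 1 else 0 := by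
        ext x; exact harm_zero_zero _ _
      rw [h]
      convert hasEth_const (-1) _ o using 1
      simp [harm_zero_zero]
    | succ b ih =>
      rcases k with _ | k
      · have h : harm 0 (b + 1) 0 = fun x => x.1 * harm 0 b 0 x := by
          ext x; exact harm_succ_right_zero _ _ _
        rw [h]
        convert z.mul (ih 0) using 1
        rw [harm_succ_right]; push_cast; ring
      · have h : harm 0 (b + 1) (k + 1) =
            fun x => x.1 * harm 0 b (k + 1) x - conj x.2 * harm 0 b k x := by
          ext x; exact harm_succ_right _ _ _ _
        rw [h]
        convert (z.mul (ih (k + 1))).sub (wb.mul (ih k)) using 1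
        rw [harm_succ_right]; push_cast; ring
  | succ a ih =>
    rcases k with _ | k
    · have h : harm (a + 1) b 0 = fun x => x.2 * harm a b 0 x := by
        ext x; exact harm_succ_left_zero _ _ _
      rw [h]
      convert w.mul (ih 0) using 1
      rw [harm_succ_left]; push_cast; ring
    · have h : harm (a + 1) b (k + 1) =
          fun x => x.2 * harm a b (k + 1) x + conj x.1 * harm a b k x := by
        ext x; exact harm_succ_left _ _ _ _
      rw [h]
      convert (w.mul (ih (k + 1))).add (zb.mul (ih k)) using 1
      rw [harm_succ_left]; push_cast; ring

lemma harm_eq_zero_of_lt {a b k : ℕ} (h : a + b < k) (o : ℂ × ℂ) : harm a b k o = 0 := by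
  rw [harm_eq_sum]
  refine Finset.sum_eq_zero fun j _ => ?_
  rcases lt_or_ge b j with hj | hj
  · simp [Nat.choose_eq_zero_of_lt hj]
  · simp [Nat.choose_eq_zero_of_lt (show a < k - j by omega)]

lemma normY_succ {s l m : ℤ} (hs : |s| ≤ l) (hs' : |s + 1| ≤ l) :
    normY s l m * ((l : ℂ) + s + 1) =
      (Real.sqrt (((l : ℝ) - s) * ((l : ℝ) + s + 1)) : ℂ) * normY (s + 1) l m := by
  rw [abs_le] at hs hs'
  obtain ⟨u, hu⟩ : ∃ u : ℕ, l - s = u + 1 := ⟨(l - s - 1).toNat, by omega⟩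
  obtain ⟨v, hv⟩ : ∃ v : ℕ, l + s = v := ⟨(l + s).toNat, by omega⟩
  have e1 : (l - s).toNat = u + 1 := by omega
  have e2 : (l + s).toNat = v := by omega
  have e3 : (l - (s + 1)).toNat = u := by omega
  have e4 : (l + (s + 1)).toNat = v + 1 := by omega
  have c1 : (l : ℝ) - s = u + 1 := by exact_mod_cast hu
  have c2 : (l : ℝ) + s = v := by exact_mod_cast hv
  have c3 : (l : ℂ) + s + 1 = ((v + 1 : ℝ) : ℂ) := by
    have : (l : ℂ) + s = v := by exact_mod_cast hv
    rw [this]; push_cast; rfl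
  simp only [normY, e1, e2, e3, e4, c1, c2, c3]
  have key : ∀ A B : ℝ, Real.sqrt (A * ((v ! : ℕ) * ((u + 1)! : ℕ)) / B) * (v + 1) =
      Real.sqrt ((u + 1) * (v + 1)) * Real.sqrt (A * (((v + 1)! : ℕ) * (u ! : ℕ)) / B) := by
    intro A B
    have hv1 : (0 : ℝ) ≤ v + 1 := by positivity
    rw [← Real.sqrt_mul (by positivity)]
    calc _ = Real.sqrt (A * ((v ! : ℕ) * ((u + 1)! : ℕ)) / B) * Real.sqrt ((v + 1) ^ 2) := by
          rw [Real.sqrt_sq hv1]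
      _ = _ := by
          rw [← Real.sqrt_mul' _ (by positivity)]
          congr 1
          rw [Nat.factorial_succ, Nat.factorial_succ]
          push_cast
          ring
  rw [mul_assoc, ← Complex.ofReal_mul, key]
  push_cast
  ring

lemma hasEth_Y_of_le {s l m : ℤ} (hs : |s| ≤ l) (hm : |m| ≤ l) {o : ℂ × ℂ} (ho : o ≠ 0) {ε d : ℂ}
    (h : HasEth ε (harm (l + m).toNat (l - m).toNat (l - s).toNat) o d) :
    HasEth ε (Y s l m) o (normY s l m * d / ((spinorNormSq o : ℝ) : ℂ) ^ l.toNat) := by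
  have hN : ((spinorNormSq o : ℝ) : ℂ) ^ l.toNat ≠ 0 :=
    pow_ne_zero _ (by exact_mod_cast (spinorNormSq_pos ho).ne')
  have h2 := (h.const_mul (normY s l m)).mul (((hasEth_spinorNormSq ε o).pow l.toNat).inv hN)
  have e : Y s l m = fun x => normY s l m * harm (l + m).toNat (l - m).toNat (l - s).toNat x *
      (((spinorNormSq x : ℝ) : ℂ) ^ l.toNat)⁻¹ := by
    ext x; rw [Y_eq hs hm, div_eq_mul_inv]
  rw [e]
  convert h2 using 1
  rw [div_eq_mul_inv]; ring

/-- `ð Y_{s; l, m} = √((l - s)(l + s + 1)) Y_{s + 1; l, m}`, for all values of the labels. -/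
lemma hasEth_Y (s l m : ℤ) {o : ℂ × ℂ} (ho : o ≠ 0) :
    HasEth 1 (Y s l m) o
      ((Real.sqrt (((l : ℝ) - s) * ((l : ℝ) + s + 1)) : ℂ) * Y (s + 1) l m o) := by
  by_cases hm : |m| ≤ l
  swap
  · have : Y s l m = fun _ => 0 := by ext x; exact Y_eq_zero (by tauto) x
    rw [this, Y_eq_zero (by tauto), mul_zero]; exact hasEth_const _ _ _
  by_cases hs : |s| ≤ l
  swap
  · have : Y s l m = fun _ => 0 := by ext x; exact Y_eq_zero (by tauto) x
    rw [this]
    convert hasEth_const 1 0 o using 1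
    by_cases hs' : |s + 1| ≤ l
    · have h0 : (l : ℝ) + s + 1 = 0 := by
        have : l + s + 1 = 0 := by rw [abs_le] at hs hs'; omega
        exact_mod_cast this
      simp [h0]
    · rw [Y_eq_zero (by tauto), mul_zero]
  have hs0 := abs_le.1 hs
  have hm0 := abs_le.1 hm
  by_cases hs' : |s + 1| ≤ l
  · have hs0' := abs_le.1 hs'
    have e : (l - s).toNat = (l - (s + 1)).toNat + 1 := by omega
    convert hasEth_Y_of_le hs hm ho (e ▸ (hasEth_harm _ _ (l - (s + 1)).toNat o).1) using 1
    have c : (((l + m).toNat : ℂ) + (l - m).toNat - (l - (s + 1)).toNat) = (l : ℂ) + s + 1 := by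
      have : (((l + m).toNat : ℤ) + (l - m).toNat - (l - (s + 1)).toNat) = l + s + 1 := by omega
      exact_mod_cast this
    rw [c, Y_eq hs' hm, ← mul_assoc, normY_succ hs hs']
    ring
  · have e : (l - s).toNat = 0 := by rw [abs_le] at hs'; omega
    convert hasEth_Y_of_le hs hm ho (e ▸ (hasEth_harm _ _ 0 o).2) using 1
    rw [Y_eq_zero (by tauto)]; simp

/-- `ð̄ Y_{s; l, m} = -√((l + s)(l - s + 1)) Y_{s - 1; l, m}`, for all values of the labels. -/
lemma hasEthBar_Y (s l m : ℤ) {o : ℂ × ℂ} (ho : o ≠ 0) :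
    HasEth (-1) (Y s l m) o
      (-(Real.sqrt (((l : ℝ) + s) * ((l : ℝ) - s + 1)) : ℂ) * Y (s - 1) l m o) := by
  by_cases hm : |m| ≤ l
  swap
  · have : Y s l m = fun _ => 0 := by ext x; exact Y_eq_zero (by tauto) x
    rw [this, Y_eq_zero (by tauto), mul_zero]; exact hasEth_const _ _ _
  by_cases hs : |s| ≤ l
  swap
  · have : Y s l m = fun _ => 0 := by ext x; exact Y_eq_zero (by tauto) x
    rw [this]
    convert hasEth_const (-1) 0 o using 1
    by_cases hs' : |s - 1| ≤ l
    · have h0 : (l : ℝ) - s + 1 = 0 := by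
        have : l - s + 1 = 0 := by rw [abs_le] at hs hs'; omega
        exact_mod_cast this
      simp [h0]
    · rw [Y_eq_zero (by tauto), mul_zero]
  have hs0 := abs_le.1 hs
  have hm0 := abs_le.1 hm
  convert hasEth_Y_of_le hs hm ho (hasEthBar_harm _ _ (l - s).toNat o) using 1
  by_cases hs' : |s - 1| ≤ l
  · have hs0' := abs_le.1 hs'
    have e : (l - (s - 1)).toNat = (l - s).toNat + 1 := by omega
    rw [Y_eq hs' hm, e]
    have key := normY_succ (m := m) hs' (by rwa [sub_add_cancel])
    rw [sub_add_cancel] at key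
    have c : (((l - s).toNat : ℂ)) = (l : ℂ) - s := by
      have : ((l - s).toNat : ℤ) = l - s := by omega
      exact_mod_cast this
    have hsq : (Real.sqrt (((l : ℝ) + s) * ((l : ℝ) - s + 1)) : ℂ) ^ 2 =
        ((l : ℂ) + s) * ((l : ℂ) - s + 1) := by
      rw [← Complex.ofReal_pow, Real.sq_sqrt]
      · push_cast; ring
      · refine mul_nonneg ?_ ?_
        · exact_mod_cast (by omega : 0 ≤ l + s)
        · exact_mod_cast (by omega : 0 ≤ l - s + 1)
    have e2 : ((l : ℝ) - ((s - 1 : ℤ) : ℝ)) * ((l : ℝ) + ((s - 1 : ℤ) : ℝ) + 1) =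
        ((l : ℝ) + s) * ((l : ℝ) - s + 1) := by push_cast; ring
    have hne : (l : ℂ) + s ≠ 0 := by exact_mod_cast (by omega : l + s ≠ 0)
    rw [e2] at key
    push_cast at key
    rw [c]
    have : (Real.sqrt (((l : ℝ) + s) * ((l : ℝ) - s + 1)) : ℂ) * normY (s - 1) l m =
        ((l : ℂ) - s + 1) * normY s l m := by
      apply mul_left_cancel₀ hne
      linear_combination (Real.sqrt (((l : ℝ) + s) * ((l : ℝ) - s + 1)) : ℂ) * key +
        normY s l m * hsq
    linear_combination (-(harm (l + m).toNat (l - m).toNat ((l - s).toNat + 1) o /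
      ((spinorNormSq o : ℝ) : ℂ) ^ l.toNat)) * this
  · rw [Y_eq_zero (by tauto), harm_eq_zero_of_lt]
    · simp
    · rw [abs_le] at hs'; omega

lemma differentiableAt_Y (s l m : ℤ) {o : ℂ × ℂ} (ho : o ≠ 0) : DifferentiableAt ℝ (Y s l m) o :=
  (hasEth_Y s l m ho).differentiableAt

/-! ### Orthogonality in the polar angle -/

section Polar
open Polynomial

/-- The polar factor of a harmonic, with `c = cos (θ / 2)` and `s = sin (θ / 2)`. -/
def polarHarm (a b k : ℕ) (c s : ℝ) : ℝ :=
  ∑ j ∈ Finset.range (k + 1), (-1 : ℝ) ^ j * (b.choose j : ℝ) * (a.choose (k - j) : ℝ) *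
    c ^ (b - j) * s ^ (a - (k - j)) * c ^ (k - j) * s ^ j

/-- The weight `t ^ a (1 - t) ^ b` of the Rodrigues formula. -/
def rodriguesWeight (a b : ℕ) : ℝ[X] := X ^ a * (1 - X) ^ b

/-- The polynomial part of the polar factor: up to powers of `s` and `c` the polar factor is this
polynomial at `t = s ^ 2`. -/
def polarPoly (a b k : ℕ) : ℝ[X] :=
  ∑ j ∈ Finset.range (k + 1), C ((-1 : ℝ) ^ j * (b.choose j : ℝ) * (a.choose (k - j) : ℝ)) *
    (X ^ j * (1 - X) ^ (k - j))

lemma eval_hasseDeriv_rodriguesWeight (a b k : ℕ) (t : ℝ) :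
    (hasseDeriv k (rodriguesWeight a b)).eval t = ∑ j ∈ Finset.range (k + 1),
      (-1 : ℝ) ^ j * (b.choose j : ℝ) * (a.choose (k - j) : ℝ) *
        (1 - t) ^ (b - j) * t ^ (a - (k - j)) := by
  have h : taylor t (rodriguesWeight a b) =
      (C (1 - t) + X * C (-1)) ^ b * (C t + X * C 1) ^ a := by
    simp only [rodriguesWeight, taylor_mul, taylor_pow, taylor_X, map_sub, map_neg, map_one]
    rw [taylor_one]
    simp
    ring
  rw [← taylor_coeff, h, coeff_mul, Finset.Nat.sum_antidiagonal_eq_sum_range_succ_mk]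
  refine Finset.sum_congr rfl fun j _ => ?_
  simp only [coeff_linear_pow, one_pow]
  ring

/-- The Rodrigues formula, with `t = s ^ 2`. -/
lemma polarHarm_eq_hasseDeriv (a b k : ℕ) {c s : ℝ} (h : c ^ 2 + s ^ 2 = 1) :
    s ^ a * c ^ b * polarHarm a b k c s =
      (s * c) ^ k * (hasseDeriv k (rodriguesWeight a b)).eval (s ^ 2) := by
  have hc : 1 - s ^ 2 = c ^ 2 := by linarith
  rw [eval_hasseDeriv_rodriguesWeight, hc, polarHarm, Finset.mul_sum, Finset.mul_sum]
  refine Finset.sum_congr rfl fun j hj => ?_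
  have hj' : j ≤ k := by simpa [Nat.lt_succ_iff] using hj
  rcases lt_or_ge b j with h1 | h1
  · simp [Nat.choose_eq_zero_of_lt h1]
  rcases lt_or_ge a (k - j) with h2 | h2
  · simp [Nat.choose_eq_zero_of_lt h2]
  obtain ⟨i, rfl⟩ := Nat.exists_eq_add_of_le hj'
  rw [Nat.add_sub_cancel_left] at *
  obtain ⟨a, rfl⟩ := Nat.exists_eq_add_of_le h2
  obtain ⟨b, rfl⟩ := Nat.exists_eq_add_of_le h1
  simp only [Nat.add_sub_cancel_left]
  ring

lemma polarHarm_eq_polarPoly (a b k : ℕ) {c s : ℝ} (h : c ^ 2 + s ^ 2 = 1) :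
    (s * c) ^ k * polarHarm a b k c s = s ^ a * c ^ b * (polarPoly a b k).eval (s ^ 2) := by
  have hc : 1 - s ^ 2 = c ^ 2 := by linarith
  rw [polarPoly, eval_finsetSum, polarHarm, Finset.mul_sum, Finset.mul_sum]
  refine Finset.sum_congr rfl fun j hj => ?_
  have hj' : j ≤ k := by simpa [Nat.lt_succ_iff] using hj
  simp only [eval_mul, eval_C, eval_pow, eval_X, eval_sub, eval_one, hc]
  rcases lt_or_ge b j with h1 | h1
  · simp [Nat.choose_eq_zero_of_lt h1]
  rcases lt_or_ge a (k - j) with h2 | h2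
  · simp [Nat.choose_eq_zero_of_lt h2]
  obtain ⟨i, rfl⟩ := Nat.exists_eq_add_of_le hj'
  rw [Nat.add_sub_cancel_left] at *
  obtain ⟨a, rfl⟩ := Nat.exists_eq_add_of_le h2
  obtain ⟨b, rfl⟩ := Nat.exists_eq_add_of_le h1
  simp only [Nat.add_sub_cancel_left]
  ring

/-- Repeated integration by parts. -/
lemma integral_iterate_derivative_mul_eq_zero (g : ℝ[X]) (k : ℕ) (q : ℝ[X])
    (hq : derivative^[k] q = 0)
    (hb : ∀ i < k, ∀ x ∈ ({0, 1} : Set ℝ),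
      (derivative^[i] g).eval x * (derivative^[k - 1 - i] q).eval x = 0) :
    ∫ t in (0 : ℝ)..1, (derivative^[k] g).eval t * q.eval t = 0 := by
  induction k generalizing q with
  | zero =>
    have : q = 0 := by simpa using hq
    simp [this]
  | succ k ih =>
    have h0 := hb k (Nat.lt_succ_self k) 0 (by simp)
    have h1 := hb k (Nat.lt_succ_self k) 1 (by simp)
    simp only [Nat.add_sub_cancel, Nat.sub_self, Function.iterate_zero, id] at h0 h1
    have ibp := intervalIntegral.integral_mul_deriv_eq_deriv_mul (a := (0 : ℝ)) (b := 1)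
      (u := fun t => q.eval t) (v := fun t => (derivative^[k] g).eval t)
      (fun x _ => q.hasDerivAt x) (fun x _ => (derivative^[k] g).hasDerivAt x)
      ((derivative q).continuous.intervalIntegrable _ _)
      ((derivative (derivative^[k] g)).continuous.intervalIntegrable _ _)
    have hd : ∫ t in (0 : ℝ)..1, (derivative^[k] g).eval t * (derivative q).eval t = 0 := by
      refine ih (derivative q) (by simpa using hq) fun i hi x hx => ?_
      have := hb i (by omega) x hx
      rwa [← Function.iterate_succ_apply, show (k - 1 - i).succ = k + 1 - 1 - i by omega]
    simp only [Function.iterate_succ_apply', mul_comm] at ibp h0 h1 hd ⊢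
    rw [ibp, h0, h1, hd]; simp

lemma eval_iterate_derivative_eq_zero_of_dvd {p : ℝ[X]} {x : ℝ} {n i : ℕ} (h : (X - C x) ^ n ∣ p)
    (hi : i < n) : (derivative^[i] p).eval x = 0 := by
  have h1 := pow_sub_dvd_iterate_derivative_of_pow_dvd i h
  have h2 : (X - C x) ∣ derivative^[i] p :=
    (dvd_pow_self _ (by omega)).trans h1
  exact dvd_iff_isRoot.1 h2

lemma natDegree_polarPoly_le (a b k : ℕ) : (polarPoly a b k).natDegree ≤ k := by
  refine natDegree_sum_le_of_forall_le _ _ fun j hj => ?_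
  have hj' : j ≤ k := by simpa [Nat.lt_succ_iff] using hj
  refine (natDegree_C_mul_le _ _).trans (natDegree_mul_le.trans ?_)
  have h1 : (1 - X : ℝ[X]).natDegree ≤ 1 := by compute_degree
  have h2 := natDegree_pow_le (p := (1 - X : ℝ[X])) (n := k - j)
  have h3 : (k - j) * (1 - X : ℝ[X]).natDegree ≤ (k - j) * 1 := Nat.mul_le_mul_left _ h1
  rw [natDegree_X_pow]
  omega

lemma X_pow_dvd_polarPoly (a b k : ℕ) : X ^ (k - a) ∣ polarPoly a b k := by
  refine Finset.dvd_sum fun j hj => ?_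
  rcases lt_or_ge a (k - j) with h2 | h2
  · simp [Nat.choose_eq_zero_of_lt h2]
  · exact dvd_mul_of_dvd_right (dvd_mul_of_dvd_left (pow_dvd_pow _ (by omega)) _) _

lemma one_sub_X_pow_dvd_polarPoly (a b k : ℕ) : (1 - X) ^ (k - b) ∣ polarPoly a b k := by
  refine Finset.dvd_sum fun j hj => ?_
  rcases lt_or_ge b j with h2 | h2
  · simp [Nat.choose_eq_zero_of_lt h2]
  · exact dvd_mul_of_dvd_right (dvd_mul_of_dvd_right (pow_dvd_pow _ (by omega)) _) _

/-- Polynomial orthogonality from the Rodrigues formula: the boundary terms vanish since the zeros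
of `rodriguesWeight a b` and `polarPoly a' b' k'` at `0` and `1` have total order at least `k`. -/
lemma integral_rodrigues_mul_polarPoly {a b k a' b' k' : ℕ} (ha : a + k' = a' + k)
    (hb : b + k' = b' + k) (hk : k' < k) :
    ∫ t in (0 : ℝ)..1, (derivative^[k] (rodriguesWeight a b)).eval t *
      (polarPoly a' b' k').eval t = 0 := by
  refine integral_iterate_derivative_mul_eq_zero _ _ _
    (iterate_derivative_eq_zero ((natDegree_polarPoly_le _ _ _).trans_lt hk)) ?_
  have hneg : ∀ n : ℕ, (X - C (1 : ℝ)) ^ n ∣ (1 - X) ^ n := fun n =>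
    pow_dvd_pow_of_dvd ⟨-1, by simp⟩ n
  intro i hi x hx
  rcases hx with rfl | hx
  · rcases lt_or_ge i a with h | h
    · rw [eval_iterate_derivative_eq_zero_of_dvd (n := a) _ h, zero_mul]
      simp [rodriguesWeight]
    · rw [eval_iterate_derivative_eq_zero_of_dvd (p := polarPoly a' b' k') (n := k' - a') _
        (by omega), mul_zero]
      simpa using X_pow_dvd_polarPoly a' b' k'
  · rw [mem_singleton_iff] at hx
    subst hx
    rcases lt_or_ge i b with h | h
    · rw [eval_iterate_derivative_eq_zero_of_dvd (n := b) _ h, zero_mul]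
      exact dvd_mul_of_dvd_right (hneg b) _
    · rw [eval_iterate_derivative_eq_zero_of_dvd (p := polarPoly a' b' k') (n := k' - b') _
        (by omega), mul_zero]
      exact (hneg _).trans (one_sub_X_pow_dvd_polarPoly a' b' k')

lemma half_angle_pos {θ : ℝ} (hθ : θ ∈ Ioo 0 Real.pi) :
    0 < Real.sin (θ / 2) ∧ 0 < Real.cos (θ / 2) :=
  ⟨Real.sin_pos_of_pos_of_lt_pi (by linarith [hθ.1]) (by linarith [hθ.2, hθ.1]),
    Real.cos_pos_of_mem_Ioo ⟨by linarith [hθ.1, Real.pi_pos], by linarith [hθ.2]⟩⟩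

/-- For equal spin weight and order, the powers of `s` and `c` in the product of a Rodrigues formula
and a polynomial formula cancel. -/
lemma polarHarm_mul_polarHarm {a b k a' b' k' : ℕ} (ha : a + k' = a' + k)
    (hb : b + k' = b' + k) {θ : ℝ} (hθ : θ ∈ Ioo 0 Real.pi) :
    polarHarm a b k (Real.cos (θ / 2)) (Real.sin (θ / 2)) *
        polarHarm a' b' k' (Real.cos (θ / 2)) (Real.sin (θ / 2)) =
      (hasseDeriv k (rodriguesWeight a b)).eval (Real.sin (θ / 2) ^ 2) *
        (polarPoly a' b' k').eval (Real.sin (θ / 2) ^ 2) := by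
  obtain ⟨h1, h2⟩ := half_angle_pos hθ
  set s := Real.sin (θ / 2)
  set c := Real.cos (θ / 2)
  have hcs : c ^ 2 + s ^ 2 = 1 := Real.cos_sq_add_sin_sq _
  have e1 := polarHarm_eq_hasseDeriv a b k hcs
  have e2 := polarHarm_eq_polarPoly a' b' k' hcs
  have hne : s ^ (a + k') * c ^ (b + k') ≠ 0 := by positivity
  apply mul_left_cancel₀ hne
  calc _ = (s ^ a * c ^ b * polarHarm a b k c s) * ((s * c) ^ k' * polarHarm a' b' k' c s) := by
        ring
    _ = s ^ (a' + k) * c ^ (b' + k) * ((hasseDeriv k (rodriguesWeight a b)).eval (s ^ 2) *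
          (polarPoly a' b' k').eval (s ^ 2)) := by rw [e1, e2]; ring
    _ = _ := by rw [ha, hb]

/-- The substitution `t = sin (θ / 2) ^ 2`. -/
lemma integral_half_angle (f : ℝ → ℝ) (hf : Continuous f) :
    ∫ θ in (0 : ℝ)..Real.pi, f (Real.sin (θ / 2) ^ 2) * Real.sin θ = 2 * ∫ t in (0 : ℝ)..1, f t := by
  have h := intervalIntegral.integral_comp_mul_deriv (a := 0) (b := Real.pi)
    (f := fun θ => Real.sin (θ / 2) ^ 2) (f' := fun θ => Real.sin θ / 2) (g := f)
    (fun x _ => by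
      have h1 : HasDerivAt (fun θ : ℝ => θ / 2) (1 / 2) x := (hasDerivAt_id x).div_const 2
      refine (h1.sin.pow 2).congr_deriv ?_
      have := Real.sin_two_mul (x / 2)
      rw [mul_div_cancel₀ x (two_ne_zero)] at this
      rw [this]; push_cast; ring) (by fun_prop) hf
  simp only [Function.comp, zero_div, Real.sin_zero, Real.sin_pi_div_two, one_pow] at h
  norm_num at h
  rw [← h, ← intervalIntegral.integral_const_mul]
  congr 1
  ext θ
  ring

lemma integral_polarHarm_of_lt {a b k a' b' k' : ℕ} (ha : a + k' = a' + k)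
    (hb : b + k' = b' + k) (hk : k' < k) :
    ∫ θ in (0 : ℝ)..Real.pi, polarHarm a b k (Real.cos (θ / 2)) (Real.sin (θ / 2)) *
        polarHarm a' b' k' (Real.cos (θ / 2)) (Real.sin (θ / 2)) * Real.sin θ = 0 := by
  have h1 : ∫ θ in (0 : ℝ)..Real.pi, polarHarm a b k (Real.cos (θ / 2)) (Real.sin (θ / 2)) *
        polarHarm a' b' k' (Real.cos (θ / 2)) (Real.sin (θ / 2)) * Real.sin θ =
      ∫ θ in (0 : ℝ)..Real.pi, (fun t => (hasseDeriv k (rodriguesWeight a b)).eval t *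
        (polarPoly a' b' k').eval t) (Real.sin (θ / 2) ^ 2) * Real.sin θ := by
    refine intervalIntegral.integral_congr fun θ hθ => ?_
    rw [uIcc_of_le Real.pi_pos.le] at hθ
    -- at the poles, where the formulas with powers of `s` and `c` degenerate, `sin θ = 0`
    rcases eq_or_lt_of_le hθ.1 with h0 | h0
    · simp [← h0]
    rcases eq_or_lt_of_le hθ.2 with hp | hp
    · simp [hp]
    simp only [polarHarm_mul_polarHarm ha hb ⟨h0, hp⟩]
  rw [h1, integral_half_angle (fun t => (hasseDeriv k (rodriguesWeight a b)).eval t *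
        (polarPoly a' b' k').eval t) (by fun_prop)]
  have h2 := integral_rodrigues_mul_polarPoly ha hb hk
  have h3 : ∀ t : ℝ, (derivative^[k] (rodriguesWeight a b)).eval t =
      (k ! : ℝ) * (hasseDeriv k (rodriguesWeight a b)).eval t := by
    intro t
    rw [← factorial_smul_hasseDeriv]
    simp
  simp only [h3, mul_assoc, intervalIntegral.integral_const_mul] at h2
  rcases mul_eq_zero.1 h2 with h | h
  · exact absurd h (by positivity)
  · rw [h, mul_zero]

lemma integral_polarHarm_of_ne {a b k a' b' k' : ℕ} (ha : a + k' = a' + k)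
    (hb : b + k' = b' + k) (hk : k ≠ k') :
    ∫ θ in (0 : ℝ)..Real.pi, polarHarm a b k (Real.cos (θ / 2)) (Real.sin (θ / 2)) *
        polarHarm a' b' k' (Real.cos (θ / 2)) (Real.sin (θ / 2)) * Real.sin θ = 0 := by
  rcases lt_or_gt_of_ne hk with h | h
  · have := integral_polarHarm_of_lt ha.symm hb.symm h
    rw [← this]
    congr 1; ext θ; ring
  · exact integral_polarHarm_of_lt ha hb h

lemma hasseDeriv_rodriguesWeight_ne_zero {a b k : ℕ} (hk : k ≤ a + b) :
    hasseDeriv k (rodriguesWeight a b) ≠ 0 := by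
  have h1 : (1 - X : ℝ[X]).natDegree = 1 := by
    rw [← neg_sub, natDegree_neg]; exact natDegree_X_sub_C (1 : ℝ)
  have h0 : (1 - X : ℝ[X]) ≠ 0 := fun h => by simp [h] at h1
  have hne : rodriguesWeight a b ≠ 0 := mul_ne_zero (pow_ne_zero _ X_ne_zero) (pow_ne_zero _ h0)
  have hdeg : (rodriguesWeight a b).natDegree = a + b := by
    rw [rodriguesWeight, natDegree_mul (pow_ne_zero _ X_ne_zero) (pow_ne_zero _ h0),
      natDegree_pow, natDegree_pow, natDegree_X, h1]; simp
  intro h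
  have hc : (hasseDeriv k (rodriguesWeight a b)).coeff (a + b - k) = 0 := by rw [h]; simp
  rw [hasseDeriv_coeff, Nat.sub_add_cancel hk, ← hdeg, coeff_natDegree] at hc
  rcases mul_eq_zero.1 hc with h' | h'
  · rw [Nat.cast_eq_zero, Nat.choose_eq_zero_iff] at h'
    omega
  · exact hne (leadingCoeff_eq_zero.1 h')

lemma continuous_polarHarm (a b k : ℕ) : Continuous fun θ : ℝ =>
    polarHarm a b k (Real.cos (θ / 2)) (Real.sin (θ / 2)) := by
  unfold polarHarm; fun_prop

lemma integral_polarHarm_sq_pos {a b k : ℕ} (hk : k ≤ a + b) :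
    0 < ∫ θ in (0 : ℝ)..Real.pi, polarHarm a b k (Real.cos (θ / 2)) (Real.sin (θ / 2)) *
        polarHarm a b k (Real.cos (θ / 2)) (Real.sin (θ / 2)) * Real.sin θ := by
  have hcont := continuous_polarHarm a b k
  refine intervalIntegral.integral_pos Real.pi_pos (by fun_prop) (fun θ hθ => ?_) ?_
  · exact mul_nonneg (mul_self_nonneg _) (Real.sin_nonneg_of_nonneg_of_le_pi hθ.1.le hθ.2)
  by_contra! hcon
  apply hasseDeriv_rodriguesWeight_ne_zero hk
  refine eq_zero_of_infinite_isRoot _ ((Ioo_infinite (zero_lt_one (α := ℝ))).mono fun t ht => ?_)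
  have hst : Real.sqrt t < 1 := by rw [Real.sqrt_lt' one_pos]; simpa using ht.2
  have hs0 : 0 < Real.sqrt t := Real.sqrt_pos.2 ht.1
  have hθ : 2 * Real.arcsin (Real.sqrt t) ∈ Ioo 0 Real.pi :=
    ⟨by have := Real.arcsin_pos.2 hs0; linarith,
      by have := Real.arcsin_lt_pi_div_two.2 hst; linarith⟩
  have hsin : Real.sin (2 * Real.arcsin (Real.sqrt t) / 2) ^ 2 = t := by
    rw [mul_div_cancel_left₀ _ (two_ne_zero), Real.sin_arcsin (by linarith) hst.le,
      Real.sq_sqrt ht.1.le]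
  obtain ⟨h1, h2⟩ := half_angle_pos hθ
  have hle := hcon _ (Ioo_subset_Icc_self hθ)
  have hsp := Real.sin_pos_of_pos_of_lt_pi hθ.1 hθ.2
  have hz := polarHarm_eq_hasseDeriv a b k (Real.cos_sq_add_sin_sq
    (2 * Real.arcsin (Real.sqrt t) / 2))
  rw [hsin] at hz
  have h0 : polarHarm a b k (Real.cos (2 * Real.arcsin (Real.sqrt t) / 2))
      (Real.sin (2 * Real.arcsin (Real.sqrt t) / 2)) = 0 := by
    by_contra hne
    have := mul_pos (mul_self_pos.2 hne) hsp
    linarith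
  rw [h0, mul_zero] at hz
  have hne : (Real.sin (2 * Real.arcsin (Real.sqrt t) / 2) *
      Real.cos (2 * Real.arcsin (Real.sqrt t) / 2)) ^ k ≠ 0 := by positivity
  exact (mul_eq_zero.1 hz.symm).resolve_left hne

end Polar

/-! ### Orthogonality and linear independence of the harmonics -/

/-- The spinor representing the point with polar angles `(θ, ϕ)`. -/
def spherePoint (ϕ θ : ℝ) : ℂ × ℂ :=
  ((Real.cos (θ / 2) : ℂ), (Real.sin (θ / 2) : ℂ) * Complex.exp (Complex.I * (ϕ : ℂ)))

lemma sphereIntegral_eq (f : ℂ × ℂ → ℂ) : sphereIntegral f =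
    ∫ ϕ in (0 : ℝ)..(2 * Real.pi), ∫ θ in (0 : ℝ)..Real.pi,
      f (spherePoint ϕ θ) * (Real.sin θ : ℂ) := rfl

lemma normSq_exp_I_mul (ϕ : ℝ) :
    Complex.exp (Complex.I * (ϕ : ℂ)) * conj (Complex.exp (Complex.I * (ϕ : ℂ))) = 1 := by
  rw [← Complex.exp_conj, ← Complex.exp_add]; simp

lemma conj_exp_I_mul (ϕ : ℝ) :
    conj (Complex.exp (Complex.I * (ϕ : ℂ))) = (Complex.exp (Complex.I * (ϕ : ℂ)))⁻¹ :=
  eq_inv_of_mul_eq_one_right (normSq_exp_I_mul ϕ)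

lemma spinorNormSq_spherePoint (ϕ θ : ℝ) : spinorNormSq (spherePoint ϕ θ) = 1 := by
  have h : ((spinorNormSq (spherePoint ϕ θ) : ℝ) : ℂ) = 1 := by
    have h1 : ((Real.cos (θ / 2) : ℝ) : ℂ) ^ 2 + ((Real.sin (θ / 2) : ℝ) : ℂ) ^ 2 = 1 := by
      exact_mod_cast Real.cos_sq_add_sin_sq (θ / 2)
    rw [spinorNormSq_eq]
    simp only [spherePoint, map_mul, Complex.conj_ofReal]
    linear_combination h1 + ((Real.sin (θ / 2) : ℝ) : ℂ) ^ 2 * normSq_exp_I_mul ϕ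
  exact_mod_cast h

lemma spherePoint_ne_zero (ϕ θ : ℝ) : spherePoint ϕ θ ≠ 0 := by
  intro h
  have := spinorNormSq_spherePoint ϕ θ
  rw [h] at this
  simp [spinorNormSq] at this

lemma continuous_spherePoint : Continuous fun x : ℝ × ℝ => spherePoint x.1 x.2 := by
  unfold spherePoint; fun_prop

lemma harm_spherePoint (a b k : ℕ) (ϕ θ : ℝ) : harm a b k (spherePoint ϕ θ) =
    Complex.exp (Complex.I * (ϕ : ℂ)) ^ ((a : ℤ) - k) *
      (polarHarm a b k (Real.cos (θ / 2)) (Real.sin (θ / 2)) : ℂ) := by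
  have he : Complex.exp (Complex.I * (ϕ : ℂ)) ≠ 0 := Complex.exp_ne_zero _
  rw [harm_eq_sum, polarHarm, Complex.ofReal_sum, Finset.mul_sum]
  refine Finset.sum_congr rfl fun j hj => ?_
  have hj' : j ≤ k := by simpa [Nat.lt_succ_iff] using hj
  rcases lt_or_ge a (k - j) with h2 | h2
  · simp [Nat.choose_eq_zero_of_lt h2]
  have e : Complex.exp (Complex.I * (ϕ : ℂ)) ^ ((a : ℤ) - k) =
      Complex.exp (Complex.I * (ϕ : ℂ)) ^ (a - (k - j)) *
        (Complex.exp (Complex.I * (ϕ : ℂ)))⁻¹ ^ j := by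
    rw [inv_pow, ← zpow_natCast, ← zpow_natCast, ← zpow_neg, ← zpow_add₀ he]
    congr 1
    omega
  simp only [spherePoint, map_mul, Complex.conj_ofReal, conj_exp_I_mul, e]
  push_cast
  ring

lemma Y_spherePoint {s l m : ℤ} (hs : |s| ≤ l) (hm : |m| ≤ l) (ϕ θ : ℝ) :
    Y s l m (spherePoint ϕ θ) = normY s l m * Complex.exp (Complex.I * (ϕ : ℂ)) ^ (m + s) *
      (polarHarm (l + m).toNat (l - m).toNat (l - s).toNat
        (Real.cos (θ / 2)) (Real.sin (θ / 2)) : ℂ) := by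
  rw [Y_eq hs hm, harm_spherePoint, spinorNormSq_spherePoint]
  have : ((l + m).toNat : ℤ) - (l - s).toNat = m + s := by
    rw [abs_le] at hs hm; omega
  rw [this]; simp [mul_assoc]

lemma normY_ne_zero {s l m : ℤ} (hs : |s| ≤ l) : normY s l m ≠ 0 := by
  have hl : (0 : ℝ) ≤ l := by exact_mod_cast (abs_nonneg s).trans hs
  rw [normY]
  refine mul_ne_zero (zpow_ne_zero _ (by norm_num)) ?_
  refine Complex.ofReal_ne_zero.2 (Real.sqrt_pos.2 ?_).ne'
  exact div_pos (mul_pos (div_pos (by linarith) (by positivity)) (by positivity)) (by positivity)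

lemma integral_exp_I_mul_zpow {k : ℤ} (hk : k ≠ 0) :
    ∫ ϕ in (0 : ℝ)..(2 * Real.pi), Complex.exp (Complex.I * (ϕ : ℂ)) ^ k = 0 := by
  have hc : (k : ℂ) * Complex.I ≠ 0 := mul_ne_zero (by exact_mod_cast hk) Complex.I_ne_zero
  have e : ∀ ϕ : ℝ, Complex.exp (Complex.I * (ϕ : ℂ)) ^ k =
      Complex.exp ((k : ℂ) * Complex.I * ϕ) := by
    intro ϕ
    rw [← Complex.exp_int_mul]; ring_nf
  simp only [e]
  rw [integral_exp_mul_complex hc]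
  have : (k : ℂ) * Complex.I * ((2 * Real.pi : ℝ) : ℂ) = k * (2 * Real.pi * Complex.I) := by
    push_cast; ring
  rw [this, Complex.exp_int_mul_two_pi_mul_I]
  simp

lemma sphereIntegral_conj_Y_mul_Y_eq {s l m l' m' : ℤ} (hs : |s| ≤ l) (hm : |m| ≤ l)
    (hs' : |s| ≤ l') (hm' : |m'| ≤ l') :
    sphereIntegral (fun o => conj (Y s l m o) * Y s l' m' o) =
      conj (normY s l m) * normY s l' m' *
        (∫ ϕ in (0 : ℝ)..(2 * Real.pi), Complex.exp (Complex.I * (ϕ : ℂ)) ^ (m' - m)) *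
        ((∫ θ in (0 : ℝ)..Real.pi,
          polarHarm (l + m).toNat (l - m).toNat (l - s).toNat
            (Real.cos (θ / 2)) (Real.sin (θ / 2)) *
          polarHarm (l' + m').toNat (l' - m').toNat (l' - s).toNat
            (Real.cos (θ / 2)) (Real.sin (θ / 2)) * Real.sin θ : ℝ) : ℂ) := by
  rw [sphereIntegral_eq, ← intervalIntegral.integral_const_mul,
    ← intervalIntegral.integral_mul_const]
  refine intervalIntegral.integral_congr fun ϕ _ => ?_
  rw [← intervalIntegral.integral_ofReal, ← intervalIntegral.integral_const_mul]
  refine intervalIntegral.integral_congr fun θ _ => ?_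
  rw [Y_spherePoint hs hm, Y_spherePoint hs' hm']
  have he : Complex.exp (Complex.I * (ϕ : ℂ)) ≠ 0 := Complex.exp_ne_zero _
  have e : Complex.exp (Complex.I * (ϕ : ℂ)) ^ (m' - m) =
      (Complex.exp (Complex.I * (ϕ : ℂ)))⁻¹ ^ (m + s) *
        Complex.exp (Complex.I * (ϕ : ℂ)) ^ (m' + s) := by
    rw [inv_zpow, ← zpow_neg, ← zpow_add₀ he]
    congr 1; ring
  simp only [map_mul, map_zpow₀, conj_exp_I_mul, Complex.conj_ofReal, e]
  push_cast
  ring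

lemma sphereIntegral_zero : sphereIntegral (fun _ => 0) = 0 := by simp [sphereIntegral]

/-- Harmonics of the same spin weight with different labels are orthogonal. -/
lemma sphereIntegral_conj_Y_mul_Y {s l m l' m' : ℤ} (h : (l, m) ≠ (l', m')) :
    sphereIntegral (fun o => conj (Y s l m o) * Y s l' m' o) = 0 := by
  by_cases h1 : |s| ≤ l ∧ |m| ≤ l
  swap
  · simp only [Y_eq_zero h1, map_zero, zero_mul, sphereIntegral_zero]
  by_cases h2 : |s| ≤ l' ∧ |m'| ≤ l'
  swap
  · simp only [Y_eq_zero h2, mul_zero, sphereIntegral_zero]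
  rw [sphereIntegral_conj_Y_mul_Y_eq h1.1 h1.2 h2.1 h2.2]
  by_cases hm : m = m'
  · subst hm
    have hl : l ≠ l' := fun h' => h (by rw [h'])
    obtain ⟨⟨a1, a2⟩, a3, a4⟩ := h1.imp abs_le.1 abs_le.1
    obtain ⟨⟨b1, b2⟩, b3, b4⟩ := h2.imp abs_le.1 abs_le.1
    rw [integral_polarHarm_of_ne (by omega) (by omega) (by omega)]
    simp
  · rw [integral_exp_I_mul_zpow (sub_ne_zero.2 (Ne.symm hm))]
    simp

lemma sphereIntegral_conj_Y_mul_self_ne_zero {s l m : ℤ} (hs : |s| ≤ l) (hm : |m| ≤ l) :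
    sphereIntegral (fun o => conj (Y s l m o) * Y s l m o) ≠ 0 := by
  rw [sphereIntegral_conj_Y_mul_Y_eq hs hm hs hm]
  have hn := normY_ne_zero (m := m) hs
  refine mul_ne_zero (mul_ne_zero (mul_ne_zero (by simpa using hn) hn) ?_) ?_
  · simp [Real.pi_ne_zero]
  · rw [abs_le] at hs hm
    exact_mod_cast (integral_polarHarm_sq_pos (by omega)).ne'

lemma sphereIntegral_sum {ι : Type*} (t : Finset ι) (f : ι → ℂ × ℂ → ℂ)
    (hf : ∀ i ∈ t, Continuous fun x : ℝ × ℝ => f i (spherePoint x.1 x.2)) :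
    sphereIntegral (fun o => ∑ i ∈ t, f i o) = ∑ i ∈ t, sphereIntegral (f i) := by
  simp only [sphereIntegral_eq, Finset.sum_mul]
  have hf' : ∀ i ∈ t, Continuous (Function.uncurry fun ϕ θ : ℝ =>
      f i (spherePoint ϕ θ) * (Real.sin θ : ℂ)) := fun i hi =>
    (hf i hi).mul (by fun_prop)
  rw [← intervalIntegral.integral_finsetSum]
  · refine intervalIntegral.integral_congr fun ϕ _ => ?_
    rw [intervalIntegral.integral_finsetSum]
    intro i hi
    exact ((hf' i hi).comp (Continuous.prodMk_right ϕ)).intervalIntegrable _ _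
  · intro i hi
    exact (intervalIntegral.continuous_parametric_intervalIntegral_of_continuous'
      (hf' i hi) _ _).intervalIntegrable _ _

lemma sphereIntegral_const_mul (c : ℂ) (f : ℂ × ℂ → ℂ) :
    sphereIntegral (fun o => c * f o) = c * sphereIntegral f := by
  simp only [sphereIntegral_eq, mul_assoc, intervalIntegral.integral_const_mul]

lemma continuousOn_Y (s l m : ℤ) : ContinuousOn (Y s l m) {o | o ≠ 0} := fun _ ho =>
  (differentiableAt_Y s l m ho).continuousAt.continuousWithinAt

lemma continuous_comp_spherePoint {f : ℂ × ℂ → ℂ} (hf : ContinuousOn f {o | o ≠ 0}) :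
    Continuous fun x : ℝ × ℝ => f (spherePoint x.1 x.2) :=
  hf.comp_continuous continuous_spherePoint fun x => spherePoint_ne_zero x.1 x.2

/-- Linear independence of the harmonics of given spin weight, for labels for which they do not
vanish identically. -/
lemma Y_coeff_eq_zero {s : ℤ} {t : Finset (ℤ × ℤ)} {c : ℤ × ℤ → ℂ}
    (h : ∀ o : ℂ × ℂ, o ≠ 0 → ∑ x ∈ t, c x * Y s x.1 x.2 o = 0) {x : ℤ × ℤ} (hx : x ∈ t)
    (hs : |s| ≤ x.1) (hm : |x.2| ≤ x.1) : c x = 0 := by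
  have h1 : sphereIntegral (fun o => ∑ y ∈ t, c y * (conj (Y s x.1 x.2 o) * Y s y.1 y.2 o)) = 0 := by
    rw [sphereIntegral_eq]
    have : ∀ ϕ θ : ℝ, ∑ y ∈ t, c y * (conj (Y s x.1 x.2 (spherePoint ϕ θ)) *
        Y s y.1 y.2 (spherePoint ϕ θ)) = 0 := by
      intro ϕ θ
      have := congrArg (conj (Y s x.1 x.2 (spherePoint ϕ θ)) * ·) (h _ (spherePoint_ne_zero ϕ θ))
      simp only [Finset.mul_sum, mul_zero] at this
      rw [← this]
      exact Finset.sum_congr rfl fun y _ => by ring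
    simp [this]
  rw [sphereIntegral_sum] at h1
  · simp only [sphereIntegral_const_mul] at h1
    rw [Finset.sum_eq_single_of_mem x hx] at h1
    · exact (mul_eq_zero.1 h1).resolve_right (sphereIntegral_conj_Y_mul_self_ne_zero hs hm)
    · intro y _ hy
      rw [sphereIntegral_conj_Y_mul_Y (by simpa using hy.symm), mul_zero]
  · intro y _
    have h2 := continuous_comp_spherePoint (continuousOn_Y s x.1 x.2)
    have h3 := continuous_comp_spherePoint (continuousOn_Y s y.1 y.2)
    exact continuous_const.mul ((Complex.continuous_conj.comp h2).mul h3)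

/-- A finite combination of point evaluations which picks out the coefficient of one harmonic. -/
lemma exists_dual_evaluation {s : ℤ} {t : Finset (ℤ × ℤ)} {x : ℤ × ℤ} (hx : x ∈ t)
    (hs : |s| ≤ x.1) (hm : |x.2| ≤ x.1) :
    ∃ (N : ℕ) (w : Fin N → ℂ) (P : Fin N → ℂ × ℂ), (∀ i, P i ≠ 0) ∧
      ∀ y ∈ t, ∑ i, w i * Y s y.1 y.2 (P i) = if y = x then 1 else 0 := by
  classical
  let ev : ℂ × ℂ → (t → ℂ) := fun o y => Y s y.1.1 y.1.2 o
  have hmem : (Pi.single ⟨x, hx⟩ 1 : t → ℂ) ∈ Submodule.span ℂ (ev '' {o | o ≠ 0}) := by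
    by_contra hnot
    obtain ⟨f, hf1, hf2⟩ := Submodule.exists_le_ker_of_notMem hnot
    apply hf1
    have key : ∀ o : ℂ × ℂ, o ≠ 0 → ∑ y ∈ t,
        (if hy : y ∈ t then f (Pi.single ⟨y, hy⟩ 1) else 0) * Y s y.1 y.2 o = 0 := by
      intro o ho
      have h1 : f (ev o) = 0 := hf2 (Submodule.subset_span ⟨o, ho, rfl⟩)
      rw [LinearMap.pi_apply_eq_sum_univ f (ev o)] at h1
      rw [← h1, ← Finset.sum_coe_sort t]
      refine Finset.sum_congr rfl fun y _ => ?_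
      rw [dif_pos y.2, smul_eq_mul, mul_comm]
      congr 2
      ext z
      simp [Pi.single_apply, eq_comm]
    have := Y_coeff_eq_zero key hx hs hm
    rwa [dif_pos hx] at this
  obtain ⟨N, w, g, hg⟩ := Submodule.mem_span_set'.1 hmem
  choose P hP using fun i => (g i).2
  refine ⟨N, w, P, fun i => (hP i).1, fun y hy => ?_⟩
  have := congrFun hg ⟨y, hy⟩
  simp only [Finset.sum_apply, Pi.smul_apply, smul_eq_mul, Pi.single_apply, Subtype.mk.injEq]
    at this
  rw [← this]
  refine Finset.sum_congr rfl fun i _ => ?_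
  rw [← (hP i).2]

section

/-! ### Directional derivatives up to the cylinder -/

/-- The domain of the field components, with the cylinder `ρ = 0` as boundary. -/
def slab (ρ₀ : ℝ) : Set (ℝ × ℝ × (ℂ × ℂ)) :=
  Ioo (-1 : ℝ) 1 ×ˢ (Ico (0 : ℝ) ρ₀ ×ˢ {o : ℂ × ℂ | o ≠ 0})

/-- The derivative in the direction `v`, one-sided at the cylinder. -/
def dir (ρ₀ : ℝ) (v : ℝ × ℝ × (ℂ × ℂ)) (G : ℝ × ℝ × (ℂ × ℂ) → ℂ) : ℝ × ℝ × (ℂ × ℂ) → ℂ :=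
  fun q => fderivWithin ℝ G (slab ρ₀) q v

/-- The derivative in the direction of `τ`. -/
abbrev dirTau (ρ₀ : ℝ) : (ℝ × ℝ × (ℂ × ℂ) → ℂ) → ℝ × ℝ × (ℂ × ℂ) → ℂ := dir ρ₀ (1, 0, 0)

/-- The derivative in the direction of `ρ`. -/
abbrev dirRho (ρ₀ : ℝ) : (ℝ × ℝ × (ℂ × ℂ) → ℂ) → ℝ × ℝ × (ℂ × ℂ) → ℂ := dir ρ₀ (0, 1, 0)

variable {ρ₀ : ℝ} {G H : ℝ × ℝ × (ℂ × ℂ) → ℂ}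

lemma isOpen_ne_zero : IsOpen {o : ℂ × ℂ | o ≠ 0} := isOpen_ne

lemma uniqueDiffOn_slab (ρ₀ : ℝ) : UniqueDiffOn ℝ (slab ρ₀) :=
  isOpen_Ioo.uniqueDiffOn.prod ((uniqueDiffOn_Ico 0 ρ₀).prod isOpen_ne_zero.uniqueDiffOn)

lemma slab_subset_closure_interior (hρ₀ : 0 < ρ₀) : slab ρ₀ ⊆ closure (interior (slab ρ₀)) := by
  rw [slab, interior_prod_eq, interior_prod_eq, isOpen_ne_zero.interior_eq, isOpen_Ioo.interior_eq,
    interior_Ico, closure_prod_eq, closure_prod_eq, closure_Ioo hρ₀.ne]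
  exact prod_mono subset_closure (prod_mono Ico_subset_Icc_self subset_closure)

lemma contDiffOn_dir (hG : ContDiffOn ℝ ∞ G (slab ρ₀)) (v : ℝ × ℝ × (ℂ × ℂ)) :
    ContDiffOn ℝ ∞ (dir ρ₀ v G) (slab ρ₀) :=
  (hG.fderivWithin (uniqueDiffOn_slab ρ₀) (by simp)).clm_apply contDiffOn_const

lemma contDiffOn_dir_iterate (hG : ContDiffOn ℝ ∞ G (slab ρ₀))
    (v : ℝ × ℝ × (ℂ × ℂ)) (p : ℕ) : ContDiffOn ℝ ∞ ((dir ρ₀ v)^[p] G) (slab ρ₀) := by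
  induction p with
  | zero => exact hG
  | succ p ih => rw [Function.iterate_succ_apply']; exact contDiffOn_dir ih v

lemma differentiableWithinAt_slab (hG : ContDiffOn ℝ ∞ G (slab ρ₀)) {q : ℝ × ℝ × (ℂ × ℂ)}
    (hq : q ∈ slab ρ₀) : DifferentiableWithinAt ℝ G (slab ρ₀) q :=
  (hG.differentiableOn (by simp)) q hq

lemma dir_congr (h : EqOn G H (slab ρ₀)) (v : ℝ × ℝ × (ℂ × ℂ)) :
    EqOn (dir ρ₀ v G) (dir ρ₀ v H) (slab ρ₀) := fun q hq => by
  simp only [dir]; rw [fderivWithin_congr h (h hq)]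

lemma dir_iterate_congr (h : EqOn G H (slab ρ₀)) (v : ℝ × ℝ × (ℂ × ℂ)) (p : ℕ) :
    EqOn ((dir ρ₀ v)^[p] G) ((dir ρ₀ v)^[p] H) (slab ρ₀) := by
  induction p with
  | zero => exact h
  | succ p ih => simp only [Function.iterate_succ_apply']; exact dir_congr ih v

lemma dir_comm (hρ₀ : 0 < ρ₀) (hG : ContDiffOn ℝ ∞ G (slab ρ₀)) (v w : ℝ × ℝ × (ℂ × ℂ)) :
    EqOn (dir ρ₀ v (dir ρ₀ w G)) (dir ρ₀ w (dir ρ₀ v G)) (slab ρ₀) := fun q hq => by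
  have hu := uniqueDiffOn_slab ρ₀
  have hd : DifferentiableWithinAt ℝ (fderivWithin ℝ G (slab ρ₀)) (slab ρ₀) q :=
    ((hG.fderivWithin hu (m := 1) (by norm_cast)).differentiableOn (by simp)) q hq
  have key : ∀ v w : ℝ × ℝ × (ℂ × ℂ), dir ρ₀ v (dir ρ₀ w G) q =
      fderivWithin ℝ (fderivWithin ℝ G (slab ρ₀)) (slab ρ₀) q v w := by
    intro v w
    have h1 : HasFDerivWithinAt (dir ρ₀ w G) _ (slab ρ₀) q :=
      hd.hasFDerivWithinAt.clm_apply (hasFDerivWithinAt_const w q (slab ρ₀))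
    rw [dir, h1.fderivWithin (hu q hq)]
    simp
  rw [key, key]
  exact (hG q hq).isSymmSndFDerivWithinAt
    (by rw [minSmoothness_of_isRCLikeNormedField]; norm_cast) hu
    (slab_subset_closure_interior hρ₀ hq) hq v w

lemma dir_iterate_comm (hρ₀ : 0 < ρ₀) (hG : ContDiffOn ℝ ∞ G (slab ρ₀))
    (v w : ℝ × ℝ × (ℂ × ℂ)) (p : ℕ) :
    EqOn (dir ρ₀ v ((dir ρ₀ w)^[p] G)) ((dir ρ₀ w)^[p] (dir ρ₀ v G)) (slab ρ₀) := by
  induction p generalizing G with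
  | zero => exact fun q _ => rfl
  | succ p ih =>
    simp only [Function.iterate_succ_apply]
    exact (ih (contDiffOn_dir hG w)).trans (dir_iterate_congr (dir_comm hρ₀ hG v w) w p)

lemma dir_add (hG : ContDiffOn ℝ ∞ G (slab ρ₀)) (hH : ContDiffOn ℝ ∞ H (slab ρ₀))
    (v : ℝ × ℝ × (ℂ × ℂ)) : EqOn (dir ρ₀ v (fun q => G q + H q))
      (fun q => dir ρ₀ v G q + dir ρ₀ v H q) (slab ρ₀) := fun q hq => by
  simp only [dir]
  rw [fderivWithin_fun_add (uniqueDiffOn_slab ρ₀ q hq) (differentiableWithinAt_slab hG hq)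
    (differentiableWithinAt_slab hH hq)]
  rfl

lemma dir_mul (hG : ContDiffOn ℝ ∞ G (slab ρ₀)) (hH : ContDiffOn ℝ ∞ H (slab ρ₀))
    (v : ℝ × ℝ × (ℂ × ℂ)) : EqOn (dir ρ₀ v (fun q => G q * H q))
      (fun q => G q * dir ρ₀ v H q + H q * dir ρ₀ v G q) (slab ρ₀) := fun q hq => by
  simp only [dir]
  rw [fderivWithin_fun_mul (uniqueDiffOn_slab ρ₀ q hq) (differentiableWithinAt_slab hG hq)
    (differentiableWithinAt_slab hH hq)]
  rfl

lemma dir_const_mul (hG : ContDiffOn ℝ ∞ G (slab ρ₀)) (c : ℂ)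
    (v : ℝ × ℝ × (ℂ × ℂ)) : EqOn (dir ρ₀ v (fun q => c * G q)) (fun q => c * dir ρ₀ v G q)
      (slab ρ₀) := fun q hq => by
  have := dir_mul (contDiffOn_const (c := c)) hG v hq
  rw [this]
  simp [dir]

lemma dir_iterate_add (hG : ContDiffOn ℝ ∞ G (slab ρ₀))
    (hH : ContDiffOn ℝ ∞ H (slab ρ₀)) (v : ℝ × ℝ × (ℂ × ℂ)) (p : ℕ) :
    EqOn ((dir ρ₀ v)^[p] (fun q => G q + H q))
      (fun q => (dir ρ₀ v)^[p] G q + (dir ρ₀ v)^[p] H q) (slab ρ₀) := by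
  induction p generalizing G H with
  | zero => exact fun q _ => rfl
  | succ p ih =>
    simp only [Function.iterate_succ_apply]
    exact (dir_iterate_congr (dir_add hG hH v) v p).trans
      (ih (contDiffOn_dir hG v) (contDiffOn_dir hH v))

lemma dir_iterate_const_mul (hG : ContDiffOn ℝ ∞ G (slab ρ₀)) (c : ℂ)
    (v : ℝ × ℝ × (ℂ × ℂ)) (p : ℕ) :
    EqOn ((dir ρ₀ v)^[p] (fun q => c * G q)) (fun q => c * (dir ρ₀ v)^[p] G q) (slab ρ₀) := by
  induction p generalizing G with
  | zero => exact fun q _ => rfl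
  | succ p ih =>
    simp only [Function.iterate_succ_apply]
    exact (dir_iterate_congr (dir_const_mul hG c v) v p).trans (ih (contDiffOn_dir hG v))

lemma contDiff_ofReal_comp {E : Type*} [NormedAddCommGroup E] [NormedSpace ℝ E] {f : E → ℝ}
    (hf : ContDiff ℝ ∞ f) : ContDiff ℝ ∞ fun q => ((f q : ℝ) : ℂ) :=
  Complex.ofRealCLM.contDiff.comp hf

lemma contDiff_rho : ContDiff ℝ ∞ fun q : ℝ × ℝ × (ℂ × ℂ) => (q.2.1 : ℂ) :=
  contDiff_ofReal_comp (by fun_prop)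

lemma dir_rho (v : ℝ × ℝ × (ℂ × ℂ)) {q : ℝ × ℝ × (ℂ × ℂ)} (hq : q ∈ slab ρ₀) :
    dir ρ₀ v (fun q => (q.2.1 : ℂ)) q = v.2.1 := by
  let L : ℝ × ℝ × (ℂ × ℂ) →L[ℝ] ℂ := Complex.ofRealCLM.comp
    ((ContinuousLinearMap.fst ℝ ℝ (ℂ × ℂ)).comp (ContinuousLinearMap.snd ℝ ℝ (ℝ × (ℂ × ℂ))))
  have : HasFDerivWithinAt (fun q : ℝ × ℝ × (ℂ × ℂ) => (q.2.1 : ℂ)) L (slab ρ₀) q :=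
    L.hasFDerivWithinAt
  rw [dir, this.fderivWithin (uniqueDiffOn_slab ρ₀ q hq)]
  rfl

lemma dirRho_iterate_rho_mul (hG : ContDiffOn ℝ ∞ G (slab ρ₀)) (p : ℕ) :
    EqOn ((dirRho ρ₀)^[p] (fun q => (q.2.1 : ℂ) * dirRho ρ₀ G q))
      (fun q => (q.2.1 : ℂ) * (dirRho ρ₀)^[p + 1] G q + p * (dirRho ρ₀)^[p] G q) (slab ρ₀) := by
  induction p generalizing G with
  | zero => intro q _; simp
  | succ p ih =>
    have hR := contDiffOn_dir hG (0, 1, 0)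
    have h1 : EqOn (dirRho ρ₀ (fun q => (q.2.1 : ℂ) * dirRho ρ₀ G q))
        (fun q => (q.2.1 : ℂ) * dirRho ρ₀ (dirRho ρ₀ G) q + dirRho ρ₀ G q) (slab ρ₀) := by
      intro q hq
      have := dir_mul contDiff_rho.contDiffOn hR (0, 1, 0) hq
      simp only [dir_rho _ hq] at this
      simpa using this
    intro q hq
    rw [Function.iterate_succ_apply, dir_iterate_congr h1 _ p hq,
      dir_iterate_add (contDiff_rho.contDiffOn.mul (contDiffOn_dir hR _)) hR _ p hq]
    simp only
    rw [ih hR hq]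
    simp only [← Function.iterate_succ_apply]
    push_cast
    ring

lemma hasDerivWithinAt_rho (hG : ContDiffOn ℝ ∞ G (slab ρ₀)) {T : Set ℝ} (hT : T ⊆ Ico 0 ρ₀)
    {τ r : ℝ} {o : ℂ × ℂ} (hτ : τ ∈ Ioo (-1 : ℝ) 1) (hr : r ∈ T) (ho : o ≠ 0) :
    HasDerivWithinAt (fun r => G (τ, r, o)) (dirRho ρ₀ G (τ, r, o)) T r := by
  have h1 : HasDerivWithinAt (fun r : ℝ => ((τ, r, o) : ℝ × ℝ × (ℂ × ℂ))) (0, 1, 0) T r :=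
    (hasDerivWithinAt_const r T τ).prodMk ((hasDerivWithinAt_id r T).prodMk
      (hasDerivWithinAt_const r T o))
  have hmaps : MapsTo (fun r : ℝ => ((τ, r, o) : ℝ × ℝ × (ℂ × ℂ))) T (slab ρ₀) :=
    fun x hx => ⟨hτ, hT hx, ho⟩
  exact (differentiableWithinAt_slab hG (hmaps hr)).hasFDerivWithinAt.comp_hasDerivWithinAt r h1
    hmaps

lemma hasDerivAt_rho (hG : ContDiffOn ℝ ∞ G (slab ρ₀)) {τ r : ℝ} {o : ℂ × ℂ}
    (hτ : τ ∈ Ioo (-1 : ℝ) 1) (hr : r ∈ Ioo 0 ρ₀) (ho : o ≠ 0) :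
    HasDerivAt (fun r => G (τ, r, o)) (dirRho ρ₀ G (τ, r, o)) r :=
  (hasDerivWithinAt_rho hG Ioo_subset_Ico_self hτ hr ho).hasDerivAt (isOpen_Ioo.mem_nhds hr)

lemma hasDerivAt_tau (hG : ContDiffOn ℝ ∞ G (slab ρ₀)) {τ r : ℝ} {o : ℂ × ℂ}
    (hτ : τ ∈ Ioo (-1 : ℝ) 1) (hr : r ∈ Ico 0 ρ₀) (ho : o ≠ 0) :
    HasDerivAt (fun t => G (t, r, o)) (dirTau ρ₀ G (τ, r, o)) τ := by
  have h1 : HasDerivWithinAt (fun t : ℝ => ((t, r, o) : ℝ × ℝ × (ℂ × ℂ))) (1, 0, 0)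
      (Ioo (-1 : ℝ) 1) τ :=
    (hasDerivWithinAt_id τ _).prodMk ((hasDerivWithinAt_const τ _ r).prodMk
      (hasDerivWithinAt_const τ _ o))
  have hmaps : MapsTo (fun t : ℝ => ((t, r, o) : ℝ × ℝ × (ℂ × ℂ))) (Ioo (-1 : ℝ) 1) (slab ρ₀) :=
    fun x hx => ⟨hx, hr, ho⟩
  exact ((differentiableWithinAt_slab hG (hmaps hτ)).hasFDerivWithinAt.comp_hasDerivWithinAt τ h1
    hmaps).hasDerivAt (isOpen_Ioo.mem_nhds hτ)

lemma fderiv_sphere (hG : ContDiffOn ℝ ∞ G (slab ρ₀)) {τ r : ℝ} {o : ℂ × ℂ}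
    (hτ : τ ∈ Ioo (-1 : ℝ) 1) (hr : r ∈ Ico 0 ρ₀) (ho : o ≠ 0) (v : ℂ × ℂ) :
    fderiv ℝ (fun o => G (τ, r, o)) o v = dir ρ₀ (0, 0, v) G (τ, r, o) := by
  have h1 : HasFDerivWithinAt (fun o : ℂ × ℂ => ((τ, r, o) : ℝ × ℝ × (ℂ × ℂ)))
      ((0 : ℂ × ℂ →L[ℝ] ℝ).prod ((0 : ℂ × ℂ →L[ℝ] ℝ).prod (ContinuousLinearMap.id ℝ (ℂ × ℂ))))
      {o | o ≠ 0} o :=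
    (hasFDerivWithinAt_const τ o _).prodMk ((hasFDerivWithinAt_const r o _).prodMk
      (hasFDerivWithinAt_id o _))
  have hmaps : MapsTo (fun o : ℂ × ℂ => ((τ, r, o) : ℝ × ℝ × (ℂ × ℂ))) {o | o ≠ 0} (slab ρ₀) :=
    fun x hx => ⟨hτ, hr, hx⟩
  have h2 := ((differentiableWithinAt_slab hG (hmaps ho)).hasFDerivWithinAt.comp o h1
    hmaps).hasFDerivAt (isOpen_ne_zero.mem_nhds ho)
  have h3 : fderiv ℝ (fun o => G (τ, r, o)) o = _ := h2.fderiv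
  rw [h3]
  rfl

lemma iteratedDerivWithin_rho (hG : ContDiffOn ℝ ∞ G (slab ρ₀)) {T : Set ℝ}
    (hT : T ⊆ Ico 0 ρ₀) (hu : UniqueDiffOn ℝ T) {τ r : ℝ} {o : ℂ × ℂ}
    (hτ : τ ∈ Ioo (-1 : ℝ) 1) (hr : r ∈ T) (ho : o ≠ 0) (p : ℕ) :
    iteratedDerivWithin p (fun r => G (τ, r, o)) T r = (dirRho ρ₀)^[p] G (τ, r, o) := by
  induction p generalizing r with
  | zero => simp
  | succ p ih =>
    rw [iteratedDerivWithin_succ, Function.iterate_succ_apply']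
    have h := hasDerivWithinAt_rho (contDiffOn_dir_iterate hG (0, 1, 0) p) hT hτ hr ho
    exact (h.congr (fun x hx => ih hx) (ih hr)).derivWithin (hu r hr)

/-- A smooth function vanishing for `ρ > 0` on a ray vanishes to infinite order at `ρ = 0`. -/
lemma dirRho_iterate_eq_zero (hρ₀ : 0 < ρ₀) (hG : ContDiffOn ℝ ∞ G (slab ρ₀)) {τ : ℝ}
    {o : ℂ × ℂ} (hτ : τ ∈ Ioo (-1 : ℝ) 1) (ho : o ≠ 0)
    (h : ∀ r ∈ Ioo 0 ρ₀, G (τ, r, o) = 0) (p : ℕ) : (dirRho ρ₀)^[p] G (τ, 0, o) = 0 := by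
  have h0 : ContinuousWithinAt (fun r => G (τ, r, o)) (Ioo 0 ρ₀) 0 :=
    ((hasDerivWithinAt_rho hG subset_rfl hτ ⟨le_rfl, hρ₀⟩ ho).continuousWithinAt).mono
      Ioo_subset_Ico_self
  have h1 : G (τ, 0, o) = 0 := by
    have hne : (𝓝[Ioo 0 ρ₀] (0 : ℝ)).NeBot := left_nhdsWithin_Ioo_neBot hρ₀
    refine tendsto_nhds_unique h0 (Tendsto.congr' ?_ tendsto_const_nhds)
    filter_upwards [self_mem_nhdsWithin] with r hr
    exact (h r hr).symm
  rw [← iteratedDerivWithin_rho hG subset_rfl (uniqueDiffOn_Ico 0 ρ₀) hτ ⟨le_rfl, hρ₀⟩ ho p]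
  have h2 : EqOn (fun r => G (τ, r, o)) (fun _ => 0) (Ico 0 ρ₀) := by
    intro r hr
    rcases eq_or_lt_of_le hr.1 with h3 | h3
    · rw [← h3]; exact h1
    · exact h r ⟨h3, hr.2⟩
  rw [iteratedDerivWithin_congr h2 ⟨le_rfl, hρ₀⟩]
  simp

end

section

/-! ### From the field equations to transport equations -/

variable {ρ₀ : ℝ} {Φ : Fin 5 → ℝ → ℝ → ℂ × ℂ → ℂ} {a : Fin 5 → ℕ → ℤ → ℤ → ℝ → ℂ}

/-- The component `Φ n` as a function on the slab. -/
def component (Φ : Fin 5 → ℝ → ℝ → ℂ × ℂ → ℂ) (n : Fin 5) : ℝ × ℝ × (ℂ × ℂ) → ℂ :=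
  fun q => Φ n q.1 q.2.1 q.2.2

/-- A box containing the labels `(L, m)` of all harmonics in the Taylor coefficient of order `p`,
whose degrees are `L = l - 1 ≤ p - 1`. -/
def labels (p : ℕ) : Finset (ℤ × ℤ) := Finset.Icc (-1) ((p : ℤ) - 1) ×ˢ Finset.Icc (-(p : ℤ)) p

lemma sum_labels (n p : ℕ) (c : ℤ → ℤ → ℂ) (o : ℂ × ℂ) :
    ∑ l ∈ Finset.Icc |2 - (n : ℤ)| (p : ℤ), ∑ m ∈ Finset.Icc (-l) l,
      c l m * Y (2 - (n : ℤ)) (l - 1) m o =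
    ∑ x ∈ labels p, c (x.1 + 1) x.2 * Y (2 - (n : ℤ)) x.1 x.2 o := by
  have h1 : ∀ l ∈ Finset.Icc |2 - (n : ℤ)| (p : ℤ), ∑ m ∈ Finset.Icc (-l) l,
      c l m * Y (2 - (n : ℤ)) (l - 1) m o = ∑ m ∈ Finset.Icc (-(p : ℤ)) p,
      c l m * Y (2 - (n : ℤ)) (l - 1) m o := by
    intro l hl
    rw [Finset.mem_Icc] at hl
    refine Finset.sum_subset (Finset.Icc_subset_Icc (by omega) (by omega)) fun m _ hm => ?_
    rw [Y_eq_zero, mul_zero]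
    rintro ⟨_, h⟩
    rw [abs_le] at h
    exact hm (Finset.mem_Icc.2 ⟨by omega, by omega⟩)
  rw [Finset.sum_congr rfl h1, labels, Finset.sum_product]
  have h2 : ∑ l ∈ Finset.Icc |2 - (n : ℤ)| (p : ℤ), ∑ m ∈ Finset.Icc (-(p : ℤ)) p,
      c l m * Y (2 - (n : ℤ)) (l - 1) m o = ∑ l ∈ Finset.Icc (0 : ℤ) p,
      ∑ m ∈ Finset.Icc (-(p : ℤ)) p, c l m * Y (2 - (n : ℤ)) (l - 1) m o := by
    refine Finset.sum_subset (Finset.Icc_subset_Icc (abs_nonneg _) le_rfl) fun l hl hl' => ?_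
    refine Finset.sum_eq_zero fun m _ => ?_
    rw [Y_eq_zero, mul_zero]
    rintro ⟨h, _⟩
    rw [Finset.mem_Icc] at hl hl'
    omega
  rw [h2]
  refine Finset.sum_nbij' (fun l => l - 1) (fun l => l + 1) ?_ ?_ ?_ ?_ ?_
  · intro l hl; simp only [Finset.mem_Icc] at hl ⊢; omega
  · intro l hl; simp only [Finset.mem_Icc] at hl ⊢; omega
  · intro l _; ring
  · intro l _; ring
  · intro l _; simp

lemma HasExpansion.contDiffOn (h : HasExpansion ρ₀ Φ a) (n : Fin 5) :
    ContDiffOn ℝ ∞ (component Φ n) (slab ρ₀) := h.smooth n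

lemma HasExpansion.dirRho_iterate (hρ₀ : 0 < ρ₀) (h : HasExpansion ρ₀ Φ a) (n : Fin 5) (p : ℕ)
    {τ : ℝ} (hτ : τ ∈ Ioo (-1 : ℝ) 1) {o : ℂ × ℂ} (ho : o ≠ 0) :
    (dirRho ρ₀)^[p] (component Φ n) (τ, 0, o) =
      ∑ x ∈ labels p, a n p (x.1 + 1) x.2 τ * Y (2 - (n : ℤ)) x.1 x.2 o := by
  rw [← sum_labels (n : ℕ) p (fun l m => a n p l m τ) o, ← h.expansion n p τ hτ o ho,
    ← iteratedDerivWithin_rho (h.contDiffOn n) subset_rfl (uniqueDiffOn_Ico 0 ρ₀) hτ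
      ⟨le_rfl, hρ₀⟩ ho p]
  rfl

lemma mem_labels {p : ℕ} {l m : ℤ} (hl : l ≤ p) (h0 : 0 ≤ l) (hm : |m| ≤ l - 1) :
    (l - 1, m) ∈ labels p := by
  rw [abs_le] at hm
  simp only [labels, Finset.mem_product, Finset.mem_Icc]
  omega

lemma HasExpansion.eq_zero (h : HasExpansion ρ₀ Φ a) {n : Fin 5} {l m : ℤ}
    (hlm : ¬(|2 - (n : ℤ)| ≤ l - 1 ∧ |m| ≤ l - 1)) (p : ℕ) : a n p l m = fun _ => 0 := by
  ext τ
  exact h.unused n p l m (by omega) τ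

/-- The coefficients are differentiable: they are combinations of values of the (smooth) Taylor
coefficients at finitely many points. -/
lemma HasExpansion.differentiableAt (hρ₀ : 0 < ρ₀) (h : HasExpansion ρ₀ Φ a) (n : Fin 5) (p : ℕ)
    {l : ℤ} (hl : l ≤ p) (m : ℤ) {τ : ℝ} (hτ : τ ∈ Ioo (-1 : ℝ) 1) :
    DifferentiableAt ℝ (a n p l m) τ := by
  by_cases hlm : |2 - (n : ℤ)| ≤ l - 1 ∧ |m| ≤ l - 1
  swap
  · rw [h.eq_zero hlm]; exact differentiableAt_const _
  have hx := mem_labels hl (by have := abs_nonneg (2 - (n : ℤ)); omega) hlm.2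
  obtain ⟨N, w, P, hP, hY⟩ := exists_dual_evaluation (s := 2 - (n : ℤ)) hx hlm.1 hlm.2
  have key : ∀ t ∈ Ioo (-1 : ℝ) 1,
      a n p l m t = ∑ i, w i * (dirRho ρ₀)^[p] (component Φ n) (t, 0, P i) := by
    intro t ht
    simp only [h.dirRho_iterate hρ₀ n p ht (hP _), Finset.mul_sum]
    rw [Finset.sum_comm]
    have : ∀ y ∈ labels p, ∑ i, w i * (a n p (y.1 + 1) y.2 t * Y (2 - (n : ℤ)) y.1 y.2 (P i)) =
        a n p (y.1 + 1) y.2 t * if y = (l - 1, m) then 1 else 0 := by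
      intro y hy
      rw [← hY y hy, Finset.mul_sum]
      exact Finset.sum_congr rfl fun i _ => by ring
    rw [Finset.sum_congr rfl this, Finset.sum_eq_single_of_mem _ hx]
    · simp
    · intro y _ hy; simp [hy]
  have hd : DifferentiableAt ℝ
      (fun t => ∑ i, w i * (dirRho ρ₀)^[p] (component Φ n) (t, 0, P i)) τ := by
    refine DifferentiableAt.fun_sum fun i _ => DifferentiableAt.const_mul ?_ _
    exact (hasDerivAt_tau (contDiffOn_dir_iterate (h.contDiffOn n) _ p) hτ ⟨le_rfl, hρ₀⟩
      (hP i)).differentiableAt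
  exact hd.congr_of_eventuallyEq
    (by filter_upwards [isOpen_Ioo.mem_nhds hτ] with t ht using key t ht)

lemma HasExpansion.dirTau_dirRho_iterate (hρ₀ : 0 < ρ₀) (h : HasExpansion ρ₀ Φ a) (n : Fin 5)
    (p : ℕ) {τ : ℝ} (hτ : τ ∈ Ioo (-1 : ℝ) 1) {o : ℂ × ℂ} (ho : o ≠ 0) :
    dirTau ρ₀ ((dirRho ρ₀)^[p] (component Φ n)) (τ, 0, o) =
      ∑ x ∈ labels p, deriv (a n p (x.1 + 1) x.2) τ * Y (2 - (n : ℤ)) x.1 x.2 o := by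
  have h1 := hasDerivAt_tau (contDiffOn_dir_iterate (h.contDiffOn n) (0, 1, 0) p) hτ
    ⟨le_rfl, hρ₀⟩ ho
  have h2 : HasDerivAt (fun t => ∑ x ∈ labels p, a n p (x.1 + 1) x.2 t * Y (2 - (n : ℤ)) x.1 x.2 o)
      (∑ x ∈ labels p, deriv (a n p (x.1 + 1) x.2) τ * Y (2 - (n : ℤ)) x.1 x.2 o) τ := by
    refine HasDerivAt.fun_sum fun x hx => ?_
    have hx' : x.1 + 1 ≤ p := by
      simp only [labels, Finset.mem_product, Finset.mem_Icc] at hx; omega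
    exact (h.differentiableAt hρ₀ n p hx' x.2 hτ).hasDerivAt.mul_const _
  refine h1.unique (h2.congr_of_eventuallyEq ?_)
  filter_upwards [isOpen_Ioo.mem_nhds hτ] with t ht using h.dirRho_iterate hρ₀ n p ht ho

/-- `ð` (for `ε = 1`) or `ð̄` (for `ε = -1`) at the spinor `o`, with `o` frozen in the directions
of differentiation, as a function on the slab. -/
def ethDir (ρ₀ : ℝ) (ε : ℂ) (o : ℂ × ℂ) (G : ℝ × ℝ × (ℂ × ℂ) → ℂ) : ℝ × ℝ × (ℂ × ℂ) → ℂ :=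
  fun q => -(1 / 2) * (dir ρ₀ (0, 0, iota o) G q +
    ε * Complex.I * dir ρ₀ (0, 0, Complex.I • iota o) G q)

section
variable {G : ℝ × ℝ × (ℂ × ℂ) → ℂ}

lemma contDiffOn_ethDir (hG : ContDiffOn ℝ ∞ G (slab ρ₀)) (ε : ℂ) (o : ℂ × ℂ) :
    ContDiffOn ℝ ∞ (ethDir ρ₀ ε o G) (slab ρ₀) :=
  contDiffOn_const.mul ((contDiffOn_dir hG _).add
    (contDiffOn_const.mul (contDiffOn_dir hG _)))

lemma eth_eq_ethDir (hG : ContDiffOn ℝ ∞ G (slab ρ₀)) {τ r : ℝ} {o : ℂ × ℂ}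
    (hτ : τ ∈ Ioo (-1 : ℝ) 1) (hr : r ∈ Ico 0 ρ₀) (ho : o ≠ 0) :
    eth (fun o => G (τ, r, o)) o = ethDir ρ₀ 1 o G (τ, r, o) := by
  simp only [eth, ethDir, fderiv_sphere hG hτ hr ho]; ring

lemma ethBar_eq_ethDir (hG : ContDiffOn ℝ ∞ G (slab ρ₀)) {τ r : ℝ} {o : ℂ × ℂ}
    (hτ : τ ∈ Ioo (-1 : ℝ) 1) (hr : r ∈ Ico 0 ρ₀) (ho : o ≠ 0) :
    ethBar (fun o => G (τ, r, o)) o = ethDir ρ₀ (-1) o G (τ, r, o) := by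
  simp only [ethBar, ethDir, fderiv_sphere hG hτ hr ho]; ring

lemma dirRho_iterate_ethDir (hρ₀ : 0 < ρ₀) (hG : ContDiffOn ℝ ∞ G (slab ρ₀)) (ε : ℂ) (o : ℂ × ℂ)
    (p : ℕ) : EqOn ((dirRho ρ₀)^[p] (ethDir ρ₀ ε o G)) (ethDir ρ₀ ε o ((dirRho ρ₀)^[p] G))
      (slab ρ₀) := by
  intro q hq
  have h1 := contDiffOn_dir hG (0, 0, iota o)
  have h2 := contDiffOn_dir hG (0, 0, Complex.I • iota o)
  have h3 : ContDiffOn ℝ ∞ (fun q => ε * Complex.I * dir ρ₀ (0, 0, Complex.I • iota o) G q)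
    (slab ρ₀) := contDiffOn_const.mul h2
  unfold ethDir
  rw [dir_iterate_const_mul (h1.add h3) _ _ p hq]
  simp only
  rw [dir_iterate_add h1 h3 _ p hq]
  simp only
  rw [dir_iterate_const_mul h2 _ _ p hq]
  beta_reduce
  rw [← dir_iterate_comm hρ₀ hG _ _ p hq, ← dir_iterate_comm hρ₀ hG _ _ p hq]

end

/-- An equation between the components near the cylinder gives an equation between the Taylor
coefficients on it. -/
lemma HasExpansion.taylor_equation (hρ₀ : 0 < ρ₀) (h : HasExpansion ρ₀ Φ a) (n i j : Fin 5)
    (c k α β d : ℂ) {τ : ℝ} (hτ : τ ∈ Ioo (-1 : ℝ) 1) {o : ℂ × ℂ} (ho : o ≠ 0)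
    (heq : ∀ r ∈ Ioo 0 ρ₀, c * dTau Φ n τ r o + k * rhoDRho Φ n τ r o + α * eth (Φ i τ r) o +
      β * ethBar (Φ j τ r) o + d * Φ n τ r o = 0) (p : ℕ) :
    c * dirTau ρ₀ ((dirRho ρ₀)^[p] (component Φ n)) (τ, 0, o) +
      (k * p + d) * (dirRho ρ₀)^[p] (component Φ n) (τ, 0, o) +
      α * eth (fun o => (dirRho ρ₀)^[p] (component Φ i) (τ, 0, o)) o +
      β * ethBar (fun o => (dirRho ρ₀)^[p] (component Φ j) (τ, 0, o)) o = 0 := by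
  have hn := h.contDiffOn n
  have hi := h.contDiffOn i
  have hj := h.contDiffOn j
  have h0 : (0 : ℝ) ∈ Ico 0 ρ₀ := ⟨le_rfl, hρ₀⟩
  have hq : ((τ, 0, o) : ℝ × ℝ × (ℂ × ℂ)) ∈ slab ρ₀ := ⟨hτ, h0, ho⟩
  have c1 : ContDiffOn ℝ ∞ (fun q => c * dirTau ρ₀ (component Φ n) q) (slab ρ₀) :=
    contDiffOn_const.mul (contDiffOn_dir hn _)
  have c2' : ContDiffOn ℝ ∞ (fun q => (q.2.1 : ℂ) * dirRho ρ₀ (component Φ n) q) (slab ρ₀) :=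
    contDiff_rho.contDiffOn.mul (contDiffOn_dir hn _)
  have c2 : ContDiffOn ℝ ∞ (fun q => k * ((q.2.1 : ℂ) * dirRho ρ₀ (component Φ n) q)) (slab ρ₀) :=
    contDiffOn_const.mul c2'
  have c3 : ContDiffOn ℝ ∞ (fun q => α * ethDir ρ₀ 1 o (component Φ i) q) (slab ρ₀) :=
    contDiffOn_const.mul (contDiffOn_ethDir hi _ _)
  have c4 : ContDiffOn ℝ ∞ (fun q => β * ethDir ρ₀ (-1) o (component Φ j) q) (slab ρ₀) :=
    contDiffOn_const.mul (contDiffOn_ethDir hj _ _)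
  have c5 : ContDiffOn ℝ ∞ (fun q => d * component Φ n q) (slab ρ₀) := contDiffOn_const.mul hn
  have hz := dirRho_iterate_eq_zero hρ₀ ((((c1.add c2).add c3).add c4).add c5) hτ ho (by
    intro r hr
    have hr' := Ioo_subset_Ico_self hr
    have e1 : dTau Φ n τ r o = dirTau ρ₀ (component Φ n) (τ, r, o) :=
      (hasDerivAt_tau hn hτ hr' ho).deriv
    have e2 : rhoDRho Φ n τ r o = (r : ℂ) * dirRho ρ₀ (component Φ n) (τ, r, o) :=
      congrArg _ (hasDerivAt_rho hn hτ hr ho).deriv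
    rw [← heq r hr, e1, e2, ← eth_eq_ethDir hi hτ hr' ho, ← ethBar_eq_ethDir hj hτ hr' ho]
    rfl) p
  rw [dir_iterate_add (((c1.add c2).add c3).add c4) c5 _ p hq] at hz
  simp only at hz
  rw [dir_iterate_add ((c1.add c2).add c3) c4 _ p hq] at hz
  simp only at hz
  rw [dir_iterate_add (c1.add c2) c3 _ p hq] at hz
  simp only at hz
  rw [dir_iterate_add c1 c2 _ p hq] at hz
  simp only at hz
  rw [dir_iterate_const_mul (contDiffOn_dir hn _) _ _ p hq, dir_iterate_const_mul c2' _ _ p hq,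
    dir_iterate_const_mul (contDiffOn_ethDir hi _ _) _ _ p hq,
    dir_iterate_const_mul (contDiffOn_ethDir hj _ _) _ _ p hq,
    dir_iterate_const_mul hn _ _ p hq] at hz
  beta_reduce at hz
  rw [← dir_iterate_comm hρ₀ hn _ _ p hq, dirRho_iterate_rho_mul hn p hq, dirRho_iterate_ethDir hρ₀ hi _ _ p hq,
    dirRho_iterate_ethDir hρ₀ hj _ _ p hq] at hz
  rw [eth_eq_ethDir (contDiffOn_dir_iterate hi _ p) hτ h0 ho,
    ethBar_eq_ethDir (contDiffOn_dir_iterate hj _ p) hτ h0 ho]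
  simp only [Complex.ofReal_zero, zero_mul, zero_add] at hz
  linear_combination hz

lemma eth_sum_Y {ι : Type*} (t : Finset ι) (c : ι → ℂ) (s : ℤ) (x : ι → ℤ × ℤ) {o : ℂ × ℂ}
    (ho : o ≠ 0) {F : ℂ × ℂ → ℂ}
    (hF : ∀ o : ℂ × ℂ, o ≠ 0 → F o = ∑ i ∈ t, c i * Y s (x i).1 (x i).2 o) :
    eth F o = ∑ i ∈ t, c i * ((Real.sqrt ((((x i).1 : ℝ) - s) * (((x i).1 : ℝ) + s + 1)) : ℂ) *
      Y (s + 1) (x i).1 (x i).2 o) := by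
  have h : F =ᶠ[𝓝 o] fun o => ∑ i ∈ t, c i * Y s (x i).1 (x i).2 o := by
    filter_upwards [isOpen_ne_zero.mem_nhds ho] with y hy using hF y hy
  have h2 : eth F o = eth (fun o => ∑ i ∈ t, c i * Y s (x i).1 (x i).2 o) o := by
    simp only [eth, h.fderiv_eq]
  rw [h2]
  exact (HasEth.sum t fun i _ => (hasEth_Y s _ _ ho).const_mul (c i)).eth_eq

lemma ethBar_sum_Y {ι : Type*} (t : Finset ι) (c : ι → ℂ) (s : ℤ) (x : ι → ℤ × ℤ) {o : ℂ × ℂ}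
    (ho : o ≠ 0) {F : ℂ × ℂ → ℂ}
    (hF : ∀ o : ℂ × ℂ, o ≠ 0 → F o = ∑ i ∈ t, c i * Y s (x i).1 (x i).2 o) :
    ethBar F o = ∑ i ∈ t, c i *
      (-(Real.sqrt ((((x i).1 : ℝ) + s) * (((x i).1 : ℝ) - s + 1)) : ℂ) *
        Y (s - 1) (x i).1 (x i).2 o) := by
  have h : F =ᶠ[𝓝 o] fun o => ∑ i ∈ t, c i * Y s (x i).1 (x i).2 o := by
    filter_upwards [isOpen_ne_zero.mem_nhds ho] with y hy using hF y hy
  have h2 : ethBar F o = ethBar (fun o => ∑ i ∈ t, c i * Y s (x i).1 (x i).2 o) o := by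
    simp only [ethBar, h.fderiv_eq]
  rw [h2]
  exact (HasEth.sum t fun i _ => (hasEthBar_Y s _ _ ho).const_mul (c i)).ethBar_eq

/-- An equation between the components near the cylinder gives a transport equation for the
coefficients of each harmonic. -/
lemma HasExpansion.coeff_equation (hρ₀ : 0 < ρ₀) (h : HasExpansion ρ₀ Φ a) (n i j : Fin 5)
    (c k α β d : ℂ) {p : ℕ} {l : ℤ} (hl : l ≤ p) (h3 : 3 ≤ l) (m : ℤ) (A B : ℝ)
    (hi : α = 0 ∨ ((i : ℕ) = n + 1 ∧ A = ((l : ℝ) - 1 - (1 - n)) * ((l : ℝ) - 1 + (2 - n))))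
    (hj : β = 0 ∨ ((j : ℕ) + 1 = n ∧ B = ((l : ℝ) - 1 + (3 - n)) * ((l : ℝ) - 1 - (2 - n))))
    {τ : ℝ} (hτ : τ ∈ Ioo (-1 : ℝ) 1)
    (heq : ∀ r ∈ Ioo 0 ρ₀, ∀ o : ℂ × ℂ, o ≠ 0 → c * dTau Φ n τ r o + k * rhoDRho Φ n τ r o +
      α * eth (Φ i τ r) o + β * ethBar (Φ j τ r) o + d * Φ n τ r o = 0) :
    c * deriv (a n p l m) τ + (k * p + d) * a n p l m τ +
      α * (Real.sqrt A : ℂ) * a i p l m τ - β * (Real.sqrt B : ℂ) * a j p l m τ = 0 := by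
  have hn4 : (n : ℕ) ≤ 4 := by omega
  by_cases hm : |m| ≤ l - 1
  swap
  · have hz : ∀ n : Fin 5, a n p l m = fun _ => 0 := fun n => h.eq_zero (by tauto) p
    simp [hz]
  have hx := mem_labels hl (by omega) hm
  have key : ∀ o : ℂ × ℂ, o ≠ 0 → ∑ x ∈ labels p,
      (c * deriv (a n p (x.1 + 1) x.2) τ + (k * p + d) * a n p (x.1 + 1) x.2 τ +
      α * (Real.sqrt (((x.1 : ℝ) - (1 - n)) * ((x.1 : ℝ) + (2 - n))) : ℂ) *
        a i p (x.1 + 1) x.2 τ -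
      β * (Real.sqrt (((x.1 : ℝ) + (3 - n)) * ((x.1 : ℝ) - (2 - n))) : ℂ) *
        a j p (x.1 + 1) x.2 τ) * Y (2 - (n : ℤ)) x.1 x.2 o = 0 := by
    intro o ho
    have e := h.taylor_equation hρ₀ n i j c k α β d hτ ho (fun r hr => heq r hr o ho) p
    rw [h.dirTau_dirRho_iterate hρ₀ n p hτ ho, h.dirRho_iterate hρ₀ n p hτ ho,
      eth_sum_Y (labels p) (fun x => a i p (x.1 + 1) x.2 τ) _ (fun x => x) ho
        (fun o ho => h.dirRho_iterate hρ₀ i p hτ ho),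
      ethBar_sum_Y (labels p) (fun x => a j p (x.1 + 1) x.2 τ) _ (fun x => x) ho
        (fun o ho => h.dirRho_iterate hρ₀ j p hτ ho)] at e
    simp only [Finset.mul_sum, ← Finset.sum_add_distrib] at e
    rw [← e]
    refine Finset.sum_congr rfl fun x _ => ?_
    have t1 : α * (Real.sqrt (((x.1 : ℝ) - (1 - n)) * ((x.1 : ℝ) + (2 - n))) : ℂ) *
        Y (2 - (n : ℤ)) x.1 x.2 o = α * ((Real.sqrt (((x.1 : ℝ) - ((2 - (i : ℤ) : ℤ) : ℝ)) *
          ((x.1 : ℝ) + ((2 - (i : ℤ) : ℤ) : ℝ) + 1)) : ℂ) *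
            Y (2 - (i : ℤ) + 1) x.1 x.2 o) := by
      rcases hi with hi | ⟨hi, _⟩
      · simp [hi]
      · rw [hi, mul_assoc]
        push_cast
        congr 3
        · ring_nf
        · ring
    have t2 : β * (Real.sqrt (((x.1 : ℝ) + (3 - n)) * ((x.1 : ℝ) - (2 - n))) : ℂ) *
        Y (2 - (n : ℤ)) x.1 x.2 o = β * ((Real.sqrt (((x.1 : ℝ) + ((2 - (j : ℤ) : ℤ) : ℝ)) *
          ((x.1 : ℝ) - ((2 - (j : ℤ) : ℤ) : ℝ) + 1)) : ℂ) *
            Y (2 - (j : ℤ) - 1) x.1 x.2 o) := by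
      rcases hj with hj | ⟨hj, _⟩
      · simp [hj]
      · rw [← hj, mul_assoc]
        push_cast
        congr 3
        · ring_nf
        · ring
    linear_combination a i p (x.1 + 1) x.2 τ * t1 - a j p (x.1 + 1) x.2 τ * t2
  have hs : |2 - (n : ℤ)| ≤ l - 1 := by rw [abs_le]; omega
  have := Y_coeff_eq_zero key hx hs hm
  simp only [sub_add_cancel] at this
  push_cast at this
  have t1 : α * (Real.sqrt A : ℂ) =
      α * (Real.sqrt (((l : ℝ) - 1 - (1 - n)) * ((l : ℝ) - 1 + (2 - n))) : ℂ) := by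
    rcases hi with hi | ⟨_, hi⟩ <;> simp [hi]
  have t2 : β * (Real.sqrt B : ℂ) =
      β * (Real.sqrt (((l : ℝ) - 1 + (3 - n)) * ((l : ℝ) - 1 - (2 - n))) : ℂ) := by
    rcases hj with hj | ⟨_, hj⟩ <;> simp [hj]
  rw [t1, t2]
  exact this

/-! ### The transport equations -/

/-- The transport equations of order `p` for harmonics of degree `L`. -/
def TransportAt (L : ℤ) (p : ℕ) (y : Fin 5 → ℝ → ℂ) : Prop :=
  ∀ τ ∈ Ioo (-1 : ℝ) 1,
    let lam1 : ℂ := (Real.sqrt (((L : ℝ) - 1) * ((L : ℝ) + 2)) : ℂ)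
    let lam0 : ℂ := (Real.sqrt ((L : ℝ) * ((L : ℝ) + 1)) : ℂ)
    let b : Fin 5 → ℂ := fun n => y n τ
    let db : Fin 5 → ℂ := fun n => deriv (y n) τ
    (1 + (τ : ℂ)) * db 0 + lam1 * b 1 - ((p : ℂ) - 2) * b 0 = 0 ∧
    db 1 - 1 / 2 * lam1 * b 0 + 1 / 2 * lam0 * b 2 + b 1 = 0 ∧
    db 2 - 1 / 2 * lam0 * b 1 + 1 / 2 * lam0 * b 3 = 0 ∧
    db 3 - 1 / 2 * lam0 * b 2 + 1 / 2 * lam1 * b 4 - b 3 = 0 ∧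
    (1 - (τ : ℂ)) * db 4 - lam1 * b 3 + ((p : ℂ) - 2) * b 4 = 0 ∧
    (τ : ℂ) * db 1 + 1 / 2 * lam0 * b 2 + 1 / 2 * lam1 * b 0 - (p : ℂ) * b 1 = 0 ∧
    (τ : ℂ) * db 2 + 1 / 2 * lam0 * b 3 + 1 / 2 * lam0 * b 1 - (p : ℂ) * b 2 = 0 ∧
    (τ : ℂ) * db 3 + 1 / 2 * lam1 * b 4 + 1 / 2 * lam0 * b 2 - (p : ℂ) * b 3 = 0

lemma TransportEquations.transportAt (h : TransportEquations a) {p : ℕ} (hp : 3 ≤ p) {m : ℤ}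
    (hm : m ∈ Finset.Icc (-(p : ℤ)) p) : TransportAt p p (fun n => a n p p m) :=
  h p p (Finset.mem_Icc.2 ⟨by exact_mod_cast hp, le_rfl⟩) m hm

/-- The coefficients labelled by `p; p, m` belong to harmonics of degree `p - 1`, so that the field
equations give the transport equations of that degree. -/
lemma FieldEquations.transportAt (hρ₀ : 0 < ρ₀) (h : HasExpansion ρ₀ Φ a)
    (hf : FieldEquations ρ₀ Φ) {p : ℕ} (hp : 3 ≤ p) (m : ℤ) :
    TransportAt ((p : ℤ) - 1) p (fun n => a n p p m) := by
  intro τ hτ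
  have h3 : (3 : ℤ) ≤ p := by exact_mod_cast hp
  have F := fun r hr o ho => hf τ hτ r hr o ho
  have v0 : (((0 : Fin 5) : ℕ) : ℝ) = 0 := by norm_num
  have v1 : (((1 : Fin 5) : ℕ) : ℝ) = 1 := by norm_num
  have v2 : (((2 : Fin 5) : ℕ) : ℝ) = 2 := by norm_num
  have v3 : (((3 : Fin 5) : ℕ) : ℝ) = ((3 : ℕ) : ℝ) := rfl
  have v4 : (((4 : Fin 5) : ℕ) : ℝ) = ((4 : ℕ) : ℝ) := rfl
  push_cast at v3 v4
  set A1 : ℝ := ((((p : ℤ) - 1 : ℤ) : ℝ) - 1) * ((((p : ℤ) - 1 : ℤ) : ℝ) + 2) with hA1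
  set A0 : ℝ := (((p : ℤ) - 1 : ℤ) : ℝ) * ((((p : ℤ) - 1 : ℤ) : ℝ) + 1) with hA0
  push_cast at hA1 hA0
  have E0 := h.coeff_equation hρ₀ 0 1 0 (1 + τ) (-1) 1 0 2 le_rfl h3 m A1 0
    (Or.inr ⟨rfl, by rw [hA1, v0]; push_cast; ring⟩)
    (Or.inl rfl) hτ
    (fun r hr o ho => by linear_combination (F r hr o ho).1)
  have E1 := h.coeff_equation hρ₀ 1 2 0 1 0 (1 / 2) (1 / 2) 1 le_rfl h3 m A0 A1
    (Or.inr ⟨rfl, by rw [hA0, v1]; push_cast; ring⟩)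
    (Or.inr ⟨rfl, by rw [hA1, v1]; push_cast; ring⟩) hτ
    (fun r hr o ho => by linear_combination (F r hr o ho).2.1)
  have E2 := h.coeff_equation hρ₀ 2 3 1 1 0 (1 / 2) (1 / 2) 0 le_rfl h3 m A0 A0
    (Or.inr ⟨rfl, by rw [hA0, v2]; push_cast; ring⟩)
    (Or.inr ⟨rfl, by rw [hA0, v2]; push_cast; ring⟩) hτ
    (fun r hr o ho => by linear_combination (F r hr o ho).2.2.1)
  have E3 := h.coeff_equation hρ₀ 3 4 2 1 0 (1 / 2) (1 / 2) (-1) le_rfl h3 m A1 A0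
    (Or.inr ⟨rfl, by rw [hA1, v3]; push_cast; ring⟩)
    (Or.inr ⟨rfl, by rw [hA0, v3]; push_cast; ring⟩) hτ
    (fun r hr o ho => by linear_combination (F r hr o ho).2.2.2.1)
  have E4 := h.coeff_equation hρ₀ 4 0 3 (1 - τ) 1 0 1 (-2) le_rfl h3 m 0 A1
    (Or.inl rfl)
    (Or.inr ⟨rfl, by rw [hA1, v4]; push_cast; ring⟩) hτ
    (fun r hr o ho => by linear_combination (F r hr o ho).2.2.2.2.1)
  have E5 := h.coeff_equation hρ₀ 1 2 0 τ (-1) (1 / 2) (-1 / 2) 0 le_rfl h3 m A0 A1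
    (Or.inr ⟨rfl, by rw [hA0, v1]; push_cast; ring⟩)
    (Or.inr ⟨rfl, by rw [hA1, v1]; push_cast; ring⟩) hτ
    (fun r hr o ho => by linear_combination (F r hr o ho).2.2.2.2.2.1)
  have E6 := h.coeff_equation hρ₀ 2 3 1 τ (-1) (1 / 2) (-1 / 2) 0 le_rfl h3 m A0 A0
    (Or.inr ⟨rfl, by rw [hA0, v2]; push_cast; ring⟩)
    (Or.inr ⟨rfl, by rw [hA0, v2]; push_cast; ring⟩) hτ
    (fun r hr o ho => by linear_combination (F r hr o ho).2.2.2.2.2.2.1)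
  have E7 := h.coeff_equation hρ₀ 3 4 2 τ (-1) (1 / 2) (-1 / 2) 0 le_rfl h3 m A1 A0
    (Or.inr ⟨rfl, by rw [hA1, v3]; push_cast; ring⟩)
    (Or.inr ⟨rfl, by rw [hA0, v3]; push_cast; ring⟩) hτ
    (fun r hr o ho => by linear_combination (F r hr o ho).2.2.2.2.2.2.2)
  refine ⟨?_, ?_, ?_, ?_, ?_, ?_, ?_, ?_⟩
  · linear_combination E0
  · linear_combination E1
  · linear_combination E2
  · linear_combination E3
  · linear_combination E4
  · linear_combination E5
  · linear_combination E6
  · linear_combination E7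

end

section

variable {ρ₀ : ℝ} {Φ : Fin 5 → ℝ → ℝ → ℂ × ℂ → ℂ} {a : Fin 5 → ℕ → ℤ → ℤ → ℝ → ℂ}

/-! ### Top coefficients of time-symmetric solutions -/

lemma sqrt_lam1_sq {L : ℤ} (hL : 2 ≤ L) :
    (Real.sqrt (((L : ℝ) - 1) * ((L : ℝ) + 2)) : ℂ) ^ 2 = ((L : ℂ) - 1) * ((L : ℂ) + 2) := by
  have h : (2 : ℝ) ≤ L := by exact_mod_cast hL
  rw [← Complex.ofReal_pow, Real.sq_sqrt (by nlinarith)]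
  push_cast; ring

lemma sqrt_lam0_sq {L : ℤ} (hL : 2 ≤ L) :
    (Real.sqrt ((L : ℝ) * ((L : ℝ) + 1)) : ℂ) ^ 2 = (L : ℂ) * ((L : ℂ) + 1) := by
  have h : (2 : ℝ) ≤ L := by exact_mod_cast hL
  rw [← Complex.ofReal_pow, Real.sq_sqrt (by nlinarith)]
  push_cast; ring

/-- The constraints at `τ = 0`, for data with `y 0 + y 4 = 0` there. -/
lemma TransportAt.constraints {L : ℤ} {p : ℕ} {y : Fin 5 → ℝ → ℂ} (h : TransportAt L p y)
    (hL : 2 ≤ L) (hLp : L ≤ p) (h0 : y 0 0 + y 4 0 = 0) :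
    (Real.sqrt (((L : ℝ) - 1) * ((L : ℝ) + 2)) : ℂ) * y 0 0 = 2 * p * y 1 0 ∧
      (Real.sqrt (((L : ℝ) - 1) * ((L : ℝ) + 2)) : ℂ) * y 4 0 = 2 * p * y 3 0 := by
  obtain ⟨-, -, -, -, -, e5, e6, e7⟩ := h 0 (by norm_num)
  simp only [Complex.ofReal_zero, zero_mul, zero_add] at e5 e6 e7
  have hs := sqrt_lam0_sq hL
  set lam1 : ℂ := (Real.sqrt (((L : ℝ) - 1) * ((L : ℝ) + 2)) : ℂ)
  set lam0 : ℂ := (Real.sqrt ((L : ℝ) * ((L : ℝ) + 1)) : ℂ)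
  have hne : (L : ℂ) * (L + 1) - 2 * p ^ 2 ≠ 0 := by
    have : L * (L + 1) - 2 * (p : ℤ) ^ 2 ≠ 0 := by nlinarith
    exact_mod_cast this
  -- eliminating `y 1` and `y 3` leaves `(L (L + 1) - 2 p ^ 2) y 2 = 0`
  have h2 : y 2 0 = 0 := by
    refine (mul_eq_zero.1 (?_ : ((L : ℂ) * (L + 1) - 2 * p ^ 2) * y 2 0 = 0)).resolve_left hne
    linear_combination lam0 * (e5 + e7) + 2 * p * e6 - y 2 0 * hs - 1 / 2 * lam0 * lam1 * h0
  rw [h2] at e5 e7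
  exact ⟨by linear_combination 2 * e5, by linear_combination 2 * e7⟩

lemma IsJacobi0.hasDerivAt_zero {p : ℕ} (hp : 2 ≤ p) {C : ℂ} {f : ℝ → ℂ} (h : IsJacobi0 p C 0 f) :
    HasDerivAt f (-4 * f 0) 0 := by
  have h1 : HasDerivAt (fun τ : ℝ => ((1 - τ) / 2) ^ (p + 2) * ((1 + τ) / 2) ^ (p - 2))
      (-4 * (((1 - 0) / 2) ^ (p + 2) * ((1 + 0) / 2) ^ (p - 2))) 0 := by
    have u : HasDerivAt (fun τ : ℝ => (1 - τ) / 2) (-1 / 2) 0 :=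
      ((hasDerivAt_id 0).const_sub 1).div_const 2
    have v : HasDerivAt (fun τ : ℝ => (1 + τ) / 2) (1 / 2) 0 :=
      ((hasDerivAt_id 0).const_add 1).div_const 2
    refine ((u.pow (p + 2)).mul (v.pow (p - 2))).congr_deriv ?_
    obtain ⟨k, rfl⟩ := Nat.exists_eq_add_of_le hp
    rw [Nat.add_sub_cancel_left]
    rcases k with _ | k
    · norm_num
    · simp only [Nat.add_sub_cancel, Pi.pow_apply]
      rw [show 2 + (k + 1) + 2 - 1 = k + 4 by omega]
      push_cast
      ring
  have h2 := (h1.ofReal_comp.mul_const C)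
  have h3 : HasDerivAt f (((-4 * (((1 - 0) / 2) ^ (p + 2) * ((1 + 0) / 2) ^ (p - 2)) : ℝ) : ℂ) * C)
      0 := by
    refine h2.congr_of_eventuallyEq ?_
    filter_upwards [isOpen_Ioo.mem_nhds (show (0 : ℝ) ∈ Ioo (-1 : ℝ) 1 by norm_num)] with τ hτ
    rw [h τ hτ, zero_mul, add_zero]
  convert h3 using 1
  rw [h 0 (by norm_num)]
  push_cast
  ring

/-- Regular time-symmetric data vanish: regularity forces `lam1 * y 1 = (p + 2) * y 0` at `τ = 0`,
the constraints force `lam1 * y 0 = 2 * p * y 1`, and `lam1 ^ 2 < 2 * p * (p + 2)`. -/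
lemma TransportAt.eq_zero_of_isJacobi0 {L : ℤ} {p : ℕ} {y : Fin 5 → ℝ → ℂ}
    (h : TransportAt L p y) (hL : 2 ≤ L) (hLp : L ≤ p) (h0 : y 0 0 = -y 4 0) {C : ℂ}
    (hC : IsJacobi0 p C 0 (y 0)) : y 0 0 = 0 := by
  have hc := (h.constraints hL hLp (by rw [h0]; ring)).1
  obtain ⟨e0, -⟩ := h 0 (by norm_num)
  have hp : 2 ≤ p := by omega
  simp only [(hC.hasDerivAt_zero hp).deriv, Complex.ofReal_zero, add_zero, one_mul] at e0
  have hs := sqrt_lam1_sq hL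
  set lam1 : ℂ := (Real.sqrt (((L : ℝ) - 1) * ((L : ℝ) + 2)) : ℂ)
  have hne : ((L : ℂ) - 1) * (L + 2) - 2 * p * (p + 2) ≠ 0 := by
    have : (L - 1) * (L + 2) - 2 * (p : ℤ) * (p + 2) ≠ 0 := by nlinarith
    exact_mod_cast this
  refine (mul_eq_zero.1 (?_ : (((L : ℂ) - 1) * (L + 2) - 2 * p * (p + 2)) * y 0 0 = 0)).resolve_left
    hne
  linear_combination -y 0 0 * hs + lam1 * hc + 2 * p * e0

/-- Uniqueness for the linear system satisfied by `y 0, y 1` and, after `τ ↦ -τ`, by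
`y 4, y 3`. -/
lemma linear_system_eq_zero {f g : ℝ → ℂ} {c d lam : ℂ}
    (hf : ∀ t ∈ Ioo (-1 : ℝ) 1, HasDerivAt f ((c * f t - lam * g t) / (1 + t)) t)
    (hg : ∀ t ∈ Ioo (-1 : ℝ) 1, HasDerivAt g ((lam * f t - d * g t) / (1 - t)) t)
    (hf0 : f 0 = 0) (hg0 : g 0 = 0) {τ : ℝ} (hτ : τ ∈ Ioo (-1 : ℝ) 1) : f τ = 0 := by
  -- the coefficients are bounded on a smaller interval
  obtain ⟨r, hr1, hr2⟩ := exists_between (abs_lt.2 hτ)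
  have hr0 : 0 < r := (abs_nonneg τ).trans_lt hr1
  have h1r : 0 < 1 - r := by linarith
  let v : ℝ → ℂ × ℂ → ℂ × ℂ := fun t x =>
    ((c * x.1 - lam * x.2) / (1 + t), (lam * x.1 - d * x.2) / (1 - t))
  have hK : 0 ≤ (‖c‖ + ‖lam‖ + ‖d‖) / (1 - r) := by positivity
  have hv : ∀ t ∈ Ioo (-r) r,
      LipschitzOnWith ⟨(‖c‖ + ‖lam‖ + ‖d‖) / (1 - r), hK⟩ (v t) univ := by
    intro t ht
    refine LipschitzOnWith.of_dist_le_mul fun x _ y _ => ?_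
    have b1 : ‖x.1 - y.1‖ ≤ ‖x - y‖ := norm_fst_le (x - y)
    have b2 : ‖x.2 - y.2‖ ≤ ‖x - y‖ := norm_snd_le (x - y)
    have key : ∀ (A B : ℂ) (w : ℝ), ‖A‖ + ‖B‖ ≤ ‖c‖ + ‖lam‖ + ‖d‖ → 1 - r ≤ w →
        ‖(A * x.1 - B * x.2) / (w : ℂ) - (A * y.1 - B * y.2) / (w : ℂ)‖ ≤
          (‖c‖ + ‖lam‖ + ‖d‖) / (1 - r) * ‖x - y‖ := by
      intro A B w hAB hw
      have hw0 : 0 < w := h1r.trans_le hw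
      rw [← sub_div, norm_div, Complex.norm_real, Real.norm_of_nonneg hw0.le, div_mul_eq_mul_div]
      have hn : ‖A * x.1 - B * x.2 - (A * y.1 - B * y.2)‖ ≤
          (‖c‖ + ‖lam‖ + ‖d‖) * ‖x - y‖ := by
        calc _ = ‖A * (x.1 - y.1) - B * (x.2 - y.2)‖ := by ring_nf
          _ ≤ ‖A‖ * ‖x.1 - y.1‖ + ‖B‖ * ‖x.2 - y.2‖ := by
            rw [← norm_mul, ← norm_mul]; exact norm_sub_le _ _
          _ ≤ ‖A‖ * ‖x - y‖ + ‖B‖ * ‖x - y‖ := by gcongr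
          _ = (‖A‖ + ‖B‖) * ‖x - y‖ := by ring
          _ ≤ _ := by gcongr
      gcongr
    have k1 := key c lam (1 + t) (by linarith [norm_nonneg d]) (by linarith [ht.1])
    have k2 := key lam d (1 - t) (by linarith [norm_nonneg c]) (by linarith [ht.2])
    push_cast at k1 k2
    rw [dist_eq_norm, dist_eq_norm, Prod.norm_def]
    exact max_le k1 k2
  have hsub : ∀ t ∈ Ioo (-r) r, t ∈ Ioo (-1 : ℝ) 1 := fun t ht =>
    ⟨by linarith [ht.1], by linarith [ht.2]⟩
  have := ODE_solution_unique_of_mem_Ioo (f := fun t => (f t, g t)) (g := fun _ => (0, 0))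
    (t₀ := 0) hv ⟨by linarith, hr0⟩
    (fun t ht => ⟨(hf t (hsub t ht)).prodMk (hg t (hsub t ht)), mem_univ _⟩)
    (fun t _ => ⟨(hasDerivAt_const t _).congr_deriv (by simp [v]; rfl), mem_univ _⟩)
    (by simp [hf0, hg0]) (abs_lt.1 hr1)
  exact (Prod.ext_iff.1 this).1

lemma one_add_ne_zero_of_mem {t : ℝ} (ht : t ∈ Ioo (-1 : ℝ) 1) : (1 : ℂ) + t ≠ 0 := by
  have : 1 + t ≠ 0 := by linarith [ht.1]
  exact_mod_cast this

lemma one_sub_ne_zero_of_mem {t : ℝ} (ht : t ∈ Ioo (-1 : ℝ) 1) : (1 : ℂ) - t ≠ 0 := by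
  have : 1 - t ≠ 0 := by linarith [ht.2]
  exact_mod_cast this

/-- Solutions whose extreme components vanish at `τ = 0` have vanishing extreme components. -/
lemma TransportAt.eq_zero {L : ℤ} {p : ℕ} {y : Fin 5 → ℝ → ℂ} (h : TransportAt L p y)
    (hd : ∀ n, ∀ τ ∈ Ioo (-1 : ℝ) 1, DifferentiableAt ℝ (y n) τ)
    (hL : 2 ≤ L) (hLp : L ≤ p) (h0 : y 0 0 = 0) (h4 : y 4 0 = 0) {τ : ℝ}
    (hτ : τ ∈ Ioo (-1 : ℝ) 1) : y 0 τ = 0 ∧ y 4 τ = 0 := by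
  obtain ⟨c1, c3⟩ := h.constraints hL hLp (by rw [h0, h4, add_zero])
  have hp : (2 : ℂ) * p ≠ 0 := by
    have : (2 * p : ℕ) ≠ 0 := by omega
    exact_mod_cast this
  have h1 : y 1 0 = 0 := by
    rw [h0, mul_zero] at c1
    exact (mul_eq_zero.1 c1.symm).resolve_left hp
  have h3 : y 3 0 = 0 := by
    rw [h4, mul_zero] at c3
    exact (mul_eq_zero.1 c3.symm).resolve_left hp
  constructor
  · refine linear_system_eq_zero (g := y 1) (c := (p : ℂ) - 2) (d := (p : ℂ) + 1)
      (lam := (Real.sqrt (((L : ℝ) - 1) * ((L : ℝ) + 2)) : ℂ)) (fun t ht => ?_) (fun t ht => ?_)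
      h0 h1 hτ
    · obtain ⟨e0, -⟩ := h t ht
      refine (hd 0 t ht).hasDerivAt.congr_deriv ?_
      rw [eq_div_iff (one_add_ne_zero_of_mem ht)]
      linear_combination e0
    · obtain ⟨-, e1, -, -, -, e5, -⟩ := h t ht
      refine (hd 1 t ht).hasDerivAt.congr_deriv ?_
      rw [eq_div_iff (one_sub_ne_zero_of_mem ht)]
      linear_combination e1 - e5
  · have hneg : ∀ t ∈ Ioo (-1 : ℝ) 1, -t ∈ Ioo (-1 : ℝ) 1 := fun t ht =>
      ⟨by linarith [ht.2], by linarith [ht.1]⟩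
    have hder : ∀ n, ∀ t ∈ Ioo (-1 : ℝ) 1,
        HasDerivAt (fun t => y n (-t)) (-deriv (y n) (-t)) t := fun n t ht =>
      ((hd n _ (hneg t ht)).hasDerivAt.scomp t (hasDerivAt_neg t)).congr_deriv (by simp)
    have := linear_system_eq_zero (f := fun t => y 4 (-t)) (g := fun t => y 3 (-t))
      (c := (p : ℂ) - 2) (d := (p : ℂ) + 1)
      (lam := (Real.sqrt (((L : ℝ) - 1) * ((L : ℝ) + 2)) : ℂ)) (fun t ht => ?_) (fun t ht => ?_)
      (by simpa using h4) (by simpa using h3) (hneg τ hτ)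
    · simpa using this
    · obtain ⟨-, -, -, -, e4, -⟩ := h (-t) (hneg t ht)
      push_cast at e4
      refine (hder 4 t ht).congr_deriv ?_
      rw [eq_div_iff (one_add_ne_zero_of_mem ht)]
      linear_combination -e4
    · obtain ⟨-, -, -, e3, -, -, -, e7⟩ := h (-t) (hneg t ht)
      push_cast at e7
      refine (hder 3 t ht).congr_deriv ?_
      rw [eq_div_iff (one_sub_ne_zero_of_mem ht)]
      linear_combination -e3 - e7

/-- Either form of the dynamics gives, for the coefficients labelled by `p; p, m`, transport
equations of some degree `L` with `2 ≤ L ≤ p`. -/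
lemma exists_transportAt (hρ₀ : 0 < ρ₀) (h : HasExpansion ρ₀ Φ a)
    (hf : FieldEquations ρ₀ Φ ∨ TransportEquations a) {p : ℕ} (hp : 3 ≤ p) {m : ℤ}
    (hm : m ∈ Finset.Icc (-(p : ℤ)) p) :
    ∃ L : ℤ, 2 ≤ L ∧ L ≤ p ∧ TransportAt L p (fun n => a n p p m) := by
  rcases hf with hf | hf
  · exact ⟨p - 1, by omega, by omega, hf.transportAt hρ₀ h hp m⟩
  · exact ⟨p, by omega, le_rfl, hf.transportAt hp hm⟩

/-- Regular time-symmetric data have vanishing `a_{0,p;p,m}` and `a_{4,p;p,m}` at `τ = 0`. -/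
lemma Regular.topDataVanish (hρ₀ : 0 < ρ₀) (h : HasExpansion ρ₀ Φ a)
    (hf : FieldEquations ρ₀ Φ ∨ TransportEquations a) (hsym : TimeSymmetric a) (hr : Regular a) :
    TopDataVanish a := by
  intro p hp m hm
  obtain ⟨L, hL, hLp, ht⟩ := exists_transportAt hρ₀ h hf hp hm
  obtain ⟨C, Cs, D, Ds, hC, -, rfl, -⟩ := hr p hp m hm
  have h0 := ht.eq_zero_of_isJacobi0 hL hLp (hsym p hp m hm) hC
  have hs := hsym p hp m hm
  refine ⟨h0, ?_⟩
  rw [h0] at hs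
  simpa using hs.symm

/-- If the top coefficients `a_{0,p;p,m}` and `a_{4,p;p,m}` vanish at `τ = 0`, they vanish
identically. -/
lemma TopDataVanish.eq_zero (hρ₀ : 0 < ρ₀) (h : HasExpansion ρ₀ Φ a)
    (hf : FieldEquations ρ₀ Φ ∨ TransportEquations a) (hv : TopDataVanish a) {p : ℕ} (hp : 3 ≤ p)
    {m : ℤ} (hm : m ∈ Finset.Icc (-(p : ℤ)) p) {τ : ℝ} (hτ : τ ∈ Ioo (-1 : ℝ) 1) :
    a 0 p p m τ = 0 ∧ a 4 p p m τ = 0 := by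
  obtain ⟨L, hL, hLp, ht⟩ := exists_transportAt hρ₀ h hf hp hm
  obtain ⟨v0, v4⟩ := hv p hp m hm
  exact ht.eq_zero (fun n τ hτ => h.differentiableAt hρ₀ n p le_rfl m hτ) hL hLp v0 v4 hτ

end

section

/-! ### The iterated derivatives in the Newman-Penrose constants -/

variable {ρ₀ : ℝ} {Φ : Fin 5 → ℝ → ℝ → ℂ × ℂ → ℂ} {a : Fin 5 → ℕ → ℤ → ℤ → ℝ → ℂ}
variable {G : ℝ × ℝ × (ℂ × ℂ) → ℂ} {ε : ℝ}

/-- Both `npDerivPlus` (for `ε = 1`) and `npDerivMinus` (for `ε = -1`). -/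
def npDeriv (ε : ℝ) (f : ℝ → ℝ → ℂ) : ℝ → ℝ → ℂ := fun τ ρ =>
  ((Real.sqrt 2 / 2 / (ρ * (1 - ε * τ) ^ 2) : ℝ) : ℂ) *
    (ε * (1 - ε * (τ : ℂ)) * deriv (fun t => f t ρ) τ + (ρ : ℂ) * deriv (fun r => f τ r) ρ)

lemma npDerivPlus_eq : npDerivPlus = npDeriv 1 := by
  ext f τ ρ; simp [npDerivPlus, npDeriv]

lemma npDerivMinus_eq : npDerivMinus = npDeriv (-1) := by
  ext f τ ρ; simp [npDerivMinus, npDeriv]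

/-- The numerators of the iterated derivatives: the `k`-th derivative of
`G / (ρ² (1 - ε τ)⁴)` is, up to a constant, `npNum ε k G` over `ρ ^ (k + 2) (1 - ε τ) ^ (2 k + 4)`,
see `npDeriv_iterate`. -/
def npNum (ρ₀ ε : ℝ) (G : ℝ × ℝ × (ℂ × ℂ) → ℂ) : ℕ → ℝ × ℝ × (ℂ × ℂ) → ℂ
  | 0 => G
  | k + 1 => fun q => (ε * (1 - ε * (q.1 : ℂ))) * dirTau ρ₀ (npNum ρ₀ ε G k) q +
      ((q.2.1 : ℂ) * dirRho ρ₀ (npNum ρ₀ ε G k) q + ((k : ℂ) + 2) * npNum ρ₀ ε G k q)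

lemma contDiff_tau_factor (ε : ℝ) : ContDiff ℝ ∞
    fun q : ℝ × ℝ × (ℂ × ℂ) => (ε : ℂ) * (1 - ε * (q.1 : ℂ)) :=
  contDiff_const.mul (contDiff_const.sub (contDiff_const.mul (contDiff_ofReal_comp (by fun_prop))))

lemma contDiffOn_npNum (hG : ContDiffOn ℝ ∞ G (slab ρ₀)) (ε : ℝ) (k : ℕ) :
    ContDiffOn ℝ ∞ (npNum ρ₀ ε G k) (slab ρ₀) := by
  induction k with
  | zero => exact hG
  | succ k ih =>
    exact ((contDiff_tau_factor ε).contDiffOn.mul (contDiffOn_dir ih _)).add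
      ((contDiff_rho.contDiffOn.mul (contDiffOn_dir ih _)).add (contDiffOn_const.mul ih))

lemma hasDerivAt_inv_pow {u : ℝ → ℂ} {u' : ℂ} {x : ℝ} (hu : HasDerivAt u u' x)
    (h0 : u x ≠ 0) (N : ℕ) :
    HasDerivAt (fun x => (u x ^ N)⁻¹) (-(N * u') * (u x ^ (N + 1))⁻¹) x := by
  refine ((hu.pow N).inv (pow_ne_zero N h0)).congr_deriv ?_
  rcases N with _ | N
  · simp
  · simp only [Nat.add_sub_cancel, Pi.pow_apply]
    field_simp
    ring

lemma one_sub_mul_ne_zero (hε : ε = 1 ∨ ε = -1) {τ : ℝ} (hτ : τ ∈ Ioo (-1 : ℝ) 1) :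
    (1 : ℂ) - ε * τ ≠ 0 := by
  rcases hε with rfl | rfl
  · simpa using one_sub_ne_zero_of_mem hτ
  · simpa using one_add_ne_zero_of_mem hτ

lemma npDeriv_iterate (hε : ε = 1 ∨ ε = -1) (hG : ContDiffOn ℝ ∞ G (slab ρ₀)) {o : ℂ × ℂ}
    (ho : o ≠ 0) (k : ℕ) {τ ρ : ℝ} (hτ : τ ∈ Ioo (-1 : ℝ) 1) (hρ : ρ ∈ Ioo 0 ρ₀) :
    (npDeriv ε)^[k] (fun t r => G (t, r, o) / ((r : ℂ) ^ 2 * (1 - ε * (t : ℂ)) ^ 4)) τ ρ =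
      ((Real.sqrt 2 / 2 : ℝ) : ℂ) ^ k * npNum ρ₀ ε G k (τ, ρ, o) * ((ρ : ℂ) ^ (k + 2))⁻¹ *
        ((1 - ε * (τ : ℂ)) ^ (2 * k + 4))⁻¹ := by
  have hε2 : (ε : ℂ) ^ 2 = 1 := by rcases hε with rfl | rfl <;> simp
  induction k generalizing τ ρ with
  | zero =>
    simp only [Function.iterate_zero, id, npNum, pow_zero, one_mul, mul_zero, zero_add,
      div_eq_mul_inv, mul_inv]
    ring
  | succ k ih =>
    have hB := contDiffOn_npNum hG ε k
    have hw := one_sub_mul_ne_zero hε hτ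
    have hr : (ρ : ℂ) ≠ 0 := by exact_mod_cast hρ.1.ne'
    rw [Function.iterate_succ_apply', npDeriv]
    set F := (npDeriv ε)^[k] (fun t r => G (t, r, o) / ((r : ℂ) ^ 2 * (1 - ε * (t : ℂ)) ^ 4))
    have d1 : deriv (fun t => F t ρ) τ = ((Real.sqrt 2 / 2 : ℝ) : ℂ) ^ k * ((ρ : ℂ) ^ (k + 2))⁻¹ *
        (dirTau ρ₀ (npNum ρ₀ ε G k) (τ, ρ, o) * ((1 - ε * (τ : ℂ)) ^ (2 * k + 4))⁻¹ +
          npNum ρ₀ ε G k (τ, ρ, o) * (-((2 * k + 4 : ℕ) * -(ε : ℂ)) *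
            ((1 - ε * (τ : ℂ)) ^ (2 * k + 4 + 1))⁻¹)) := by
      have hu : HasDerivAt (fun t : ℝ => 1 - (ε : ℂ) * (t : ℂ)) (-(ε : ℂ)) τ := by
        simpa using ((hasDerivAt_id τ).ofReal_comp.const_mul (ε : ℂ)).const_sub 1
      have h1 := ((hasDerivAt_tau hB hτ (Ioo_subset_Ico_self hρ) ho).mul
        (hasDerivAt_inv_pow hu hw (2 * k + 4))).const_mul
          (((Real.sqrt 2 / 2 : ℝ) : ℂ) ^ k * ((ρ : ℂ) ^ (k + 2))⁻¹)
      refine (h1.congr_of_eventuallyEq ?_).deriv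
      filter_upwards [isOpen_Ioo.mem_nhds hτ] with t ht
      rw [ih ht hρ, Pi.mul_apply]; ring
    have d2 : deriv (fun r => F τ r) ρ = ((Real.sqrt 2 / 2 : ℝ) : ℂ) ^ k *
        ((1 - ε * (τ : ℂ)) ^ (2 * k + 4))⁻¹ *
        (dirRho ρ₀ (npNum ρ₀ ε G k) (τ, ρ, o) * ((ρ : ℂ) ^ (k + 2))⁻¹ +
          npNum ρ₀ ε G k (τ, ρ, o) * (-((k + 2 : ℕ) * (1 : ℂ)) * ((ρ : ℂ) ^ (k + 2 + 1))⁻¹)) := by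
      have hu : HasDerivAt (fun r : ℝ => (r : ℂ)) 1 ρ := by
        simpa using (hasDerivAt_id ρ).ofReal_comp
      have h1 := ((hasDerivAt_rho hB hτ hρ ho).mul
        (hasDerivAt_inv_pow hu hr (k + 2))).const_mul
          (((Real.sqrt 2 / 2 : ℝ) : ℂ) ^ k * ((1 - ε * (τ : ℂ)) ^ (2 * k + 4))⁻¹)
      refine (h1.congr_of_eventuallyEq ?_).deriv
      filter_upwards [isOpen_Ioo.mem_nhds hρ] with r hr'
      rw [ih hτ hr', Pi.mul_apply]; ring
    rw [d1, d2, npNum]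
    have e : ((Real.sqrt 2 / 2 / (ρ * (1 - ε * τ) ^ 2) : ℝ) : ℂ) =
        ((Real.sqrt 2 / 2 : ℝ) : ℂ) * ((ρ : ℂ) * (1 - ε * (τ : ℂ)) ^ 2)⁻¹ := by
      push_cast; rw [div_eq_mul_inv]
    rw [e]
    beta_reduce
    generalize ((Real.sqrt 2 / 2 : ℝ) : ℂ) = c
    generalize dirTau ρ₀ (npNum ρ₀ ε G k) (τ, ρ, o) = x
    generalize dirRho ρ₀ (npNum ρ₀ ε G k) (τ, ρ, o) = y
    generalize npNum ρ₀ ε G k (τ, ρ, o) = z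
    generalize (1 : ℂ) - ε * (τ : ℂ) = w at *
    generalize (ρ : ℂ) = r at *
    generalize (ε : ℂ) = η at *
    push_cast
    simp only [pow_mul, pow_succ, pow_zero, one_mul]
    field_simp
    linear_combination c * c ^ k * (2 * (k : ℂ) + 4) * z * hε2

/-! ### Taylor coefficients of the numerators -/

lemma dirRho_tau_factor_mul {H : ℝ × ℝ × (ℂ × ℂ) → ℂ} (hH : ContDiffOn ℝ ∞ H (slab ρ₀)) (ε : ℝ) :
    EqOn (dirRho ρ₀ (fun q => (ε * (1 - ε * (q.1 : ℂ))) * H q))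
      (fun q => (ε * (1 - ε * (q.1 : ℂ))) * dirRho ρ₀ H q) (slab ρ₀) := by
  intro q hq
  have hd : dirRho ρ₀ (fun q => (ε : ℂ) * (1 - ε * (q.1 : ℂ))) q = 0 := by
    let A : ℝ × ℝ × (ℂ × ℂ) →L[ℝ] ℂ :=
      Complex.ofRealCLM.comp (ContinuousLinearMap.fst ℝ ℝ (ℝ × (ℂ × ℂ)))
    have h1 : HasFDerivWithinAt (fun q : ℝ × ℝ × (ℂ × ℂ) => (ε : ℂ) * (1 - ε * (q.1 : ℂ)))
        ((ε : ℂ) • (-((ε : ℂ) • A))) (slab ρ₀) q :=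
      ((A.hasFDerivWithinAt.const_mul (ε : ℂ)).const_sub 1).const_mul (ε : ℂ)
    rw [dirRho, dir, h1.fderivWithin (uniqueDiffOn_slab ρ₀ q hq)]
    simp [A]
  have := dir_mul (contDiff_tau_factor ε).contDiffOn hH (0, 1, 0) hq
  rw [dirRho] at hd ⊢
  rw [this]
  beta_reduce
  rw [hd]
  simp

lemma dirRho_iterate_tau_factor_mul {H : ℝ × ℝ × (ℂ × ℂ) → ℂ}
    (hH : ContDiffOn ℝ ∞ H (slab ρ₀)) (ε : ℝ) (p : ℕ) :
    EqOn ((dirRho ρ₀)^[p] (fun q => (ε * (1 - ε * (q.1 : ℂ))) * H q))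
      (fun q => (ε * (1 - ε * (q.1 : ℂ))) * (dirRho ρ₀)^[p] H q) (slab ρ₀) := by
  induction p generalizing H with
  | zero => exact fun q _ => rfl
  | succ p ih =>
    simp only [Function.iterate_succ_apply]
    exact (dir_iterate_congr (dirRho_tau_factor_mul hH ε) _ p).trans (ih (contDiffOn_dir hH _))

lemma dirRho_iterate_npNum_succ (hρ₀ : 0 < ρ₀) (hG : ContDiffOn ℝ ∞ G (slab ρ₀)) (ε : ℝ)
    (k p : ℕ) {τ : ℝ} (hτ : τ ∈ Ioo (-1 : ℝ) 1) {o : ℂ × ℂ} (ho : o ≠ 0) :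
    (dirRho ρ₀)^[p] (npNum ρ₀ ε G (k + 1)) (τ, 0, o) =
      (ε * (1 - ε * (τ : ℂ))) * dirTau ρ₀ ((dirRho ρ₀)^[p] (npNum ρ₀ ε G k)) (τ, 0, o) +
        ((p : ℂ) + (k + 2)) * (dirRho ρ₀)^[p] (npNum ρ₀ ε G k) (τ, 0, o) := by
  have hq : ((τ, 0, o) : ℝ × ℝ × (ℂ × ℂ)) ∈ slab ρ₀ := ⟨hτ, ⟨le_rfl, hρ₀⟩, ho⟩
  have hB := contDiffOn_npNum hG ε k
  have hT := contDiffOn_dir hB (1, 0, 0)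
  have hR := contDiff_rho.contDiffOn.mul (contDiffOn_dir hB (0, 1, 0))
  have hC : ContDiffOn ℝ ∞ (fun q => ((k : ℂ) + 2) * npNum ρ₀ ε G k q) (slab ρ₀) :=
    contDiffOn_const.mul hB
  rw [npNum, dir_iterate_add ((contDiff_tau_factor ε).contDiffOn.mul hT) (hR.add hC) _ p hq]
  beta_reduce
  rw [dirRho_iterate_tau_factor_mul hT ε p hq, dir_iterate_add hR hC _ p hq]
  beta_reduce
  rw [dirRho_iterate_rho_mul hB p hq, dir_iterate_const_mul hB _ _ p hq]
  beta_reduce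
  rw [← dir_iterate_comm hρ₀ hB _ _ p hq]
  simp
  ring

/-- A pointwise differentiable curve in a finite-dimensional space of functions has its derivatives
in that space. -/
lemma deriv_mem_of_finiteDimensional {X : Type*} (W : Submodule ℂ (X → ℂ))
    [FiniteDimensional ℂ W] {u : ℝ → X → ℂ} {u' : X → ℂ} {τ : ℝ}
    (hu : ∀ᶠ t in 𝓝 τ, u t ∈ W) (hd : ∀ x, HasDerivAt (fun t => u t x) (u' x) τ) : u' ∈ W := by
  have hclosed : IsClosed (W : Set (X → ℂ)) := W.closed_of_finiteDimensional
  have hlim : Tendsto (fun t => (((t - τ)⁻¹ : ℝ) : ℂ) • (u t - u τ)) (𝓝[≠] τ) (𝓝 u') := by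
    rw [tendsto_pi_nhds]
    intro x
    refine (hasDerivAt_iff_tendsto_slope.1 (hd x)).congr fun t => ?_
    simp [slope]
  refine hclosed.mem_of_tendsto hlim ?_
  filter_upwards [nhdsWithin_le_nhds hu] with t ht
  exact W.smul_mem _ (W.sub_mem ht hu.self_of_nhds)

/-- The Taylor coefficients of the numerators lie in every finite-dimensional space which contains
those of `G`. -/
lemma dirRho_iterate_npNum_mem (hρ₀ : 0 < ρ₀) (hG : ContDiffOn ℝ ∞ G (slab ρ₀)) (ε : ℝ) (p : ℕ)
    (W : Submodule ℂ ({o : ℂ × ℂ // o ≠ 0} → ℂ)) [FiniteDimensional ℂ W]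
    (hW : ∀ τ ∈ Ioo (-1 : ℝ) 1,
      (fun o : {o : ℂ × ℂ // o ≠ 0} => (dirRho ρ₀)^[p] G (τ, 0, o.1)) ∈ W)
    (k : ℕ) {τ : ℝ} (hτ : τ ∈ Ioo (-1 : ℝ) 1) :
    (fun o : {o : ℂ × ℂ // o ≠ 0} => (dirRho ρ₀)^[p] (npNum ρ₀ ε G k) (τ, 0, o.1)) ∈ W := by
  induction k generalizing τ with
  | zero => exact hW τ hτ
  | succ k ih =>
    have e : (fun o : {o : ℂ × ℂ // o ≠ 0} =>
        (dirRho ρ₀)^[p] (npNum ρ₀ ε G (k + 1)) (τ, 0, o.1)) =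
        ((ε : ℂ) * (1 - ε * (τ : ℂ))) • (fun o : {o : ℂ × ℂ // o ≠ 0} =>
          dirTau ρ₀ ((dirRho ρ₀)^[p] (npNum ρ₀ ε G k)) (τ, 0, o.1)) +
        ((p : ℂ) + (k + 2)) • (fun o : {o : ℂ × ℂ // o ≠ 0} =>
          (dirRho ρ₀)^[p] (npNum ρ₀ ε G k) (τ, 0, o.1)) := by
      ext o
      exact dirRho_iterate_npNum_succ hρ₀ hG ε k p hτ o.2
    rw [e]
    refine W.add_mem (W.smul_mem _ ?_) (W.smul_mem _ (ih hτ))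
    refine deriv_mem_of_finiteDimensional W
      (u := fun t o => (dirRho ρ₀)^[p] (npNum ρ₀ ε G k) (t, 0, o.1)) (τ := τ) ?_ fun o => ?_
    · filter_upwards [isOpen_Ioo.mem_nhds hτ] with t ht using ih ht
    · exact hasDerivAt_tau (contDiffOn_dir_iterate (contDiffOn_npNum hG ε k) _ p) hτ
        ⟨le_rfl, hρ₀⟩ o.2

/-! ### The limit at the cylinder -/

lemma norm_sphereIntegral_le {f : ℂ × ℂ → ℂ} {M : ℝ}
    (h : ∀ ϕ ∈ Icc 0 (2 * Real.pi), ∀ θ ∈ Icc 0 Real.pi, ‖f (spherePoint ϕ θ)‖ ≤ M) :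
    ‖sphereIntegral f‖ ≤ M * Real.pi * (2 * Real.pi) := by
  have hpi := Real.pi_pos
  have hM : 0 ≤ M := (norm_nonneg _).trans (h 0 ⟨le_rfl, by positivity⟩ 0 ⟨le_rfl, hpi.le⟩)
  rw [sphereIntegral_eq]
  have h1 := intervalIntegral.norm_integral_le_of_norm_le_const (a := 0) (b := 2 * Real.pi)
    (C := M * Real.pi) (f := fun ϕ => ∫ θ in (0 : ℝ)..Real.pi,
      f (spherePoint ϕ θ) * (Real.sin θ : ℂ)) (fun ϕ hϕ => by
      rw [uIoc_of_le (by positivity)] at hϕ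
      have h2 := intervalIntegral.norm_integral_le_of_norm_le_const (a := 0) (b := Real.pi)
        (C := M) (f := fun θ => f (spherePoint ϕ θ) * (Real.sin θ : ℂ)) (fun θ hθ => by
          rw [uIoc_of_le hpi.le] at hθ
          rw [norm_mul, Complex.norm_real, Real.norm_eq_abs]
          calc _ ≤ M * 1 := mul_le_mul (h ϕ (Ioc_subset_Icc_self hϕ) θ (Ioc_subset_Icc_self hθ))
                (Real.abs_sin_le_one θ) (abs_nonneg _) hM
            _ = M := mul_one M)
      rwa [sub_zero, abs_of_pos hpi] at h2)
  rwa [sub_zero, abs_of_pos (by positivity)] at h1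

/-- A smooth function whose Taylor coefficients up to order `N` at the cylinder are orthogonal to a
harmonic has a projection of order `ρ ^ (N + 1)` on that harmonic. -/
lemma exists_norm_sphereIntegral_le (hρ₀ : 0 < ρ₀) {B : ℝ × ℝ × (ℂ × ℂ) → ℂ}
    (hB : ContDiffOn ℝ ∞ B (slab ρ₀)) {τ : ℝ} (hτ : τ ∈ Ioo (-1 : ℝ) 1) (s l m : ℤ) (N : ℕ)
    (horth : ∀ p ≤ N, sphereIntegral
      (fun o => conj (Y s l m o) * (dirRho ρ₀)^[p] B (τ, 0, o)) = 0) :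
    ∃ K : ℝ, ∀ r ∈ Icc 0 (ρ₀ / 2),
      ‖sphereIntegral (fun o => conj (Y s l m o) * B (τ, r, o))‖ ≤ K * r ^ (N + 1) := by
  have hsub : Icc 0 (ρ₀ / 2) ⊆ Ico 0 ρ₀ := fun x hx => ⟨hx.1, by linarith [hx.2]⟩
  have hhalf : 0 < ρ₀ / 2 := by linarith
  have hud := uniqueDiffOn_Icc hhalf
  have h0 : (0 : ℝ) ∈ Icc 0 (ρ₀ / 2) := ⟨le_rfl, hhalf.le⟩
  -- uniform bounds on the compact sphere
  obtain ⟨M, hM⟩ : ∃ M, ∀ x ∈ Icc (0 : ℝ) (ρ₀ / 2) ×ˢ (Icc 0 (2 * Real.pi) ×ˢ Icc 0 Real.pi),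
      ‖(dirRho ρ₀)^[N + 1] B (τ, x.1, spherePoint x.2.1 x.2.2)‖ ≤ M := by
    refine (isCompact_Icc.prod (isCompact_Icc.prod isCompact_Icc)).exists_bound_of_continuousOn ?_
    refine (contDiffOn_dir_iterate hB (0, 1, 0) (N + 1)).continuousOn.comp ?_ fun x hx =>
      ⟨hτ, hsub hx.1, spherePoint_ne_zero _ _⟩
    have := continuous_spherePoint
    exact (continuous_const.prodMk (continuous_fst.prodMk
      (this.comp continuous_snd))).continuousOn
  obtain ⟨M', hM'⟩ : ∃ M', ∀ x ∈ Icc (0 : ℝ) (2 * Real.pi) ×ˢ Icc 0 Real.pi,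
      ‖Y s l m (spherePoint x.1 x.2)‖ ≤ M' :=
    (isCompact_Icc.prod isCompact_Icc).exists_bound_of_continuousOn
      (continuous_comp_spherePoint (continuousOn_Y s l m)).continuousOn
  refine ⟨M' * (M / (N ! : ℝ)) * Real.pi * (2 * Real.pi), fun r hr => ?_⟩
  have hcont : ∀ H : ℝ × ℝ × (ℂ × ℂ) → ℂ, ContDiffOn ℝ ∞ H (slab ρ₀) → ∀ r ∈ Icc 0 (ρ₀ / 2),
      Continuous fun x : ℝ × ℝ => conj (Y s l m (spherePoint x.1 x.2)) *
        H (τ, r, spherePoint x.1 x.2) := by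
    intro H hH r hr
    refine (Complex.continuous_conj.comp
      (continuous_comp_spherePoint (continuousOn_Y s l m))).mul ?_
    refine continuous_comp_spherePoint (f := fun o => H (τ, r, o)) ?_
    exact hH.continuousOn.comp (by fun_prop) fun o ho => ⟨hτ, hsub hr, ho⟩
  -- subtracting the Taylor polynomial does not change the projection
  let c : ℕ → ℂ := fun p => (((p ! : ℝ)⁻¹ * (r - 0) ^ p : ℝ) : ℂ)
  have hsum : sphereIntegral (fun o => conj (Y s l m o) * B (τ, r, o)) = sphereIntegral (fun o =>
      conj (Y s l m o) * (B (τ, r, o) -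
        ∑ p ∈ Finset.range (N + 1), c p * (dirRho ρ₀)^[p] B (τ, 0, o))) := by
    let F : Option ℕ → ℂ × ℂ → ℂ := fun i o => i.elim (conj (Y s l m o) * B (τ, r, o))
      fun p => -c p * (conj (Y s l m o) * (dirRho ρ₀)^[p] B (τ, 0, o))
    have h1 := sphereIntegral_sum (Finset.range (N + 1)).insertNone F (by
      intro i _
      rcases i with _ | p
      · exact hcont B hB r hr
      · exact continuous_const.mul (hcont _ (contDiffOn_dir_iterate hB _ p) 0 h0))
    rw [Finset.sum_insertNone] at h1
    have h2 : ∑ p ∈ Finset.range (N + 1), sphereIntegral (F (some p)) = 0 := by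
      refine Finset.sum_eq_zero fun p hp => ?_
      have := sphereIntegral_const_mul (-c p)
        (fun o => conj (Y s l m o) * (dirRho ρ₀)^[p] B (τ, 0, o))
      rw [horth p (by simpa [Nat.lt_succ_iff] using hp), mul_zero] at this
      exact this
    rw [h2, add_zero] at h1
    rw [← show sphereIntegral (F none) = sphereIntegral
      (fun o => conj (Y s l m o) * B (τ, r, o)) from rfl, ← h1]
    congr 1
    ext o
    rw [Finset.sum_insertNone]
    simp only [F, Option.elim]
    rw [mul_sub, Finset.mul_sum, sub_eq_add_neg, ← Finset.sum_neg_distrib]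
    congr 1
    exact Finset.sum_congr rfl fun p _ => by ring
  rw [hsum]
  refine (norm_sphereIntegral_le (M := M' * (M / (N ! : ℝ) * r ^ (N + 1))) ?_).trans
    (le_of_eq (by ring))
  intro ϕ hϕ θ hθ
  have ho := spherePoint_ne_zero ϕ θ
  have hY := hM' (ϕ, θ) ⟨hϕ, hθ⟩
  have hf : ContDiffOn ℝ (N + 1) (fun r => B (τ, r, spherePoint ϕ θ)) (Icc 0 (ρ₀ / 2)) := by
    have h1 : ContDiff ℝ ∞ (fun r : ℝ => ((τ, r, spherePoint ϕ θ) : ℝ × ℝ × (ℂ × ℂ))) := by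
      fun_prop
    have h2 : ContDiffOn ℝ ∞ (fun r => B (τ, r, spherePoint ϕ θ)) (Icc 0 (ρ₀ / 2)) :=
      hB.comp h1.contDiffOn fun x hx => ⟨hτ, hsub hx, ho⟩
    exact h2.of_le (by exact_mod_cast le_top)
  have ht := taylor_mean_remainder_bound hhalf.le hf hr (C := M) fun y hy => by
    rw [iteratedDerivWithin_rho hB hsub hud hτ hy ho]
    exact hM (y, ϕ, θ) ⟨hy, hϕ, hθ⟩
  rw [taylor_within_apply] at ht
  have e : ∑ p ∈ Finset.range (N + 1), (((p ! : ℝ))⁻¹ * (r - 0) ^ p) •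
      iteratedDerivWithin p (fun r => B (τ, r, spherePoint ϕ θ)) (Icc 0 (ρ₀ / 2)) 0 =
      ∑ p ∈ Finset.range (N + 1), c p * (dirRho ρ₀)^[p] B (τ, 0, spherePoint ϕ θ) := by
    refine Finset.sum_congr rfl fun p _ => ?_
    rw [iteratedDerivWithin_rho hB hsub hud hτ h0 ho, Complex.real_smul]
  rw [e, sub_zero] at ht
  rw [norm_mul, RCLike.norm_conj]
  refine mul_le_mul hY (ht.trans (le_of_eq (by ring))) (norm_nonneg _) ((norm_nonneg _).trans hY)

/-- The labels of the harmonics of degree less than `n + 2` in the Taylor coefficients of order at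
most `n + 3`. -/
def lowLabels (n : ℕ) : Finset (ℤ × ℤ) := (labels (n + 3)).filter fun x => x.1 < n + 2

/-- If the Taylor coefficients of `G` up to order `n + 3` only involve harmonics of degree less than
`n + 2`, then the integral of the `n + 1`-st derivative against a harmonic of degree `n + 2` is
`O(ρ)`: it is `ρ ^ (-(n + 3))` times a function of order `ρ ^ (n + 4)`. -/
lemma tendsto_sphereIntegral_npDeriv (hρ₀ : 0 < ρ₀) (hε : ε = 1 ∨ ε = -1)
    (hG : ContDiffOn ℝ ∞ G (slab ρ₀)) (s m : ℤ) (n : ℕ)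
    (hexp : ∀ p ≤ n + 3, ∀ τ ∈ Ioo (-1 : ℝ) 1, ∃ c : ℤ × ℤ → ℂ, ∀ o : ℂ × ℂ, o ≠ 0 →
      (dirRho ρ₀)^[p] G (τ, 0, o) = ∑ x ∈ lowLabels n, c x * Y s x.1 x.2 o)
    {τ : ℝ} (hτ : τ ∈ Ioo (-1 : ℝ) 1) :
    Tendsto (fun ρ => sphereIntegral (fun o => conj (Y s (n + 2) m o) *
      ((npDeriv ε)^[n + 1]
        (fun t r => G (t, r, o) / ((r : ℂ) ^ 2 * (1 - ε * (t : ℂ)) ^ 4)) τ ρ)))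
      (𝓝[>] 0) (𝓝 0) := by
  let y : ℤ × ℤ → {o : ℂ × ℂ // o ≠ 0} → ℂ := fun x o => Y s x.1 x.2 o.1
  let W : Submodule ℂ ({o : ℂ × ℂ // o ≠ 0} → ℂ) := Submodule.span ℂ (y '' (lowLabels n))
  have hfin : FiniteDimensional ℂ W :=
    FiniteDimensional.span_of_finite ℂ ((lowLabels n).finite_toSet.image y)
  have hW : ∀ p ≤ n + 3, ∀ τ ∈ Ioo (-1 : ℝ) 1,
      (fun o : {o : ℂ × ℂ // o ≠ 0} => (dirRho ρ₀)^[p] G (τ, 0, o.1)) ∈ W := by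
    intro p hp τ hτ
    obtain ⟨c, hc⟩ := hexp p hp τ hτ
    have e : (fun o : {o : ℂ × ℂ // o ≠ 0} => (dirRho ρ₀)^[p] G (τ, 0, o.1)) =
        ∑ x ∈ lowLabels n, c x • y x := by
      ext o; simp [hc o.1 o.2, y]
    rw [e]
    exact W.sum_mem fun x hx => W.smul_mem _ (Submodule.subset_span ⟨x, hx, rfl⟩)
  have hB := contDiffOn_npNum hG ε (n + 1)
  have horth : ∀ p ≤ n + 3, sphereIntegral (fun o => conj (Y s (n + 2) m o) *
      (dirRho ρ₀)^[p] (npNum ρ₀ ε G (n + 1)) (τ, 0, o)) = 0 := by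
    intro p hp
    have hmem := dirRho_iterate_npNum_mem hρ₀ hG ε p W (hW p hp) (n + 1) hτ
    obtain ⟨c, hc⟩ := (Submodule.mem_span_image_finset_iff_exists_fun ℂ).1 hmem
    have h1 : sphereIntegral (fun o => conj (Y s (n + 2) m o) *
        (dirRho ρ₀)^[p] (npNum ρ₀ ε G (n + 1)) (τ, 0, o)) = sphereIntegral (fun o =>
          ∑ x : lowLabels n, c x * (conj (Y s (n + 2) m o) * Y s x.1.1 x.1.2 o)) := by
      simp only [sphereIntegral_eq]
      congr 1; ext ϕ; congr 1; ext θ; congr 1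
      have := congrFun hc ⟨spherePoint ϕ θ, spherePoint_ne_zero ϕ θ⟩
      simp only at this
      rw [← this, Finset.sum_apply, Finset.mul_sum]
      refine Finset.sum_congr rfl fun x _ => ?_
      simp only [Pi.smul_apply, smul_eq_mul, y]
      ring
    rw [h1, sphereIntegral_sum]
    · refine Finset.sum_eq_zero fun x _ => ?_
      have hx := (Finset.mem_filter.1 x.2).2
      rw [sphereIntegral_const_mul, sphereIntegral_conj_Y_mul_Y, mul_zero]
      intro h
      rw [Prod.ext_iff] at h
      simp only at h
      omega
    · intro x _
      exact continuous_const.mul ((Complex.continuous_conj.comp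
        (continuous_comp_spherePoint (continuousOn_Y s _ m))).mul
          (continuous_comp_spherePoint (continuousOn_Y s _ _)))
  obtain ⟨K, hK⟩ := exists_norm_sphereIntegral_le hρ₀ hB hτ s (n + 2) m (n + 3) horth
  let κ : ℂ := ((Real.sqrt 2 / 2 : ℝ) : ℂ) ^ (n + 1) * ((1 - ε * (τ : ℂ)) ^ (2 * (n + 1) + 4))⁻¹
  have hbound : ∀ ρ ∈ Ioc 0 (ρ₀ / 2), ‖sphereIntegral (fun o => conj (Y s (n + 2) m o) *
      ((npDeriv ε)^[n + 1]
        (fun t r => G (t, r, o) / ((r : ℂ) ^ 2 * (1 - ε * (t : ℂ)) ^ 4)) τ ρ))‖ ≤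
      ‖κ‖ * K * ρ := by
    intro ρ hρ
    have hρ' : ρ ∈ Ioo 0 ρ₀ := ⟨hρ.1, by linarith [hρ.2]⟩
    have h1 : sphereIntegral (fun o => conj (Y s (n + 2) m o) * ((npDeriv ε)^[n + 1]
        (fun t r => G (t, r, o) / ((r : ℂ) ^ 2 * (1 - ε * (t : ℂ)) ^ 4)) τ ρ)) =
        κ * ((ρ : ℂ) ^ (n + 1 + 2))⁻¹ * sphereIntegral (fun o => conj (Y s (n + 2) m o) *
          npNum ρ₀ ε G (n + 1) (τ, ρ, o)) := by
      rw [← sphereIntegral_const_mul]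
      simp only [sphereIntegral_eq]
      congr 1; ext ϕ; congr 1; ext θ; congr 1
      rw [npDeriv_iterate hε hG (spherePoint_ne_zero ϕ θ) (n + 1) hτ hρ']
      simp only [κ]
      ring
    have hpos : (0 : ℝ) < ρ ^ (n + 3) := pow_pos hρ.1 _
    rw [h1, norm_mul, norm_mul, norm_inv, norm_pow, Complex.norm_real, Real.norm_of_nonneg hρ.1.le]
    calc ‖κ‖ * (ρ ^ (n + 3))⁻¹ * _ ≤ ‖κ‖ * (ρ ^ (n + 3))⁻¹ * (K * ρ ^ (n + 3 + 1)) :=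
          mul_le_mul_of_nonneg_left (hK ρ ⟨hρ.1.le, hρ.2⟩) (by positivity)
      _ = ‖κ‖ * K * ρ := by rw [pow_succ ρ (n + 3)]; field_simp
  have hlim : Tendsto (fun ρ : ℝ => ‖κ‖ * K * ρ) (𝓝[>] 0) (𝓝 0) := by
    have : Tendsto (fun ρ : ℝ => ‖κ‖ * K * ρ) (𝓝 0) (𝓝 (‖κ‖ * K * 0)) :=
      (continuous_const.mul continuous_id).tendsto 0
    rw [mul_zero] at this
    exact this.mono_left nhdsWithin_le_nhds
  refine squeeze_zero_norm' ?_ hlim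
  filter_upwards [Ioc_mem_nhdsGT (show (0 : ℝ) < ρ₀ / 2 by linarith)] with ρ hρ using hbound ρ hρ

/-- If the top coefficient of order `n + 3` vanishes, the Taylor coefficients up to that order only
involve harmonics of degree less than `n + 2`. -/
lemma HasExpansion.exists_lowLabels (hρ₀ : 0 < ρ₀) (h : HasExpansion ρ₀ Φ a) (i : Fin 5) (n : ℕ)
    (htop : ∀ m ∈ Finset.Icc (-((n + 3 : ℕ) : ℤ)) (n + 3 : ℕ), ∀ τ ∈ Ioo (-1 : ℝ) 1,
      a i (n + 3) (n + 3 : ℕ) m τ = 0) {p : ℕ} (hp : p ≤ n + 3) {τ : ℝ}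
    (hτ : τ ∈ Ioo (-1 : ℝ) 1) : ∃ c : ℤ × ℤ → ℂ, ∀ o : ℂ × ℂ, o ≠ 0 →
      (dirRho ρ₀)^[p] (component Φ i) (τ, 0, o) =
        ∑ x ∈ lowLabels n, c x * Y (2 - (i : ℤ)) x.1 x.2 o := by
  refine ⟨fun x => if x ∈ labels p then a i p (x.1 + 1) x.2 τ else 0, fun o ho => ?_⟩
  rw [h.dirRho_iterate hρ₀ i p hτ ho]
  simp only [ite_mul, zero_mul]
  rw [← Finset.sum_filter]
  symm
  refine Finset.sum_subset (fun x hx => (Finset.mem_filter.1 hx).2) fun x hx hx' => ?_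
  have hx1 := hx
  simp only [labels, Finset.mem_product, Finset.mem_Icc] at hx1
  simp only [lowLabels, labels, Finset.mem_filter, Finset.mem_product, Finset.mem_Icc] at hx'
  have hpn : p = n + 3 := by
    by_contra hne
    exact hx' (by push_cast; omega)
  subst hpn
  have hx2 : x.1 + 1 = ((n + 3 : ℕ) : ℤ) := by
    by_contra hne
    exact hx' (by push_cast at *; omega)
  rw [hx2, htop x.2 (Finset.mem_Icc.2 (by omega)) τ hτ, zero_mul]

end

end Spin2

end

theorem mainTheorem7 (ρ₀ : ℝ) (hρ₀ : 0 < ρ₀)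
    (Φ : Fin 5 → ℝ → ℝ → ℂ × ℂ → ℂ) (a : Fin 5 → ℕ → ℤ → ℤ → ℝ → ℂ)
    (hexp : Spin2.HasExpansion ρ₀ Φ a)
    (hfield : Spin2.FieldEquations ρ₀ Φ ∨ Spin2.TransportEquations a)
    (hsym : Spin2.TimeSymmetric a) :
    (Spin2.Regular a → Spin2.TopDataVanish a) ∧
    (Spin2.TopDataVanish a → ∀ (n : ℕ) (m : ℤ), |m| ≤ n + 2 →
      Spin2.HasNPConstantPlus Φ n m 0 ∧ Spin2.HasNPConstantMinus Φ n m 0) := by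
  refine ⟨fun hr => hr.topDataVanish hρ₀ hexp hfield hsym, fun hv n m _ => ⟨?_, ?_⟩⟩
  · refine ⟨fun _ => 0, fun τ hτ => ?_, tendsto_const_nhds⟩
    have h := Spin2.tendsto_sphereIntegral_npDeriv hρ₀ (ε := 1) (by simp) (hexp.contDiffOn 0)
      (2 - ((0 : Fin 5) : ℕ)) m n
      (fun p hp τ hτ => hexp.exists_lowLabels hρ₀ 0 n (fun m hm τ hτ =>
        (hv.eq_zero hρ₀ hexp hfield (p := n + 3) (by omega) hm hτ).1) hp hτ) hτ
    have h2 := h.const_mul (((-1) ^ (n + 1) / (((n + 1) ! : ℕ) * Real.sqrt 2 ^ (n + 1)) : ℝ) : ℂ)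
    rw [mul_zero, ← Spin2.npDerivPlus_eq, show (2 : ℤ) - ((0 : Fin 5) : ℕ) = 2 from rfl] at h2
    simp only [Complex.ofReal_one, one_mul] at h2
    exact h2
  · refine ⟨fun _ => 0, fun τ hτ => ?_, tendsto_const_nhds⟩
    have h := Spin2.tendsto_sphereIntegral_npDeriv hρ₀ (ε := -1) (by simp) (hexp.contDiffOn 4)
      (2 - ((4 : Fin 5) : ℕ)) m n
      (fun p hp τ hτ => hexp.exists_lowLabels hρ₀ 4 n (fun m hm τ hτ =>
        (hv.eq_zero hρ₀ hexp hfield (p := n + 3) (by omega) hm hτ).2) hp hτ) hτ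
    have h2 := h.const_mul (((-1) ^ (n + 1) / (((n + 1) ! : ℕ) * Real.sqrt 2 ^ (n + 1)) : ℝ) : ℂ)
    rw [mul_zero, ← Spin2.npDerivMinus_eq, show (2 : ℤ) - ((4 : Fin 5) : ℕ) = -2 from rfl] at h2
    simp only [Complex.ofReal_neg, Complex.ofReal_one, neg_mul, one_mul, sub_neg_eq_add] at h2
    exact h2
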